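/- **Setting.** Let $\mathcal A$ be a set of particles with a real symmetric matrix $\mathcal L=(L(\alpha,\beta))_{\alpha,\beta\in\mathcal A}$, positive definite on finitely supported functions, each row having finitely many nonzero entries. Let $\mathcal C$ be a finite set of channels; a channel $\sigma$ is a sequence of particles $\sigma(0),\sigma(1),\dots$ such that, for $k\ge1$, $L(\sigma(k),\beta)=0$ unless $\beta\in\{\sigma(k-1),\sigma(k),\sigma(k+1)\}$, while $\sigma(0)$ also interacts with some particle outside $\sigma$. All particles $\sigma(k)$ ($\sigma\in\mathcal C$, $k\ge0$) are distinct, and the central part $\mathcal A_1=\mathcal A\setminus\{\sigma(k):\sigma\in\mathcal C,\ k\ge1\}$ is finite. Put $\mathfrak a_\sigma(k)=L(\sigma(k),\sigma(k))$, $\mathfrak b_\sigma(k)=-L(\sigma(k),\sigma(k+1))$ and assume $\mathfrak b_\sigma(k)>0$, and that for some $b_\sigma>0$, $a_\sigma\in\mathbb R$, $\epsilon>0$ $$\sum_{k\ge1}(1+\epsilon)^k\{|\mathfrak a_\sigma(k)-a_\sigma|+|\mathfrak b_\sigma(k)-b_\sigma|\}<\infty .$$ Assume that $\bigcup_\sigma(a_\sigma-2b_\sigma,a_\sigma+2b_\sigma)$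 is connected and $\bigcup_\sigma[a_\sigma-2b_\sigma,a_\sigma+2b_\sigma]=[a-2b,a+2b]$, $b>0$. Let $\mathbb D$ be the open unit disk, $\mathbb T$ the unit circle, $W(\omega)=\lambda(\omega)=a-b(\omega+\omega^{-1})$, $W_\sigma(\theta)=a_\sigma-b_\sigma(\theta+\theta^{-1})$, $\theta_\sigma=W_\sigma^{-1}\circ W:\mathbb D\to\mathbb D$, extended continuously to $\overline{\mathbb D}$, and $T_\sigma^+=\{\omega\in\mathbb T:|\theta_\sigma(\omega)|=1\}$. Let $e_\sigma(k,\theta)$, $k\ge0$, be the Jost solutions: holomorphic in $\mathbb D$, continuous on $\overline{\mathbb D}$, with $-\mathfrak b_\sigma(k-1)e_\sigma(k-1,\theta)+\mathfrak a_\sigma(k)e_\sigma(k,\theta)-\mathfrak b_\sigma(k)e_\sigma(k+1,\theta)=W_\sigma(\theta)e_\sigma(k,\theta)$ for $k\ge1$ and $e_\sigma(k,\theta)=\theta^k(1+o(1))$, $k\to\infty$, uniformly on $\overline{\mathbb D}$. Let $p_\sigma(k,\omega)$ solve $$-\mathfrak b_\sigma(k-1)\xi_\sigma(k-1)+\mathfrak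 a_\sigma(k)\xi_\sigma(k)-\mathfrak b_\sigma(k)\xi_\sigma(k+1)=\lambda(\omega)\xi_\sigma(k),\quad k\ge1,\qquad(1)$$ with $p_\sigma(0,\omega)=1$, $p_\sigma(1,\omega)=0$. Let $\mathcal L_1=(L(\alpha,\beta))_{\alpha,\beta\in\mathcal A_1}$, $(r(\alpha,\beta;\lambda))=(\mathcal L_1-\lambda)^{-1}$, $\mathcal R(\lambda)=(r(\sigma(0),\nu(0);\lambda))_{\sigma,\nu\in\mathcal C}$, $B=\mathrm{diag}\{b_\sigma\}$, $B(0)=\mathrm{diag}\{\mathfrak b_\sigma(0)\}$, $\mathcal E(k,\omega)=\mathrm{diag}\{e_\sigma(k,\theta_\sigma(\omega))\}$, $P(k,\omega)=\mathrm{diag}\{p_\sigma(k,\omega)\}$, $D(\omega)=\mathrm{diag}\{\theta_\sigma(\omega)^{-1}-\theta_\sigma(\omega)\}$, $T(\omega)=\mathcal E(0,\omega)-\mathcal R(\lambda(\omega))B(0)\mathcal E(1,\omega)$ and $$U(k,\omega)=[-P(k,\omega)+\mathcal E(k,\omega)T(\omega)^{-1}]\,B\,B(0)^{-1}D(\omega)\,\mathcal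 E(1,\omega)^{-1}.$$ Let $\Omega_0\subset\overline{\mathbb D}$ be the set of $\omega\in\overline{\mathbb D}$ at which this formula is undefined: $\omega=0$, or $\lambda(\omega)$ is an eigenvalue of $\mathcal L_1$, or $\det T(\omega)=0$, or $\det\mathcal E(1,\omega)=0$. Let $\mathcal B$ be the finite set of $\omega\in\mathbb T\setminus\{\pm1\}$ with $\lambda(\omega)=a_\gamma\pm2b_\gamma$ for some $\gamma\in\mathcal C$ (the branch points of the $\theta_\gamma$). A function on $\overline{\mathbb D}$ is called *holomorphic (meromorphic) near* $\omega_0\in\overline{\mathbb D}$ if near $\omega_0$ (punctured at $\omega_0$ in the meromorphic case) it is the restriction to $\overline{\mathbb D}$ of a function of $\omega$ holomorphic (meromorphic) at $\omega_0$ when $\omega_0\notin\mathcal B$, respectively equals $F\big(\sqrt{1-\omega/\omega_0}\big)$ with $F$ holomorphic (meromorphic) at $0$ when $\omega_0\in\mathcal B$. A *special solution* corresponding to $\sigma\in\mathcal C$ is a function $\psi^\sigma(\alpha,\omega)$, $\alpha\in\mathcal A$, $\omega\in\overline{\mathbb D}$, for which there are a finite set $\mathcal O\subset\overline{\mathbb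 D}$ with $\mathcal O\cap T_\sigma^+=\emptyset$ and functions $s_{\gamma\sigma}$, $\gamma\in\mathcal C$, such that 1. each $\psi^\sigma(\alpha,\cdot)$ is holomorphic near every point of $\overline{\mathbb D}\setminus\mathcal O$ and meromorphic near every point of $\mathcal O$, and at each $\omega_0\in\mathcal O$ at least one of the functions $|\psi^\sigma(\alpha,\cdot)|$ tends to $\infty$; 2. $\mathcal L\psi^\sigma(\cdot,\omega)=\lambda(\omega)\psi^\sigma(\cdot,\omega)$ for $\omega\in\overline{\mathbb D}\setminus\mathcal O$; 3. for $\gamma\ne\sigma$, $s_{\gamma\sigma}$ is holomorphic near every point of $\overline{\mathbb D}\setminus\mathcal O$ and meromorphic near every point of $\mathcal O$; $s_{\sigma\sigma}$ is continuous on $T_\sigma^+$; and for all $k\ge0$ $$\psi^\sigma(\sigma(k),\omega)=e_\sigma(k,\theta_\sigma(\omega)^{-1})+s_{\sigma\sigma}(\omega)e_\sigma(k,\theta_\sigma(\omega)),\quad \omega\in T_\sigma^+,$$ $$\psi^\sigma(\gamma(k),\omega)=s_{\gamma\sigma}(\omega)e_\gamma(k,\theta_\gamma(\omega)),\quad \gamma\ne\sigma,\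 \omega\in\overline{\mathbb D}\setminus\mathcal O,$$ while $\psi^\sigma(\sigma(k),\omega)=\theta_\sigma(\omega)^{-k}(1+o(1))$ as $k\to\infty$ for $\omega\in\overline{\mathbb D}\setminus(T_\sigma^+\cup\mathcal O)$. **Lemma.** The set $\Omega_0$ is finite. For every $\omega\in\overline{\mathbb D}\setminus\Omega_0$ the columns of $U(k,\omega)$ satisfy the channel equations (1) and the boundary condition $U(0,\omega)=\mathcal R(\lambda(\omega))B(0)U(1,\omega)$. For every $\sigma\in\mathcal C$ there is a special solution $\psi^\sigma$ corresponding to $\sigma$ such that, for all $\omega\in\overline{\mathbb D}\setminus\Omega_0$, the vector $(\psi^\sigma(\gamma(k),\omega))_{\gamma\in\mathcal C}$ is the $\sigma$-th column of $U(k,\omega)$ for all $k\ge0$, and $$\psi^\sigma(\alpha,\omega)=\sum_{\nu\in\mathcal C}r(\alpha,\nu(0);\lambda(\omega))\,\mathfrak b_\nu(0)\,\psi^\sigma(\nu(1),\omega),\qquad\alpha\in\mathcal A_1.$$ In particular, on $T_\sigma^+\setminus\Omega_0$ the $\sigma$-th column of $U(k,\omega)$ has the representation in 3. -/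

import Mathlib

open Filter Topology Metric Set

/-- A web-like system on the set `A` of particles, with the finite set `C` of channels.
`L` is the interaction matrix, `pt σ k` is the particle `σ(k)` of the channel `σ`,
`aLim σ`, `bLim σ` are the limits of the coefficients along `σ`, and `[a - 2 b, a + 2 b]` is the
union of the bands `[a_σ - 2 b_σ, a_σ + 2 b_σ]`. -/
structure WebSystem (A C : Type*) [Fintype C] where
  L : A → A → ℝ
  pt : C → ℕ → A
  aLim : C → ℝ
  bLim : C → ℝ
  a : ℝ
  b : ℝ
  L_symm : ∀ α β, L α β = L β α
  /-- each particle interacts with finitely many particles -/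
  L_locallyFinite : ∀ α, {β | L α β ≠ 0}.Finite
  /-- strict positivity of `L`, required on finitely supported functions only -/
  L_pos : ∀ ξ : A →₀ ℝ, ξ ≠ 0 → 0 < ξ.sum fun α x => ξ.sum fun β y => L α β * x * y
  /-- all particles `σ(k)` are distinct -/
  pt_injective : Function.Injective fun q : C × ℕ => pt q.1 q.2
  /-- for `k ≥ 1` the particle `σ(k)` interacts with `σ(k-1)`, `σ(k+1)` (and an external field) only -/
  channel : ∀ σ k β, L (pt σ (k + 1)) β ≠ 0 →
    β = pt σ k ∨ β = pt σ (k + 1) ∨ β = pt σ (k + 2)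
  /-- the attachment point `σ(0)` interacts with some particle outside `σ` -/
  attached : ∀ σ, ∃ β, (∀ k, β ≠ pt σ k) ∧ L (pt σ 0) β ≠ 0
  /-- the central part is finite -/
  central_finite : {α : A | ∀ σ k, α ≠ pt σ (k + 1)}.Finite
  /-- the coefficients `𝔟_σ(k) = -L(σ(k), σ(k+1))` are positive -/
  coupling_pos : ∀ σ k, 0 < -L (pt σ k) (pt σ (k + 1))
  bLim_pos : ∀ σ, 0 < bLim σ
  /-- exponentially fast convergence of the coefficients to their limits -/
  decay : ∃ ε : ℝ, 0 < ε ∧ ∀ σ, Summable fun k : ℕ => (1 + ε) ^ (k + 1) *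
    (|L (pt σ (k + 1)) (pt σ (k + 1)) - aLim σ| + |-L (pt σ (k + 1)) (pt σ (k + 2)) - bLim σ|)
  bands_connected :
    IsPreconnected (⋃ σ, Ioo (aLim σ - 2 * bLim σ) (aLim σ + 2 * bLim σ))
  b_pos : 0 < b
  bands_union :
    ⋃ σ, Icc (aLim σ - 2 * bLim σ) (aLim σ + 2 * bLim σ) = Icc (a - 2 * b) (a + 2 * b)

/-- The Zhukovskii function `z ↦ a - b (z + z⁻¹)`. -/
noncomputable def zhukovskii (a b : ℝ) (z : ℂ) : ℂ := a - b * (z + z⁻¹)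

/-- `e` is the family of Jost solutions of the difference equation with coefficients
`𝔞(k)`, `k ≥ 1`, and `𝔟(k)`, `k ≥ 0`, whose limits are `a` and `b`.
On the closed unit disk these conditions determine `e`. -/
structure IsJostFamily (𝔞 𝔟 : ℕ → ℝ) (a b : ℝ) (e : ℕ → ℂ → ℂ) : Prop where
  holomorphic : ∀ k, DifferentiableOn ℂ (e k) (ball 0 1)
  continuous : ∀ k, ContinuousOn (e k) (closedBall 0 1)
  equation : ∀ θ ∈ closedBall (0 : ℂ) 1, θ ≠ 0 → ∀ k : ℕ,
    -(𝔟 k : ℂ) * e k θ + 𝔞 (k + 1) * e (k + 1) θ - 𝔟 (k + 1) * e (k + 2) θ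
      = zhukovskii a b θ * e (k + 1) θ
  /-- `e(k, θ) = θ ^ k (1 + o(1))` as `k → ∞`, uniformly in `θ` -/
  asymptotics : TendstoUniformlyOn (fun (k : ℕ) (θ : ℂ) => e k θ / θ ^ k) (fun _ => 1) atTop
    (closedBall 0 1 \ {0})

/-- The solution `p` of the difference equation at the spectral parameter `l` with
`p(0) = 1`, `p(1) = 0`. -/
noncomputable def regularSolution (𝔞 𝔟 : ℕ → ℝ) (l : ℂ) : ℕ → ℂ
  | 0 => 1
  | 1 => 0
  | k + 2 => ((𝔞 (k + 1) - l) * regularSolution 𝔞 𝔟 l (k + 1)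
      - 𝔟 k * regularSolution 𝔞 𝔟 l k) / 𝔟 (k + 1)

namespace WebSystem

variable {A C : Type*} [Fintype C] (S : WebSystem A C)

/-- `𝔞_σ(k) = L(σ(k), σ(k))` -/
def coefA (σ : C) (k : ℕ) : ℝ := S.L (S.pt σ k) (S.pt σ k)

/-- `𝔟_σ(k) = -L(σ(k), σ(k+1))` -/
def coefB (σ : C) (k : ℕ) : ℝ := -S.L (S.pt σ k) (S.pt σ (k + 1))

/-- The action of the infinite matrix `L` on functions on `A`
(the sum has finitely many nonzero terms). -/
noncomputable def apply (ξ : A → ℂ) (α : A) : ℂ := ∑ᶠ β, (S.L α β : ℂ) * ξ β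

/-- The central part `A₁`: all particles other than `σ(k)`, `k ≥ 1`. -/
def central : Set A := {α | ∀ σ k, α ≠ S.pt σ (k + 1)}

noncomputable instance : Fintype S.central := S.central_finite.fintype

/-- The attachment point `σ(0)` as an element of the central part. -/
def attach (σ : C) : S.central :=
  ⟨S.pt σ 0, fun ν k h => by
    have := S.pt_injective (a₁ := (σ, 0)) (a₂ := (ν, k + 1)) h
    simp at this⟩

/-- The truncation of `L` to the central part. -/
def centralMatrix : Matrix S.central S.central ℂ := Matrix.of fun α β => (S.L α β : ℂ)

open scoped Classical in
/-- `l` is an eigenvalue of the truncated matrix. -/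
def IsCentralEigenvalue (l : ℂ) : Prop := (S.centralMatrix - l • 1).det = 0

open scoped Classical in
/-- The matrix `(r(α, β; l))`, the inverse of `L₁ - l`. -/
noncomputable def r (l : ℂ) : Matrix S.central S.central ℂ := (S.centralMatrix - l • 1)⁻¹

/-- The matrix `(r(σ(0), ν(0); l))` indexed by channels. -/
noncomputable def R (l : ℂ) : Matrix C C ℂ :=
  Matrix.of fun σ ν => S.r l (S.attach σ) (S.attach ν)

/-- The spectral parameter `λ(ω) = a - b (ω + ω⁻¹)`. -/
noncomputable def lam (ω : ℂ) : ℂ := zhukovskii S.a S.b ω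

/-- The map `θ_σ = W_σ⁻¹ ∘ W` of the unit disk, extended by continuity to the closed disk.
Here `W_σ⁻¹` takes values in the unit disk; the continuous extension also gives `θ_σ(0) = 0`. -/
noncomputable def theta (σ : C) : ℂ → ℂ :=
  extendFrom (ball (0 : ℂ) 1 \ {0}) fun ω =>
    Function.invFunOn (zhukovskii (S.aLim σ) (S.bLim σ)) (ball (0 : ℂ) 1 \ {0}) (S.lam ω)

/-- `T_σ⁺`, the part of the unit circle which `θ_σ` maps to the unit circle. -/
def Tplus (σ : C) : Set ℂ := {ω | ω ∈ sphere (0 : ℂ) 1 ∧ ‖S.theta σ ω‖ = 1}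

/-- The Jost solutions `e_σ(k, θ)` on the channel `σ`. -/
noncomputable def jost (σ : C) : ℕ → ℂ → ℂ :=
  Classical.epsilon (IsJostFamily (S.coefA σ) (S.coefB σ) (S.aLim σ) (S.bLim σ))

/-- The points `ω ≠ ±1` of the unit circle where `λ(ω)` is an end point of a band:
the branch points of the functions `θ_γ`. -/
def bandEdges : Set ℂ :=
  {ω | ω ∈ sphere (0 : ℂ) 1 ∧ ω ≠ 1 ∧ ω ≠ -1 ∧
    ∃ γ, S.lam ω = ((S.aLim γ - 2 * S.bLim γ : ℝ) : ℂ) ∨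
      S.lam ω = ((S.aLim γ + 2 * S.bLim γ : ℝ) : ℂ)}

open scoped Classical in
/-- The local parameter at a point `ω₀` of the closed disk: `ω - ω₀`, except at the branch points,
where it is `√(1 - ω / ω₀)` (principal branch). -/
noncomputable def localParam (ω₀ ω : ℂ) : ℂ :=
  if ω₀ ∈ S.bandEdges then (1 - ω / ω₀) ^ (1 / 2 : ℂ) else ω - ω₀

/-- Near `ω₀`, the function `f` on the closed disk is a holomorphic function of the local
parameter. At a point `ω₀` that is not a branch point this says that `f` extends holomorphically
to a full neighbourhood of `ω₀`. -/
def HolomorphicNear (f : ℂ → ℂ) (ω₀ : ℂ) : Prop :=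
  ∃ F : ℂ → ℂ, AnalyticAt ℂ F 0 ∧
    ∀ᶠ ω in 𝓝[closedBall (0 : ℂ) 1] ω₀, f ω = F (S.localParam ω₀ ω)

/-- Near `ω₀`, the function `f` on the closed disk is a meromorphic function of the local
parameter. -/
def MeromorphicNear (f : ℂ → ℂ) (ω₀ : ℂ) : Prop :=
  ∃ F : ℂ → ℂ, MeromorphicAt F 0 ∧
    ∀ᶠ ω in 𝓝[closedBall (0 : ℂ) 1 \ {ω₀}] ω₀, f ω = F (S.localParam ω₀ ω)

/-- `ψ` is a special solution corresponding to the channel `σ`, with set of poles `O` and with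
scattering coefficients `s γ = s_{γσ}`. -/
structure IsSpecialSolution (σ : C) (O : Set ℂ) (ψ : A → ℂ → ℂ) (s : C → ℂ → ℂ) : Prop where
  finite : O.Finite
  subset : O ⊆ closedBall 0 1
  holomorphic : ∀ α, ∀ ω₀ ∈ closedBall (0 : ℂ) 1 \ O, S.HolomorphicNear (ψ α) ω₀
  meromorphic : ∀ α, ∀ ω₀ ∈ O, S.MeromorphicNear (ψ α) ω₀
  /-- the points of `O` are indeed poles -/
  pole : ∀ ω₀ ∈ O, ∃ α,
    Tendsto (fun ω => ‖ψ α ω‖) (𝓝[closedBall (0 : ℂ) 1 \ {ω₀}] ω₀) atTop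
  /-- no pole lies on `T_σ⁺` -/
  disjoint : Disjoint O (S.Tplus σ)
  equation : ∀ ω ∈ closedBall (0 : ℂ) 1 \ O, ∀ α,
    S.apply (fun β => ψ β ω) α = S.lam ω * ψ α ω
  s_holomorphic : ∀ γ, γ ≠ σ → ∀ ω₀ ∈ closedBall (0 : ℂ) 1 \ O, S.HolomorphicNear (s γ) ω₀
  s_meromorphic : ∀ γ, γ ≠ σ → ∀ ω₀ ∈ O, S.MeromorphicNear (s γ) ω₀
  s_continuous : ContinuousOn (s σ) (S.Tplus σ)
  along_self : ∀ ω ∈ S.Tplus σ, ∀ k,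
    ψ (S.pt σ k) ω = S.jost σ k (S.theta σ ω)⁻¹ + s σ ω * S.jost σ k (S.theta σ ω)
  along_other : ∀ γ, γ ≠ σ → ∀ ω ∈ closedBall (0 : ℂ) 1 \ O, ∀ k,
    ψ (S.pt γ k) ω = s γ ω * S.jost γ k (S.theta γ ω)
  /-- `ψ(σ(k), ω) = θ_σ(ω) ^ (-k) (1 + o(1))` as `k → ∞`, off `T_σ⁺` -/
  along_self_off : ∀ ω ∈ closedBall (0 : ℂ) 1 \ O, ω ∉ S.Tplus σ →
    Tendsto (fun k : ℕ => ψ (S.pt σ k) ω / (S.theta σ ω)⁻¹ ^ k) atTop (𝓝 1)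

variable [DecidableEq C]

/-- `B = diag {b_σ}` -/
def B : Matrix C C ℂ := Matrix.diagonal fun σ => (S.bLim σ : ℂ)

/-- `B(0) = diag {𝔟_σ(0)}` -/
def B0 : Matrix C C ℂ := Matrix.diagonal fun σ => (S.coefB σ 0 : ℂ)

/-- `E(k, ω) = diag {e_σ(k, θ_σ(ω))}` -/
noncomputable def E (k : ℕ) (ω : ℂ) : Matrix C C ℂ :=
  Matrix.diagonal fun σ => S.jost σ k (S.theta σ ω)

/-- `P(k, ω) = diag {p_σ(k, ω)}` -/
noncomputable def P (k : ℕ) (ω : ℂ) : Matrix C C ℂ :=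
  Matrix.diagonal fun σ => regularSolution (S.coefA σ) (S.coefB σ) (S.lam ω) k

/-- `D(ω) = diag {θ_σ(ω)⁻¹ - θ_σ(ω)}` -/
noncomputable def D (ω : ℂ) : Matrix C C ℂ :=
  Matrix.diagonal fun σ => (S.theta σ ω)⁻¹ - S.theta σ ω

/-- `T(ω) = E(0, ω) - R(λ(ω)) B(0) E(1, ω)` -/
noncomputable def T (ω : ℂ) : Matrix C C ℂ := S.E 0 ω - S.R (S.lam ω) * S.B0 * S.E 1 ω

/-- `U(k, ω) = [-P(k, ω) + E(k, ω) T(ω)⁻¹] B B(0)⁻¹ D(ω) E(1, ω)⁻¹` -/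
noncomputable def U (k : ℕ) (ω : ℂ) : Matrix C C ℂ :=
  (-S.P k ω + S.E k ω * (S.T ω)⁻¹) * S.B * S.B0⁻¹ * S.D ω * (S.E 1 ω)⁻¹

/-- The points of the closed disk where the formula for `U(k, ω)` is not defined. -/
def undefinedSet : Set ℂ :=
  {ω | ω ∈ closedBall (0 : ℂ) 1 ∧
    (ω = 0 ∨ S.IsCentralEigenvalue (S.lam ω) ∨ (S.T ω).det = 0 ∨ (S.E 1 ω).det = 0)}

end WebSystem

/-!
Inside the disk `θ_γ` is the small root of `θ + θ⁻¹ = (a_γ - λ(ω)) / b_γ`. Its discriminant has, at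
each point of the unit circle, a holomorphic square root in the local parameter
(`exists_sq_eq_discriminant`), so `θ_γ` is holomorphic near every point of the closed disk
(`holomorphicNear_theta`). The exponential decay of the perturbation makes `e_γ(k, θ) / θ ^ k`
holomorphic in a disk of radius larger than one (`exists_jost`). Therefore all entries of `U(k, ω)`
are meromorphic near every point of the closed disk. As `ω → 0`, `T(ω)` tends to the
invertible matrix `E(0, 0)`; the other determinants that define the exceptional set are nonzero near
the origin as well, and by compactness and connectedness of the disk all of them have finitely many
zeros (`undefinedSet_finite`).

The column of `U` with index `σ` solves the channel equations, being a combination of `p` and of Jost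
solutions, and the boundary condition at `k = 0` is what makes the resolvent formula an extension of
it to a solution on the central part (`rawSolution`). Its continuous extension across the removable
points of the exceptional set is the special solution; what remains of the exceptional set is the set
of poles. The scattering representation follows from constancy of the Wronskian: on `σ` the Wronskian
with the Jost solution equals that of `e_σ(k, θ⁻¹)`, and on the other channels it vanishes, so the
solution is determined up to a multiple of the Jost solution (`specialSolution_self_eq`,
`specialSolution_other_eq`). Off `T_σ⁺` the same Wronskian fixes the growth `θ_σ ^ (-k)`
(`tendsto_specialSolution_self`).

The heart of the matter is that no pole lies on `T_σ⁺` (`disjoint_poles_Tplus`). Green's formula for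
the solution and its conjugate inside the disk expresses its energy off the channel `σ` through the
flux entering from `σ` (`sq_im_lam_mul_energy_le`). At the boundary the flux equals
`(1 - |s_σσ|²)` times that of the incoming wave, whence `|s_σσ| ≤ 1` and the solution has no pole on
the channel `σ` (`exists_tendsto_rawSolution_self`). If some other component had a pole, the leading
coefficient `φ` there would be a nonzero eigenfunction that vanishes on `σ` and is a multiple of the
Jost solution on every other channel (`exists_leading_solution`). The energy bound, used along a path
on which `Im λ` dominates the square of the local parameter (`exists_neBot_approach`), shows that `φ`
has finite energy on each channel (`exists_energy_le`), so it has no component along the oscillating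
Jost solutions. Finally Green's formula for the solution at `ω` inside the disk and `conj φ` makes
them orthogonal, and in the limit `φ` is orthogonal to itself (`eq_zero_of_tendsto_of_decay`).
-/

/-! ### The local parameter on the closed disk -/

/-- A holomorphic function has a holomorphic square root near a point where it does not vanish. -/
theorem AnalyticAt.exists_sq_eq {G : ℂ → ℂ} {z : ℂ} (hG : AnalyticAt ℂ G z) (h0 : G z ≠ 0) :
    ∃ h : ℂ → ℂ, AnalyticAt ℂ h z ∧ ∀ᶠ t in 𝓝 z, h t ^ 2 = G t := by
  have hq : ∀ w : ℂ, (w ^ (1 / 2 : ℂ)) ^ 2 = w := fun w => by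
    rw [← Complex.cpow_nat_mul]; norm_num
  refine ⟨fun t => G z ^ (1 / 2 : ℂ) * (G t / G z) ^ (1 / 2 : ℂ), ?_, Eventually.of_forall fun t => ?_⟩
  · refine analyticAt_const.mul (AnalyticAt.cpow (hG.div analyticAt_const h0) analyticAt_const ?_)
    simp [h0]
  · rw [mul_pow, hq, hq]
    field_simp

namespace WebSystem

variable {A C : Type*} [Fintype C] (S : WebSystem A C)

theorem norm_eq_one_of_mem_bandEdges {ω₀ : ℂ} (h : ω₀ ∈ S.bandEdges) : ‖ω₀‖ = 1 := by
  simpa using h.1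

/-- The inverse of the local parameter at `ω₀`: it expresses `ω` through the parameter. -/
noncomputable def chart (ω₀ t : ℂ) : ℂ :=
  open scoped Classical in if ω₀ ∈ S.bandEdges then ω₀ * (1 - t ^ 2) else ω₀ + t

theorem chart_zero (ω₀ : ℂ) : S.chart ω₀ 0 = ω₀ := by
  simp [chart]

theorem analyticAt_chart (ω₀ t : ℂ) : AnalyticAt ℂ (S.chart ω₀) t := by
  by_cases h : ω₀ ∈ S.bandEdges
  · have : S.chart ω₀ = fun t => ω₀ * (1 - t ^ 2) := by ext; simp [chart, h]
    rw [this]; fun_prop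
  · have : S.chart ω₀ = fun t => ω₀ + t := by ext; simp [chart, h]
    rw [this]; fun_prop

theorem chart_localParam (ω₀ ω : ℂ) : S.chart ω₀ (S.localParam ω₀ ω) = ω := by
  by_cases h : ω₀ ∈ S.bandEdges
  · have h1 := S.norm_eq_one_of_mem_bandEdges h
    have h0 : ω₀ ≠ 0 := by rintro rfl; simp at h1
    have : ((1 - ω / ω₀) ^ (1 / 2 : ℂ)) ^ 2 = 1 - ω / ω₀ := by
      rw [← Complex.cpow_nat_mul]; norm_num
    simp only [chart, localParam, h, if_true, this]
    field_simp
    ring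
  · simp [chart, localParam, h]

theorem localParam_self (ω₀ : ℂ) : S.localParam ω₀ ω₀ = 0 := by
  by_cases h : ω₀ ∈ S.bandEdges
  · have h1 := S.norm_eq_one_of_mem_bandEdges h
    have h0 : ω₀ ≠ 0 := by rintro rfl; simp at h1
    simp [localParam, h, h0]
  · simp [localParam, h]

theorem localParam_ne_zero {ω₀ ω : ℂ} (h : ω ≠ ω₀) : S.localParam ω₀ ω ≠ 0 := by
  intro h0
  apply h
  rw [← S.chart_localParam ω₀ ω, h0, chart_zero]

theorem norm_localParam_of_mem {ω₀ ω : ℂ} (h : ω₀ ∈ S.bandEdges) :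
    ‖S.localParam ω₀ ω‖ ^ 2 = ‖ω - ω₀‖ := by
  have h1 := S.norm_eq_one_of_mem_bandEdges h
  have h0 : ω₀ ≠ 0 := by rintro rfl; simp at h1
  have h2 := S.chart_localParam ω₀ ω
  simp only [chart, h, if_true] at h2
  have h3 : ω - ω₀ = - (ω₀ * S.localParam ω₀ ω ^ 2) := by rw [← h2] ; rw [h2]; linear_combination -h2
  rw [h3, norm_neg, norm_mul, h1, norm_pow, one_mul]

theorem norm_localParam_of_notMem {ω₀ ω : ℂ} (h : ω₀ ∉ S.bandEdges) :
    ‖S.localParam ω₀ ω‖ = ‖ω - ω₀‖ := by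
  simp [localParam, h]

theorem continuousOn_localParam (ω₀ : ℂ) : ContinuousOn (S.localParam ω₀) (closedBall 0 1) := by
  intro ω hω
  by_cases h : ω₀ ∈ S.bandEdges
  · by_cases hne : ω = ω₀
    · subst hne
      apply ContinuousAt.continuousWithinAt
      rw [ContinuousAt, localParam_self, tendsto_zero_iff_norm_tendsto_zero]
      have : ∀ ω', ‖S.localParam ω ω'‖ = Real.sqrt ‖ω' - ω‖ := fun ω' => by
        rw [← S.norm_localParam_of_mem h, Real.sqrt_sq (norm_nonneg _)]
      simp only [this]
      have : Tendsto (fun ω' : ℂ => Real.sqrt ‖ω' - ω‖) (𝓝 ω) (𝓝 (Real.sqrt ‖ω - ω‖)) :=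
        Continuous.tendsto (by fun_prop) ω
      simpa using this
    · have h1 := S.norm_eq_one_of_mem_bandEdges h
      have h0 : ω₀ ≠ 0 := by rintro rfl; simp at h1
      have hq : ‖ω / ω₀‖ ≤ 1 := by simpa [h1] using hω
      -- `1 - ω / ω₀` has nonnegative real part and vanishes only at `ω = ω₀`
      have hsl : 1 - ω / ω₀ ∈ Complex.slitPlane := by
        rw [Complex.mem_slitPlane_iff]
        by_contra hcon
        push Not at hcon
        have hre : (ω / ω₀).re = 1 := by
          have := (Complex.abs_re_le_norm (ω / ω₀)).trans hq
          have h2 := hcon.1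
          simp at h2
          linarith [(abs_le.mp this).2]
        have him : (ω / ω₀).im = 0 := by
          have := hcon.2
          simpa using this
        have : ω / ω₀ = 1 := Complex.ext (by simpa using hre) (by simpa using him)
        exact hne (by rwa [div_eq_one_iff_eq h0] at this)
      have heq : S.localParam ω₀ = fun ω => (1 - ω / ω₀) ^ (1 / 2 : ℂ) := by
        ext; simp [localParam, h]
      rw [heq]
      apply ContinuousAt.continuousWithinAt
      exact ContinuousAt.cpow (by fun_prop) (by fun_prop) hsl
  · have heq : S.localParam ω₀ = fun ω => ω - ω₀ := by ext; simp [localParam, h]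
    rw [heq]; fun_prop

theorem tendsto_localParam {ω₀ : ℂ} (h : ω₀ ∈ closedBall (0 : ℂ) 1) :
    Tendsto (S.localParam ω₀) (𝓝[closedBall 0 1] ω₀) (𝓝 0) := by
  have := S.continuousOn_localParam ω₀ ω₀ h
  rwa [ContinuousWithinAt, localParam_self] at this

theorem tendsto_localParam_ne {ω₀ : ℂ} (h : ω₀ ∈ closedBall (0 : ℂ) 1) :
    Tendsto (S.localParam ω₀) (𝓝[closedBall 0 1 \ {ω₀}] ω₀) (𝓝[≠] 0) := by
  rw [tendsto_nhdsWithin_iff]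
  refine ⟨(S.tendsto_localParam h).mono_left (nhdsWithin_mono _ sdiff_subset), ?_⟩
  filter_upwards [self_mem_nhdsWithin] with ω hω
  exact S.localParam_ne_zero hω.2

theorem closedBall_subset_closure_ball_diff {F : Set ℂ} (hF : F.Finite) :
    closedBall (0 : ℂ) 1 ⊆ closure (ball 0 1 \ F) := by
  rw [← closure_ball (0 : ℂ) one_ne_zero]
  apply closure_minimal _ isClosed_closure
  have : Dense (Fᶜ : Set ℂ) := hF.countable.dense_compl ℂ
  have := this.open_subset_closure_inter (isOpen_ball (x := (0 : ℂ)) (ε := 1))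
  rwa [sdiff_eq]

theorem neBot_ball_diff {F : Set ℂ} (hF : F.Finite) {ω₀ : ℂ} (h : ω₀ ∈ closedBall (0 : ℂ) 1) :
    (𝓝[ball 0 1 \ F] ω₀).NeBot :=
  mem_closure_iff_nhdsWithin_neBot.mp (closedBall_subset_closure_ball_diff hF h)

theorem neBot_closedBall_diff {F : Set ℂ} (hF : F.Finite) {ω₀ : ℂ}
    (h : ω₀ ∈ closedBall (0 : ℂ) 1) : (𝓝[closedBall 0 1 \ F] ω₀).NeBot :=
  (neBot_ball_diff hF h).mono (nhdsWithin_mono _ (sdiff_subset_sdiff_left ball_subset_closedBall))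

/-! ### Functions holomorphic or meromorphic in the local parameter -/

variable {S}

theorem HolomorphicNear.of_analyticAt {f : ℂ → ℂ} {ω₀ : ℂ} (hf : AnalyticAt ℂ f ω₀) :
    S.HolomorphicNear f ω₀ := by
  refine ⟨f ∘ S.chart ω₀, ?_, ?_⟩
  · exact AnalyticAt.comp (by rwa [chart_zero]) (S.analyticAt_chart ω₀ 0)
  · exact Eventually.of_forall fun ω => by simp [chart_localParam]

theorem HolomorphicNear.comp_analyticAt {f g : ℂ → ℂ} {ω₀ : ℂ} (hf : S.HolomorphicNear f ω₀)
    (hω : ω₀ ∈ closedBall (0 : ℂ) 1) (hg : AnalyticAt ℂ g (f ω₀)) :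
    S.HolomorphicNear (fun ω => g (f ω)) ω₀ := by
  obtain ⟨F, hF, h⟩ := hf
  have h0 := h.self_of_nhdsWithin hω
  rw [localParam_self] at h0
  refine ⟨g ∘ F, AnalyticAt.comp (h0 ▸ hg) hF, ?_⟩
  filter_upwards [h] with ω hω
  simp [hω]

theorem HolomorphicNear.continuousWithinAt {f : ℂ → ℂ} {ω₀ : ℂ} (hf : S.HolomorphicNear f ω₀)
    (hω : ω₀ ∈ closedBall (0 : ℂ) 1) : ContinuousWithinAt f (closedBall 0 1) ω₀ := by
  obtain ⟨F, hF, h⟩ := hf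
  have h0 := h.self_of_nhdsWithin hω
  rw [localParam_self] at h0
  rw [ContinuousWithinAt, h0]
  refine Tendsto.congr' (f₁ := fun ω => F (S.localParam ω₀ ω)) ?_
    (hF.continuousAt.tendsto.comp (S.tendsto_localParam hω))
  filter_upwards [h] with ω hω using hω.symm

theorem HolomorphicNear.meromorphicNear {f : ℂ → ℂ} {ω₀ : ℂ} (hf : S.HolomorphicNear f ω₀) :
    S.MeromorphicNear f ω₀ := by
  obtain ⟨F, hF, h⟩ := hf
  exact ⟨F, hF.meromorphicAt, h.filter_mono (nhdsWithin_mono _ sdiff_subset)⟩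

theorem HolomorphicNear.congr {f g : ℂ → ℂ} {ω₀ : ℂ} (hf : S.HolomorphicNear f ω₀)
    (h : f =ᶠ[𝓝[closedBall 0 1] ω₀] g) : S.HolomorphicNear g ω₀ := by
  obtain ⟨F, hF, h'⟩ := hf
  refine ⟨F, hF, ?_⟩
  filter_upwards [h, h'] with ω h1 h2
  rw [← h1, h2]

theorem MeromorphicNear.congr {f g : ℂ → ℂ} {ω₀ : ℂ} (hf : S.MeromorphicNear f ω₀)
    (h : f =ᶠ[𝓝[closedBall 0 1 \ {ω₀}] ω₀] g) : S.MeromorphicNear g ω₀ := by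
  obtain ⟨F, hF, h'⟩ := hf
  refine ⟨F, hF, ?_⟩
  filter_upwards [h, h'] with ω h1 h2
  rw [← h1, h2]

theorem MeromorphicNear.of_meromorphicAt {f : ℂ → ℂ} {ω₀ : ℂ} (hf : MeromorphicAt f ω₀) :
    S.MeromorphicNear f ω₀ := by
  refine ⟨f ∘ S.chart ω₀, ?_, ?_⟩
  · exact MeromorphicAt.comp_analyticAt (by rwa [chart_zero]) (S.analyticAt_chart ω₀ 0)
  · exact Eventually.of_forall fun ω => by simp [chart_localParam]

theorem MeromorphicNear.const (c : ℂ) (ω₀ : ℂ) : S.MeromorphicNear (fun _ => c) ω₀ :=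
  ⟨fun _ => c, MeromorphicAt.const c 0, Eventually.of_forall fun _ => rfl⟩

theorem MeromorphicNear.add {f g : ℂ → ℂ} {ω₀ : ℂ} (hf : S.MeromorphicNear f ω₀)
    (hg : S.MeromorphicNear g ω₀) : S.MeromorphicNear (fun ω => f ω + g ω) ω₀ := by
  obtain ⟨F, hF, h⟩ := hf
  obtain ⟨G, hG, h'⟩ := hg
  refine ⟨F + G, hF.add hG, ?_⟩
  filter_upwards [h, h'] with ω h1 h2
  simp [h1, h2]

theorem MeromorphicNear.mul {f g : ℂ → ℂ} {ω₀ : ℂ} (hf : S.MeromorphicNear f ω₀)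
    (hg : S.MeromorphicNear g ω₀) : S.MeromorphicNear (fun ω => f ω * g ω) ω₀ := by
  obtain ⟨F, hF, h⟩ := hf
  obtain ⟨G, hG, h'⟩ := hg
  refine ⟨F * G, hF.mul hG, ?_⟩
  filter_upwards [h, h'] with ω h1 h2
  simp [h1, h2]

theorem MeromorphicNear.inv {f : ℂ → ℂ} {ω₀ : ℂ} (hf : S.MeromorphicNear f ω₀) :
    S.MeromorphicNear (fun ω => (f ω)⁻¹) ω₀ := by
  obtain ⟨F, hF, h⟩ := hf
  refine ⟨F⁻¹, hF.inv, ?_⟩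
  filter_upwards [h] with ω h1
  simp [h1]

theorem MeromorphicNear.neg {f : ℂ → ℂ} {ω₀ : ℂ} (hf : S.MeromorphicNear f ω₀) :
    S.MeromorphicNear (fun ω => -f ω) ω₀ := by
  simpa using (MeromorphicNear.const (-1) ω₀).mul hf

theorem MeromorphicNear.sub {f g : ℂ → ℂ} {ω₀ : ℂ} (hf : S.MeromorphicNear f ω₀)
    (hg : S.MeromorphicNear g ω₀) : S.MeromorphicNear (fun ω => f ω - g ω) ω₀ := by
  simpa [sub_eq_add_neg] using hf.add hg.neg

theorem MeromorphicNear.div {f g : ℂ → ℂ} {ω₀ : ℂ} (hf : S.MeromorphicNear f ω₀)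
    (hg : S.MeromorphicNear g ω₀) : S.MeromorphicNear (fun ω => f ω / g ω) ω₀ := by
  simpa [div_eq_mul_inv] using hf.mul hg.inv

theorem MeromorphicNear.sum {ι : Type*} {f : ι → ℂ → ℂ} {ω₀ : ℂ} (s : Finset ι)
    (hf : ∀ i ∈ s, S.MeromorphicNear (f i) ω₀) :
    S.MeromorphicNear (fun ω => ∑ i ∈ s, f i ω) ω₀ := by
  classical
  induction s using Finset.induction_on with
  | empty => simpa using MeromorphicNear.const 0 ω₀
  | insert i s hi ih =>
    simp only [Finset.sum_insert hi]
    exact (hf i (by simp)).add (ih fun j hj => hf j (by simp [hj]))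

theorem MeromorphicNear.prod {ι : Type*} {f : ι → ℂ → ℂ} {ω₀ : ℂ} (s : Finset ι)
    (hf : ∀ i ∈ s, S.MeromorphicNear (f i) ω₀) :
    S.MeromorphicNear (fun ω => ∏ i ∈ s, f i ω) ω₀ := by
  classical
  induction s using Finset.induction_on with
  | empty => simpa using MeromorphicNear.const 1 ω₀
  | insert i s hi ih =>
    simp only [Finset.prod_insert hi]
    exact (hf i (by simp)).mul (ih fun j hj => hf j (by simp [hj]))

section Matrix

variable {n : Type*} {M N : ℂ → Matrix n n ℂ} {ω₀ : ℂ}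

theorem MeromorphicNear.det [Fintype n] [DecidableEq n]
    (hM : ∀ i j, S.MeromorphicNear (fun ω => M ω i j) ω₀) :
    S.MeromorphicNear (fun ω => (M ω).det) ω₀ := by
  simp only [Matrix.det_apply']
  refine .sum _ fun p _ => (MeromorphicNear.const _ ω₀).mul (.prod _ fun i _ => hM _ _)

theorem MeromorphicNear.matrix_mul [Fintype n]
    (hM : ∀ i j, S.MeromorphicNear (fun ω => M ω i j) ω₀)
    (hN : ∀ i j, S.MeromorphicNear (fun ω => N ω i j) ω₀) (i j : n) :
    S.MeromorphicNear (fun ω => (M ω * N ω) i j) ω₀ := by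
  simp only [Matrix.mul_apply]
  exact .sum _ fun k _ => (hM i k).mul (hN k j)

theorem MeromorphicNear.diagonal [DecidableEq n] {f : n → ℂ → ℂ} (hf : ∀ i, S.MeromorphicNear (f i) ω₀) (i j : n) :
    S.MeromorphicNear (fun ω => (Matrix.diagonal fun k => f k ω) i j) ω₀ := by
  by_cases h : i = j
  · subst h; simpa using hf i
  · simpa [h] using MeromorphicNear.const 0 ω₀

theorem MeromorphicNear.matrix_inv [Fintype n] [DecidableEq n]
    (hM : ∀ i j, S.MeromorphicNear (fun ω => M ω i j) ω₀) (i j : n) :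
    S.MeromorphicNear (fun ω => (M ω)⁻¹ i j) ω₀ := by
  simp only [Matrix.inv_def, Matrix.smul_apply, Matrix.adjugate_apply, Ring.inverse_eq_inv',
    smul_eq_mul]
  refine (MeromorphicNear.det hM).inv.mul (MeromorphicNear.det fun k l => ?_)
  by_cases h : k = j
  · subst h; simpa using MeromorphicNear.const _ ω₀
  · simpa [Matrix.updateRow_ne h] using hM k l

end Matrix

/-- A function meromorphic near `ω₀` which has no pole there agrees, off `ω₀`, with
a holomorphic function of the local parameter. -/
theorem MeromorphicNear.exists_analyticAt {f : ℂ → ℂ} {ω₀ : ℂ} (hω : ω₀ ∈ closedBall (0 : ℂ) 1)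
    (hf : S.MeromorphicNear f ω₀)
    (hno : ¬ Tendsto (fun ω => ‖f ω‖) (𝓝[closedBall (0 : ℂ) 1 \ {ω₀}] ω₀) atTop) :
    ∃ G : ℂ → ℂ, AnalyticAt ℂ G 0 ∧
      ∀ᶠ ω in 𝓝[closedBall (0 : ℂ) 1 \ {ω₀}] ω₀, f ω = G (S.localParam ω₀ ω) := by
  obtain ⟨F, hF, h⟩ := hf
  have hord : 0 ≤ meromorphicOrderAt F 0 := by
    by_contra hneg
    push Not at hneg
    apply hno
    have := (tendsto_norm_cobounded_atTop.comp (tendsto_cobounded_of_meromorphicOrderAt_neg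
      hneg)).comp (S.tendsto_localParam_ne hω)
    refine this.congr' ?_
    filter_upwards [h] with ω hω
    simp [hω]
  obtain ⟨G, hG, hFG⟩ := (MeromorphicAt.meromorphicOrderAt_nonneg_iff hF).mp hord
  refine ⟨G, hG, ?_⟩
  filter_upwards [h, (S.tendsto_localParam_ne hω).eventually hFG] with ω h1 h2
  rw [h1, h2]

theorem MeromorphicNear.holomorphicNear {f : ℂ → ℂ} {ω₀ : ℂ} (hω : ω₀ ∈ closedBall (0 : ℂ) 1)
    (hf : S.MeromorphicNear f ω₀) (hc : ContinuousWithinAt f (closedBall 0 1) ω₀) :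
    S.HolomorphicNear f ω₀ := by
  have hne : (𝓝[closedBall (0 : ℂ) 1 \ {ω₀}] ω₀).NeBot :=
    neBot_closedBall_diff (finite_singleton _) hω
  have hc' : Tendsto f (𝓝[closedBall (0 : ℂ) 1 \ {ω₀}] ω₀) (𝓝 (f ω₀)) :=
    Tendsto.mono_left hc (nhdsWithin_mono _ sdiff_subset)
  obtain ⟨G, hG, h⟩ := hf.exists_analyticAt hω fun h => not_tendsto_nhds_of_tendsto_atTop h _ hc'.norm
  refine ⟨G, hG, ?_⟩
  have h0 : f ω₀ = G 0 := by
    refine tendsto_nhds_unique hc' (Tendsto.congr' ?_ (hG.continuousAt.tendsto.comp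
      ((S.tendsto_localParam_ne hω).mono_right nhdsWithin_le_nhds)))
    filter_upwards [h] with ω hω using hω.symm
  rw [sdiff_eq, nhdsWithin_inter', eventually_inf_principal] at h
  filter_upwards [h] with ω h1
  by_cases hw : ω = ω₀
  · rw [hw, localParam_self, h0]
  · exact h1 hw

/-- Removal of a finite set of singularities: the continuous extension of `f` is holomorphic near
each point which is not a pole. -/
theorem HolomorphicNear.extendFrom {f : ℂ → ℂ} {Ω : Set ℂ} (hΩ : Ω.Finite)
    (hf : ∀ ω ∈ closedBall (0 : ℂ) 1, S.MeromorphicNear f ω)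
    (hc : ∀ ω ∈ closedBall (0 : ℂ) 1 \ Ω, ContinuousWithinAt f (closedBall 0 1) ω) {ω₀ : ℂ}
    (hω : ω₀ ∈ closedBall (0 : ℂ) 1)
    (hno : ¬ Tendsto (fun ω => ‖f ω‖) (𝓝[closedBall (0 : ℂ) 1 \ {ω₀}] ω₀) atTop) :
    S.HolomorphicNear (extendFrom (closedBall 0 1 \ Ω) f) ω₀ := by
  obtain ⟨G, hG, h⟩ := (hf ω₀ hω).exists_analyticAt hω hno
  have hext : ∀ ω ∈ closedBall (0 : ℂ) 1 \ Ω, _root_.extendFrom (closedBall 0 1 \ Ω) f ω = f ω :=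
    extendFrom_extends fun ω hω => (hc ω hω).mono sdiff_subset
  have hnb : (Ω \ {ω₀})ᶜ ∈ 𝓝 ω₀ := (hΩ.subset sdiff_subset).isClosed.isOpen_compl.mem_nhds (by simp)
  have hlim : Tendsto f (𝓝[closedBall (0 : ℂ) 1 \ {ω₀}] ω₀) (𝓝 (G 0)) := by
    refine Tendsto.congr' ?_ (hG.continuousAt.tendsto.comp
      ((S.tendsto_localParam_ne hω).mono_right nhdsWithin_le_nhds))
    filter_upwards [h] with ω hω using hω.symm
  have hne : (𝓝[closedBall (0 : ℂ) 1 \ {ω₀}] ω₀).NeBot :=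
    neBot_closedBall_diff (finite_singleton _) hω
  have h0 : _root_.extendFrom (closedBall 0 1 \ Ω) f ω₀ = G 0 := by
    by_cases hmem : ω₀ ∈ Ω
    · refine extendFrom_eq (mem_closure_iff_nhdsWithin_neBot.mpr (neBot_closedBall_diff hΩ hω))
        (hlim.mono_left (nhdsWithin_mono _ fun x hx => ⟨hx.1, ?_⟩))
      rintro rfl
      exact hx.2 hmem
    · rw [hext ω₀ ⟨hω, hmem⟩]
      exact tendsto_nhds_unique (Tendsto.mono_left (hc ω₀ ⟨hω, hmem⟩)
        (nhdsWithin_mono _ sdiff_subset)) hlim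
  refine ⟨G, hG, ?_⟩
  rw [sdiff_eq, nhdsWithin_inter', eventually_inf_principal] at h
  filter_upwards [h, mem_nhdsWithin_of_mem_nhds hnb, self_mem_nhdsWithin] with ω h1 h2 h3
  by_cases hw : ω = ω₀
  · rw [hw, localParam_self, h0]
  · rw [hext ω ⟨h3, fun hΩ => h2 ⟨hΩ, hw⟩⟩]
    exact h1 hw

theorem MeromorphicNear.extendFrom {f : ℂ → ℂ} {Ω : Set ℂ} (hΩ : Ω.Finite)
    (hc : ∀ ω ∈ closedBall (0 : ℂ) 1 \ Ω, ContinuousWithinAt f (closedBall 0 1) ω) {ω₀ : ℂ}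
    (hf : S.MeromorphicNear f ω₀) :
    S.MeromorphicNear (extendFrom (closedBall 0 1 \ Ω) f) ω₀ := by
  have hext : ∀ ω ∈ closedBall (0 : ℂ) 1 \ Ω, _root_.extendFrom (closedBall 0 1 \ Ω) f ω = f ω :=
    extendFrom_extends fun ω hω => (hc ω hω).mono sdiff_subset
  have hnb : (Ω \ {ω₀})ᶜ ∈ 𝓝 ω₀ := (hΩ.subset sdiff_subset).isClosed.isOpen_compl.mem_nhds (by simp)
  refine hf.congr ?_
  filter_upwards [mem_nhdsWithin_of_mem_nhds hnb, self_mem_nhdsWithin] with ω h2 h3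
  rw [hext ω ⟨h3.1, fun hΩ => h2 ⟨hΩ, h3.2⟩⟩]

/-- A function meromorphic near each point of the closed disk which does not vanish near one
of them has finitely many zeros. -/
theorem finite_zeros_of_meromorphicNear {f : ℂ → ℂ}
    (hf : ∀ ω ∈ closedBall (0 : ℂ) 1, S.MeromorphicNear f ω) {ω₁ : ℂ}
    (hω₁ : ω₁ ∈ closedBall (0 : ℂ) 1)
    (h₁ : ∀ᶠ ω in 𝓝[closedBall (0 : ℂ) 1 \ {ω₁}] ω₁, f ω ≠ 0) :
    {ω ∈ closedBall (0 : ℂ) 1 | f ω = 0}.Finite := by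
  have hdich : ∀ ω₀ ∈ closedBall (0 : ℂ) 1,
      (∀ᶠ ω in 𝓝[closedBall (0 : ℂ) 1 \ {ω₀}] ω₀, f ω = 0) ∨
      (∀ᶠ ω in 𝓝[closedBall (0 : ℂ) 1 \ {ω₀}] ω₀, f ω ≠ 0) := by
    intro ω₀ hω
    obtain ⟨F, hF, h⟩ := hf ω₀ hω
    rcases hF.eventually_eq_zero_or_eventually_ne_zero with h0 | h0
    · left
      filter_upwards [h, (S.tendsto_localParam_ne hω).eventually h0] with ω h1 h2
      rw [h1, h2]
    · right
      filter_upwards [h, (S.tendsto_localParam_ne hω).eventually h0] with ω h1 h2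
      rwa [h1]
  -- a property holding in a punctured neighbourhood of `ω₀` holds in one of each nearby point
  have hopen : ∀ (p : ℂ → Prop) (ω₀ : ℂ), (∀ᶠ ω in 𝓝[closedBall (0 : ℂ) 1 \ {ω₀}] ω₀, p ω) →
      ∀ᶠ ω in 𝓝 ω₀, ∀ᶠ ω' in 𝓝[closedBall (0 : ℂ) 1 \ {ω}] ω, p ω' := by
    intro p ω₀ h
    by_cases hω : ω₀ ∈ closedBall (0 : ℂ) 1
    · rw [eventually_nhdsWithin_iff, _root_.eventually_nhds_iff] at h
      obtain ⟨u, hu, huo, hmem⟩ := h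
      filter_upwards [huo.mem_nhds hmem] with ω hω
      by_cases he : ω = ω₀
      · subst he
        filter_upwards [self_mem_nhdsWithin, mem_nhdsWithin_of_mem_nhds (huo.mem_nhds hmem)]
          with ω' h1 h2 using hu ω' h2 h1
      · have : u ∩ {ω₀}ᶜ ∈ 𝓝 ω := (huo.inter isOpen_compl_singleton).mem_nhds ⟨hω, he⟩
        filter_upwards [self_mem_nhdsWithin, mem_nhdsWithin_of_mem_nhds this] with ω' h1 h2
        exact hu ω' h2.1 ⟨h1.1, h2.2⟩
    · filter_upwards [isClosed_closedBall.isOpen_compl.mem_nhds hω] with ω hω'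
      have : (closedBall (0 : ℂ) 1)ᶜ ∈ 𝓝 ω := isClosed_closedBall.isOpen_compl.mem_nhds hω'
      filter_upwards [self_mem_nhdsWithin, mem_nhdsWithin_of_mem_nhds this] with ω' h1 h2
      exact absurd h1.1 h2
  have hNZ : ∀ ω₀ ∈ closedBall (0 : ℂ) 1,
      ∀ᶠ ω in 𝓝[closedBall (0 : ℂ) 1 \ {ω₀}] ω₀, f ω ≠ 0 := by
    by_contra! hcon
    obtain ⟨ω₂, hω₂, h₂⟩ := hcon
    let U : Set ℂ := {ω | ∀ᶠ ω' in 𝓝[closedBall (0 : ℂ) 1 \ {ω}] ω, f ω' = 0}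
    let V : Set ℂ := {ω | ∀ᶠ ω' in 𝓝[closedBall (0 : ℂ) 1 \ {ω}] ω, f ω' ≠ 0}
    have hU : IsOpen U := isOpen_iff_mem_nhds.mpr fun x hx => hopen _ x hx
    have hV : IsOpen V := isOpen_iff_mem_nhds.mpr fun x hx => hopen _ x hx
    obtain ⟨x, hx, hxU, hxV⟩ := (convex_closedBall (0 : ℂ) 1).isPreconnected U V hU hV
      (fun x hx => hdich x hx) ⟨ω₂, hω₂, (hdich ω₂ hω₂).resolve_right h₂⟩ ⟨ω₁, hω₁, h₁⟩
    have := neBot_closedBall_diff (finite_singleton x) hx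
    have hxU' : ∀ᶠ ω' in 𝓝[closedBall (0 : ℂ) 1 \ {x}] x, f ω' = 0 := hxU
    have hxV' : ∀ᶠ ω' in 𝓝[closedBall (0 : ℂ) 1 \ {x}] x, f ω' ≠ 0 := hxV
    obtain ⟨y, hy1, hy2⟩ := (hxU'.and hxV').exists
    exact hy2 hy1
  -- the zeros are isolated, and the disk is compact
  obtain ⟨s, -, hs⟩ := (isCompact_closedBall (0 : ℂ) 1).elim_nhdsWithin_subcover
    (fun ω₀ => {ω | ω = ω₀ ∨ f ω ≠ 0}) fun ω₀ hω => by
      have := hNZ ω₀ hω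
      rw [sdiff_eq, nhdsWithin_inter', eventually_inf_principal] at this
      filter_upwards [this] with ω h
      exact (em (ω = ω₀)).imp_right h
  refine s.finite_toSet.subset fun ω hω => ?_
  obtain ⟨ω₀, h1, h2⟩ := mem_iUnion₂.mp (hs hω.1)
  rcases h2 with h2 | h2
  · rw [h2]; exact h1
  · exact absurd hω.2 h2

/-- Leading coefficients at a pole: if one member of a finite family has a pole at `ω₀`, a suitable
power of the local parameter turns the whole family into functions with finite limits,
not all of them zero. -/
theorem exists_leading_coefficients {ι : Type*} [Finite ι] {f : ι → ℂ → ℂ} {ω₀ : ℂ}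
    (hω : ω₀ ∈ closedBall (0 : ℂ) 1) (hf : ∀ i, S.MeromorphicNear (f i) ω₀) {i₀ : ι}
    (hpole : Tendsto (fun ω => ‖f i₀ ω‖) (𝓝[closedBall (0 : ℂ) 1 \ {ω₀}] ω₀) atTop) :
    ∃ (m : ℕ) (c : ι → ℂ), m ≠ 0 ∧ (∃ i, c i ≠ 0) ∧ ∀ i,
      Tendsto (fun ω => S.localParam ω₀ ω ^ m * f i ω)
        (𝓝[closedBall (0 : ℂ) 1 \ {ω₀}] ω₀) (𝓝 (c i)) := by
  choose F hF h using hf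
  have hne : (𝓝[closedBall (0 : ℂ) 1 \ {ω₀}] ω₀).NeBot :=
    neBot_closedBall_diff (finite_singleton _) hω
  have : Nonempty ι := ⟨i₀⟩
  obtain ⟨j, hj⟩ := Finite.exists_min fun i => meromorphicOrderAt (F i) 0
  have hi₀ : meromorphicOrderAt (F i₀) 0 < 0 := by
    by_contra hcon
    push Not at hcon
    obtain ⟨c, hc⟩ := tendsto_nhds_of_meromorphicOrderAt_nonneg (hF i₀) hcon
    have h1 := hc.comp (S.tendsto_localParam_ne hω)
    refine not_tendsto_nhds_of_tendsto_atTop hpole ‖c‖ (h1.norm.congr' ?_)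
    filter_upwards [h i₀] with ω hω
    simp [hω]
  have hj0 := (hj i₀).trans_lt hi₀
  obtain ⟨n, hn⟩ := WithTop.ne_top_iff_exists.mp (ne_top_of_lt hj0)
  have hn0 : n < 0 := by rw [← hn] at hj0; exact_mod_cast hj0
  obtain ⟨m, rfl⟩ : ∃ m : ℕ, n = -m := ⟨n.natAbs, by omega⟩
  have hord : ∀ i, meromorphicOrderAt (fun t => (t - 0) ^ m * F i t) 0
      = m + meromorphicOrderAt (F i) 0 := fun i => by
    have hp : MeromorphicAt (fun t : ℂ => (t - 0) ^ m) 0 := by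
      have : AnalyticAt ℂ (fun t : ℂ => (t - 0) ^ m) 0 := by fun_prop
      exact this.meromorphicAt
    have h1 := meromorphicOrderAt_mul hp (hF i)
    have h2 : meromorphicOrderAt (fun t : ℂ => (t - 0) ^ m) 0 = m :=
      fun_meromorphicOrderAt_pow_id_sub_const
    rw [h2] at h1
    exact h1
  have hmer : ∀ i, MeromorphicAt (fun t => (t - 0) ^ m * F i t) 0 := fun i => by
    have : AnalyticAt ℂ (fun t : ℂ => (t - 0) ^ m) 0 := by fun_prop
    exact this.meromorphicAt.mul (hF i)
  have hlim : ∀ i, ∃ c, Tendsto (fun t => (t - 0) ^ m * F i t) (𝓝[≠] 0) (𝓝 c) := fun i => by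
    refine tendsto_nhds_of_meromorphicOrderAt_nonneg (hmer i) ?_
    rw [hord]
    calc (0 : WithTop ℤ) = m + ((-m : ℤ) : WithTop ℤ) := by norm_cast; simp
      _ ≤ _ := by gcongr; rw [hn]; exact hj i
  choose c hc using hlim
  refine ⟨m, c, by rintro rfl; simp at hn0, ⟨j, ?_⟩, fun i => ?_⟩
  · have h0 : meromorphicOrderAt (fun t => (t - 0) ^ m * F j t) 0 = 0 := by
      rw [hord, ← hn]; norm_cast; simp
    obtain ⟨d, hd, hd'⟩ := tendsto_ne_zero_of_meromorphicOrderAt_eq_zero (hmer j) h0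
    rwa [tendsto_nhds_unique (hc j) hd']
  · refine ((hc i).comp (S.tendsto_localParam_ne hω)).congr' ?_
    filter_upwards [h i] with ω hω
    simp [hω]

end WebSystem

/-! ### The Zhukovskii function -/

theorem norm_eq_one_of_add_inv_eq {z : ℂ} (hz : z ≠ 0) {c : ℝ} (h : z + z⁻¹ = c) (hc : |c| ≤ 2) :
    ‖z‖ = 1 := by
  have hn : Complex.normSq z ≠ 0 := by simpa using hz
  have hre := congrArg Complex.re h
  have him := congrArg Complex.im h
  simp only [Complex.add_re, Complex.add_im, Complex.inv_re, Complex.inv_im, Complex.ofReal_re,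
    Complex.ofReal_im] at hre him
  suffices hs : Complex.normSq z = 1 by
    rw [Complex.normSq_eq_norm_sq] at hs
    nlinarith [norm_nonneg z]
  by_contra hne
  have h0 : z.im = 0 := by
    field_simp at him
    have h1 : z.im * (Complex.normSq z - 1) = 0 := by linarith
    exact (mul_eq_zero.mp h1).resolve_right (sub_ne_zero.mpr hne)
  have hsq : Complex.normSq z = z.re ^ 2 := by rw [Complex.normSq_apply, h0]; ring
  rw [hsq] at hre hne hn
  have hx : z.re ≠ 0 := by rintro h; simp [h] at hn
  field_simp at hre
  have hc2 := abs_le.mp hc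
  apply hne
  nlinarith [sq_nonneg (z.re - 1), sq_nonneg (z.re + 1), sq_nonneg (2 * z.re - c),
    mul_nonneg (sub_nonneg.mpr hc2.2) (by linarith : (0:ℝ) ≤ c + 2)]

theorem add_inv_of_norm_eq_one {z : ℂ} (h : ‖z‖ = 1) : z + z⁻¹ = ((2 * z.re : ℝ) : ℂ) := by
  rw [Complex.inv_eq_conj h, Complex.add_conj]

theorem eq_or_mul_eq_one_of_add_inv_eq {x y : ℂ} (hx : x ≠ 0) (hy : y ≠ 0)
    (h : x + x⁻¹ = y + y⁻¹) : x = y ∨ x * y = 1 := by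
  have : (x - y) * (x * y - 1) = 0 := by
    field_simp at h
    linear_combination h
  rcases mul_eq_zero.mp this with h | h
  · left; linear_combination h
  · right; linear_combination h

theorem zhukovskii_eq_iff {a b : ℝ} (hb : b ≠ 0) {z l : ℂ} :
    zhukovskii a b z = l ↔ z + z⁻¹ = (a - l) / b := by
  have : (b : ℂ) ≠ 0 := by exact_mod_cast hb
  rw [zhukovskii, eq_div_iff this]
  constructor <;> intro h <;> linear_combination -h

theorem im_zhukovskii (a b : ℝ) {z : ℂ} :
    (zhukovskii a b z).im = b * z.im * (1 / Complex.normSq z - 1) := by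
  simp [zhukovskii, Complex.inv_im]
  ring

theorem finite_setOf_zhukovskii_eq {a b : ℝ} (hb : b ≠ 0) (l : ℂ) :
    {z : ℂ | zhukovskii a b z = l}.Finite := by
  by_cases hne : ∃ x : ℂ, x ≠ 0 ∧ zhukovskii a b x = l
  · obtain ⟨x, hx, h⟩ := hne
    refine (toFinite ({0, x, x⁻¹} : Set ℂ)).subset fun y hy => ?_
    by_cases hy0 : y = 0
    · simp [hy0]
    · rcases eq_or_mul_eq_one_of_add_inv_eq hy0 hx (((zhukovskii_eq_iff hb).mp hy).trans
        ((zhukovskii_eq_iff hb).mp h).symm) with h1 | h1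
      · simp [h1]
      · simp [eq_inv_of_mul_eq_one_left h1]
  · push Not at hne
    refine (finite_singleton (0 : ℂ)).subset fun y hy => ?_
    by_contra h0
    exact hne y h0 hy

/-- The root of `z + z⁻¹ = u⁻¹` in the unit disk, as a function of `u`. With the root in this form
the value at `u = 0`, where `z + z⁻¹ = ∞`, is `0` and needs no special treatment. -/
noncomputable def smallRoot (u : ℂ) : ℂ := 2 * u / (1 + (1 - 4 * u ^ 2) ^ (1 / 2 : ℂ))

theorem re_cpow_half_pos {w : ℂ} (hw : w ∈ Complex.slitPlane) : 0 < (w ^ (1 / 2 : ℂ)).re := by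
  have hne := Complex.slitPlane_ne_zero hw
  rw [Complex.cpow_def_of_ne_zero hne, Complex.exp_re]
  refine mul_pos (Real.exp_pos _) (Real.cos_pos_of_mem_Ioo ?_)
  have h1 := Complex.neg_pi_lt_arg w
  have h2 : w.arg < Real.pi := lt_of_le_of_ne (Complex.arg_le_pi w)
    (Complex.mem_slitPlane_iff_arg.mp hw).1
  have : (Complex.log w * (1 / 2)).im = w.arg / 2 := by
    simp [Complex.mul_im, Complex.log_im]
    ring
  rw [this]
  constructor <;> linarith

section smallRoot

variable {u : ℂ} (hu : 1 - 4 * u ^ 2 ∈ Complex.slitPlane)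
include hu

theorem one_add_sqrt_ne_zero : 1 + (1 - 4 * u ^ 2) ^ (1 / 2 : ℂ) ≠ 0 := by
  intro h
  have := re_cpow_half_pos hu
  have h2 := congrArg Complex.re h
  simp only [Complex.add_re, Complex.one_re, Complex.zero_re] at h2
  linarith

theorem analyticAt_smallRoot : AnalyticAt ℂ smallRoot u := by
  unfold smallRoot
  refine AnalyticAt.div (by fun_prop) (analyticAt_const.add (AnalyticAt.cpow (by fun_prop)
    analyticAt_const hu)) (one_add_sqrt_ne_zero hu)

theorem smallRoot_add_inv (h0 : u ≠ 0) : smallRoot u + (smallRoot u)⁻¹ = u⁻¹ := by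
  have h1 := one_add_sqrt_ne_zero hu
  have h2 : ((1 - 4 * u ^ 2) ^ (1 / 2 : ℂ)) ^ 2 = 1 - 4 * u ^ 2 := by
    rw [← Complex.cpow_nat_mul]; norm_num
  unfold smallRoot
  generalize (1 - 4 * u ^ 2) ^ (1 / 2 : ℂ) = s at h1 h2
  field_simp
  linear_combination h2

theorem norm_smallRoot_lt : ‖smallRoot u‖ < 1 := by
  have h1 := one_add_sqrt_ne_zero hu
  have h2 : ((1 - 4 * u ^ 2) ^ (1 / 2 : ℂ)) ^ 2 = 1 - 4 * u ^ 2 := by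
    rw [← Complex.cpow_nat_mul]; norm_num
  have h3 := re_cpow_half_pos hu
  unfold smallRoot
  generalize (1 - 4 * u ^ 2) ^ (1 / 2 : ℂ) = s at h1 h2 h3
  have h4 : (2 * u / (1 + s)) ^ 2 = (1 - s) / (1 + s) := by
    field_simp
    linear_combination h2
  have h5 : ‖1 - s‖ < ‖1 + s‖ := by
    rw [← sq_lt_sq₀ (norm_nonneg _) (norm_nonneg _), ← Complex.normSq_eq_norm_sq,
      ← Complex.normSq_eq_norm_sq, Complex.normSq_apply, Complex.normSq_apply]
    simp
    nlinarith
  have h6 : ‖2 * u / (1 + s)‖ ^ 2 < 1 := by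
    rw [← norm_pow, h4, norm_div, div_lt_one (norm_pos_iff.mpr h1)]
    exact h5
  nlinarith [norm_nonneg (2 * u / (1 + s))]

end smallRoot

namespace WebSystem

variable {A C : Type*} [Fintype C] (S : WebSystem A C)

/-! ### The maps `θ_σ` inside the disk -/

theorem b_ne_zero : (S.b : ℂ) ≠ 0 := by exact_mod_cast S.b_pos.ne'

theorem bLim_ne_zero (γ : C) : (S.bLim γ : ℂ) ≠ 0 := by exact_mod_cast (S.bLim_pos γ).ne'

theorem band_subset (γ : C) :
    Icc (S.aLim γ - 2 * S.bLim γ) (S.aLim γ + 2 * S.bLim γ) ⊆ Icc (S.a - 2 * S.b) (S.a + 2 * S.b) :=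
  fun _ hx => S.bands_union ▸ mem_iUnion.mpr ⟨γ, hx⟩

theorem lam_ne_ofReal {ω : ℂ} (hω : ω ∈ ball (0 : ℂ) 1) (h0 : ω ≠ 0) {x : ℝ}
    (hx : x ∈ Icc (S.a - 2 * S.b) (S.a + 2 * S.b)) : S.lam ω ≠ x := by
  intro h
  have h1 := (zhukovskii_eq_iff S.b_pos.ne').mp h
  have h2 : ‖ω‖ = 1 := norm_eq_one_of_add_inv_eq h0 (c := (S.a - x) / S.b)
    (by rw [h1]; push_cast; rfl) (by
      rw [abs_le]
      constructor
      · rw [le_div_iff₀ S.b_pos]; linarith [hx.2]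
      · rw [div_le_iff₀ S.b_pos]; linarith [hx.1])
  rw [mem_ball_zero_iff] at hω
  linarith

theorem analyticAt_lam {ω : ℂ} (h0 : ω ≠ 0) : AnalyticAt ℂ S.lam ω := by
  unfold lam zhukovskii
  exact analyticAt_const.sub (analyticAt_const.mul (analyticAt_id.add (analyticAt_id.inv h0)))

theorem meromorphicAt_lam (ω : ℂ) : MeromorphicAt S.lam ω := by
  unfold lam zhukovskii
  exact (MeromorphicAt.const _ _).sub ((MeromorphicAt.const _ _).mul
    ((MeromorphicAt.id ω).add (MeromorphicAt.id ω).inv))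

/-- The value of `θ + θ⁻¹` prescribed by the equation `W_γ(θ) = λ(ω)`. -/
noncomputable def trace (γ : C) (ω : ℂ) : ℂ := (S.aLim γ - S.lam ω) / S.bLim γ

theorem zhukovskii_eq_lam_iff {γ : C} {θ ω : ℂ} :
    zhukovskii (S.aLim γ) (S.bLim γ) θ = S.lam ω ↔ θ + θ⁻¹ = S.trace γ ω :=
  zhukovskii_eq_iff (S.bLim_pos γ).ne'

theorem analyticAt_trace (γ : C) {ω : ℂ} (h0 : ω ≠ 0) : AnalyticAt ℂ (S.trace γ) ω := by
  unfold trace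
  exact (analyticAt_const.sub (S.analyticAt_lam h0)).div analyticAt_const (S.bLim_ne_zero γ)

theorem trace_ne_ofReal (γ : C) {ω : ℂ} (hω : ω ∈ ball (0 : ℂ) 1) (h0 : ω ≠ 0) {c : ℝ}
    (hc : |c| ≤ 2) : S.trace γ ω ≠ c := by
  intro h
  have hb := S.bLim_pos γ
  have hc' := abs_le.mp hc
  refine S.lam_ne_ofReal hω h0 (x := S.aLim γ - S.bLim γ * c) (S.band_subset γ ⟨?_, ?_⟩) ?_
  · nlinarith
  · nlinarith
  · rw [trace, div_eq_iff (S.bLim_ne_zero γ)] at h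
    push_cast
    linear_combination -h

/-- The inverse of `S.trace γ`, written so that it is analytic in the whole open disk. -/
noncomputable def invTrace (γ : C) (ω : ℂ) : ℂ :=
  S.bLim γ * ω / ((S.aLim γ - S.a) * ω + S.b * (ω ^ 2 + 1))

theorem invTrace_eq (γ : C) {ω : ℂ} (h0 : ω ≠ 0) : S.invTrace γ ω = (S.trace γ ω)⁻¹ := by
  have hb := S.bLim_ne_zero γ
  rw [trace, inv_div, invTrace, lam, zhukovskii]
  have : (S.aLim γ - S.a) * ω + S.b * (ω ^ 2 + 1) =
      ((S.aLim γ : ℂ) - (S.a - S.b * (ω + ω⁻¹))) * ω := by field_simp; ring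
  rw [this, mul_div_mul_right _ _ h0]

theorem trace_ne_zero (γ : C) {ω : ℂ} (hω : ω ∈ ball (0 : ℂ) 1) (h0 : ω ≠ 0) :
    S.trace γ ω ≠ 0 := by
  have := S.trace_ne_ofReal γ hω h0 (c := 0) (by simp)
  simpa using this

theorem analyticAt_invTrace (γ : C) {ω : ℂ} (hω : ω ∈ ball (0 : ℂ) 1) :
    AnalyticAt ℂ (S.invTrace γ) ω := by
  unfold invTrace
  refine AnalyticAt.div (by fun_prop) (by fun_prop) ?_
  by_cases h0 : ω = 0
  · simp [h0, S.b_ne_zero]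
  · have hz := S.trace_ne_zero γ hω h0
    intro h
    have h1 := S.invTrace_eq γ h0
    rw [invTrace, h, div_zero] at h1
    exact hz (inv_eq_zero.mp h1.symm)

theorem slitPlane_invTrace (γ : C) {ω : ℂ} (hω : ω ∈ ball (0 : ℂ) 1) :
    1 - 4 * S.invTrace γ ω ^ 2 ∈ Complex.slitPlane := by
  by_cases h0 : ω = 0
  · simp [h0, invTrace]
  rw [S.invTrace_eq γ h0]
  have hz := S.trace_ne_zero γ hω h0
  have hr := fun c (hc : |c| ≤ 2) => S.trace_ne_ofReal γ hω h0 (c := c) hc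
  generalize S.trace γ ω = z at hz hr
  by_contra hcon
  rw [Complex.mem_slitPlane_iff] at hcon
  push Not at hcon
  -- otherwise `4 / z² = 1 + s` with `s ≥ 0`, which makes `z` a real number in `[-2, 2]`
  obtain ⟨hre, him⟩ := hcon
  set s : ℝ := -(1 - 4 * z⁻¹ ^ 2).re with hs
  have hs0 : 0 ≤ s := by linarith
  have heq : 1 - 4 * z⁻¹ ^ 2 = -(s : ℂ) := Complex.ext
    (by rw [hs]; push_cast; rw [neg_neg]; rfl) (by rw [him]; simp)
  have h1s : (0 : ℝ) < Real.sqrt (1 + s) := Real.sqrt_pos.mpr (by linarith)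
  have hsq : ((Real.sqrt (1 + s) : ℝ) : ℂ) ^ 2 = 1 + s := by
    rw [← Complex.ofReal_pow, Real.sq_sqrt (by linarith)]; push_cast; rfl
  have h1s' : ((Real.sqrt (1 + s) : ℝ) : ℂ) ≠ 0 := by exact_mod_cast h1s.ne'
  have hz2 : z ^ 2 = ((2 / Real.sqrt (1 + s) : ℝ) : ℂ) ^ 2 := by
    push_cast
    rw [div_pow, hsq, eq_div_iff (by rw [← hsq]; exact pow_ne_zero 2 h1s')]
    field_simp at heq
    linear_combination heq
  have hle : |2 / Real.sqrt (1 + s)| ≤ 2 := by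
    rw [abs_of_pos (by positivity), div_le_iff₀ h1s]
    nlinarith [Real.one_le_sqrt.mpr (by linarith : (1:ℝ) ≤ 1 + s)]
  rcases sq_eq_sq_iff_eq_or_eq_neg.mp hz2 with h | h
  · exact hr _ hle h
  · refine hr (-(2 / Real.sqrt (1 + s))) (by rwa [abs_neg]) (by rw [h]; push_cast; rfl)

/-- The values of `θ_γ` in the open disk. -/
theorem smallRoot_invTrace_spec (γ : C) {ω : ℂ} (hω : ω ∈ ball (0 : ℂ) 1) (h0 : ω ≠ 0) :
    smallRoot (S.invTrace γ ω) ∈ ball (0 : ℂ) 1 \ {0} ∧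
      zhukovskii (S.aLim γ) (S.bLim γ) (smallRoot (S.invTrace γ ω)) = S.lam ω := by
  have hsl := S.slitPlane_invTrace γ hω
  have hz := S.trace_ne_zero γ hω h0
  have hi : S.invTrace γ ω ≠ 0 := by rw [S.invTrace_eq γ h0]; exact inv_ne_zero hz
  refine ⟨⟨mem_ball_zero_iff.mpr (norm_smallRoot_lt hsl), ?_⟩, ?_⟩
  · exact div_ne_zero (mul_ne_zero two_ne_zero hi) (one_add_sqrt_ne_zero hsl)
  · rw [zhukovskii_eq_lam_iff, smallRoot_add_inv hsl hi, S.invTrace_eq γ h0, inv_inv]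

theorem zhukovskii_injOn {a b : ℝ} (hb : b ≠ 0) :
    InjOn (zhukovskii a b) (ball (0 : ℂ) 1 \ {0}) := by
  intro x hx y hy h
  refine (eq_or_mul_eq_one_of_add_inv_eq hx.2 hy.2 (((zhukovskii_eq_iff hb).mp h).trans
    ((zhukovskii_eq_iff hb).mp rfl).symm)).resolve_right fun h1 => ?_
  have := congrArg norm h1
  rw [norm_mul, norm_one] at this
  have h2 := mem_ball_zero_iff.mp hx.1
  have h3 := mem_ball_zero_iff.mp hy.1
  nlinarith [norm_nonneg x, norm_nonneg y]

theorem invFunOn_eq_smallRoot (γ : C) {ω : ℂ} (hω : ω ∈ ball (0 : ℂ) 1) (h0 : ω ≠ 0) :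
    Function.invFunOn (zhukovskii (S.aLim γ) (S.bLim γ)) (ball (0 : ℂ) 1 \ {0}) (S.lam ω)
      = smallRoot (S.invTrace γ ω) := by
  have h := S.smallRoot_invTrace_spec γ hω h0
  have hex : ∃ θ ∈ ball (0 : ℂ) 1 \ {0}, zhukovskii (S.aLim γ) (S.bLim γ) θ = S.lam ω :=
    ⟨_, h.1, h.2⟩
  exact zhukovskii_injOn (S.bLim_pos γ).ne' (Function.invFunOn_mem hex) h.1
    ((Function.invFunOn_eq hex).trans h.2.symm)

theorem analyticAt_smallRoot_invTrace (γ : C) {ω : ℂ} (hω : ω ∈ ball (0 : ℂ) 1) :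
    AnalyticAt ℂ (fun ω => smallRoot (S.invTrace γ ω)) ω :=
  (analyticAt_smallRoot (S.slitPlane_invTrace γ hω)).comp (S.analyticAt_invTrace γ hω)

/-- A limit of the inner values of `θ_γ` at a point of the closed disk is its value there. -/
theorem theta_eq_of_tendsto (γ : C) {ω y : ℂ} (hω : ω ∈ closedBall (0 : ℂ) 1)
    (h : Tendsto (fun ω => smallRoot (S.invTrace γ ω)) (𝓝[ball 0 1 \ {0}] ω) (𝓝 y)) :
    S.theta γ ω = y := by
  refine extendFrom_eq (closedBall_subset_closure_ball_diff (finite_singleton _) hω)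
    (h.congr' ?_)
  filter_upwards [self_mem_nhdsWithin] with ω' h'
  exact (S.invFunOn_eq_smallRoot γ h'.1 h'.2).symm

theorem theta_eq_smallRoot (γ : C) {ω : ℂ} (hω : ω ∈ ball (0 : ℂ) 1) :
    S.theta γ ω = smallRoot (S.invTrace γ ω) :=
  S.theta_eq_of_tendsto γ (ball_subset_closedBall hω)
    ((S.analyticAt_smallRoot_invTrace γ hω).continuousAt.tendsto.mono_left nhdsWithin_le_nhds)

theorem theta_zero (γ : C) : S.theta γ 0 = 0 := by
  rw [S.theta_eq_smallRoot γ (by simp)]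
  simp [invTrace, smallRoot]

theorem norm_theta_lt_of_mem_ball (γ : C) {ω : ℂ} (hω : ω ∈ ball (0 : ℂ) 1) :
    ‖S.theta γ ω‖ < 1 := by
  rw [S.theta_eq_smallRoot γ hω]
  exact norm_smallRoot_lt (S.slitPlane_invTrace γ hω)

/-! ### The maps `θ_σ` at the boundary of the disk -/

/-- The discriminant `z² - 4`, with `z = θ_γ + θ_γ⁻¹`, is near each point of the unit circle
the square of a holomorphic function of the local parameter. -/
theorem exists_sq_eq_discriminant (γ : C) {ω₀ : ℂ} (hω : ω₀ ∈ sphere (0 : ℂ) 1) :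
    ∃ H : ℂ → ℂ, AnalyticAt ℂ H 0 ∧
      ∀ᶠ ω in 𝓝 ω₀, S.trace γ ω ^ 2 - 4 = H (S.localParam ω₀ ω) ^ 2 := by
  have h1 : ‖ω₀‖ = 1 := by simpa using hω
  have h0 : ω₀ ≠ 0 := by rintro rfl; simp at h1
  have hb := S.bLim_ne_zero γ
  have hb' := S.b_ne_zero
  have han := S.analyticAt_trace γ h0
  have hchart : ∀ {h : ℂ → ℂ}, AnalyticAt ℂ h ω₀ → AnalyticAt ℂ (h ∘ S.chart ω₀) 0 := fun hh =>
    AnalyticAt.comp (by rwa [chart_zero]) (S.analyticAt_chart ω₀ 0)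
  by_cases hq : S.trace γ ω₀ ^ 2 - 4 = 0
  · -- at a band edge the discriminant vanishes to second order in the local parameter
    suffices hG : ∃ G : ℂ → ℂ, AnalyticAt ℂ G ω₀ ∧ G ω₀ ≠ 0 ∧
        ∀ ω, ω ≠ 0 → S.trace γ ω ^ 2 - 4 = S.localParam ω₀ ω ^ 2 * G ω by
      obtain ⟨G, hGa, hG0, hG⟩ := hG
      obtain ⟨h, hh, hh2⟩ := hGa.exists_sq_eq hG0
      refine ⟨fun t => t * (h ∘ S.chart ω₀) t, analyticAt_id.mul (hchart hh), ?_⟩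
      filter_upwards [hh2, isOpen_compl_singleton.mem_nhds h0] with ω hω hω0
      rw [hG ω hω0, mul_pow]
      simp only [Function.comp, chart_localParam, hω]
    have hz0 : S.trace γ ω₀ ≠ 0 := by intro h; rw [h] at hq; norm_num at hq
    have hfac : ∀ ω, ω ≠ 0 → S.trace γ ω ^ 2 - 4 = S.b / S.bLim γ * (ω - ω₀) * (1 - 1 / (ω * ω₀))
        * (S.trace γ ω + S.trace γ ω₀) := fun ω hω => by
      have : S.trace γ ω - S.trace γ ω₀ = S.b / S.bLim γ * (ω - ω₀) * (1 - 1 / (ω * ω₀)) := by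
        simp only [trace, lam, zhukovskii]
        field_simp
        ring
      rw [← this]
      linear_combination hq
    by_cases hpm : ω₀ = 1 ∨ ω₀ = -1
    · have hsq : ω₀ * ω₀ = 1 := by rcases hpm with h | h <;> rw [h] <;> norm_num
      have hnot : ω₀ ∉ S.bandEdges := fun h => by
        rcases hpm with h' | h'
        · exact h.2.1 h'
        · exact h.2.2.1 h'
      refine ⟨fun ω => S.b / S.bLim γ * ω⁻¹ * (S.trace γ ω + S.trace γ ω₀), ?_, ?_, fun ω hω => ?_⟩
      · exact (analyticAt_const.mul (analyticAt_id.inv h0)).mul (han.add analyticAt_const)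
      · have : S.trace γ ω₀ + S.trace γ ω₀ ≠ 0 := by rw [← two_mul]; simp [hz0]
        exact mul_ne_zero (mul_ne_zero (div_ne_zero hb' hb) (inv_ne_zero h0)) this
      · rw [hfac ω hω]
        have : 1 - 1 / (ω * ω₀) = (ω - ω₀) * ω⁻¹ := by
          field_simp
          linear_combination hsq
        simp only [this, localParam, hnot, if_false]
        ring
    · push Not at hpm
      have hmem : ω₀ ∈ S.bandEdges := by
        refine ⟨hω, hpm.1, hpm.2, γ, ?_⟩
        have : (S.trace γ ω₀ - 2) * (S.trace γ ω₀ + 2) = 0 := by linear_combination hq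
        rcases mul_eq_zero.mp this with h | h
        · left
          have h2 : S.trace γ ω₀ = 2 := by linear_combination h
          rw [trace, div_eq_iff hb] at h2
          push_cast; linear_combination -h2
        · right
          have h2 : S.trace γ ω₀ = -2 := by linear_combination h
          rw [trace, div_eq_iff hb] at h2
          push_cast; linear_combination -h2
      have hsq : (S.localParam ω₀ · ^ 2) = fun ω => 1 - ω / ω₀ := by
        ext ω
        simp only [localParam, hmem, if_true]
        rw [← Complex.cpow_nat_mul]; norm_num
      refine ⟨fun ω => -ω₀ * (S.b / S.bLim γ) * (1 - (ω * ω₀)⁻¹) * (S.trace γ ω + S.trace γ ω₀),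
        ?_, ?_, fun ω hω => ?_⟩
      · refine AnalyticAt.mul (analyticAt_const.mul (analyticAt_const.sub
          (AnalyticAt.inv (by fun_prop) ?_))) (han.add analyticAt_const)
        exact mul_ne_zero h0 h0
      · have h3 : S.trace γ ω₀ + S.trace γ ω₀ ≠ 0 := by rw [← two_mul]; simp [hz0]
        have h4 : 1 - (ω₀ * ω₀)⁻¹ ≠ 0 := by
          intro h
          have h5 : ω₀ * ω₀ = 1 := by
            field_simp at h
            linear_combination h
          have : (ω₀ - 1) * (ω₀ + 1) = 0 := by linear_combination h5
          rcases mul_eq_zero.mp this with h | h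
          · exact hpm.1 (by linear_combination h)
          · exact hpm.2 (by linear_combination h)
        exact mul_ne_zero (mul_ne_zero (mul_ne_zero (neg_ne_zero.mpr h0) (div_ne_zero hb' hb)) h4) h3
      · rw [hfac ω hω, show S.localParam ω₀ ω ^ 2 = 1 - ω / ω₀ from congrFun hsq ω]
        field_simp
        ring
  · have hqa : AnalyticAt ℂ (fun ω => S.trace γ ω ^ 2 - 4) ω₀ := (han.pow 2).sub analyticAt_const
    obtain ⟨h, hh, hh2⟩ := hqa.exists_sq_eq hq
    refine ⟨h ∘ S.chart ω₀, hchart hh, ?_⟩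
    filter_upwards [hh2] with ω hω
    simp only [Function.comp, chart_localParam, hω]

/-- The quadratic equation for `θ_γ` has two solutions holomorphic in the local parameter, and
by connectedness `θ_γ` is one of them. -/
theorem exists_theta_branch (γ : C) {ω₀ : ℂ} (hω : ω₀ ∈ sphere (0 : ℂ) 1) :
    ∃ Θ : ℂ → ℂ, AnalyticAt ℂ Θ 0 ∧
      ∀ᶠ ω in 𝓝 ω₀, ω ∈ ball (0 : ℂ) 1 → smallRoot (S.invTrace γ ω) = Θ (S.localParam ω₀ ω) := by
  have h1 : ‖ω₀‖ = 1 := by simpa using hω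
  have h0 : ω₀ ≠ 0 := by rintro rfl; simp at h1
  obtain ⟨H, hH, hHsq⟩ := S.exists_sq_eq_discriminant γ hω
  have hHc : ∀ᶠ ω in 𝓝 ω₀, ω ∈ closedBall (0 : ℂ) 1 → ContinuousAt H (S.localParam ω₀ ω) := by
    rw [← eventually_nhdsWithin_iff]
    exact (S.tendsto_localParam (sphere_subset_closedBall hω)).eventually
      (hH.eventually_analyticAt.mono fun _ h => h.continuousAt)
  obtain ⟨ε, hε, hball⟩ := Metric.eventually_nhds_iff_ball.mp
    ((hHsq.and hHc).and (isOpen_compl_singleton.mem_nhds h0))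
  let U : Set ℂ := ball 0 1 ∩ ball ω₀ ε
  have hU : IsPreconnected U := ((convex_ball 0 1).inter (convex_ball ω₀ ε)).isPreconnected
  have hne : ∀ ω ∈ U, ω ≠ 0 := fun ω h => (hball ω h.2).2
  let u : ℂ → ℂ := fun ω => 2 * smallRoot (S.invTrace γ ω) - S.trace γ ω
  have hu : ContinuousOn u U := fun ω h => by
    refine (((S.analyticAt_smallRoot_invTrace γ h.1).continuousAt.const_mul 2).sub
      (S.analyticAt_trace γ (hne ω h)).continuousAt).continuousWithinAt
  have hHU : ContinuousOn (fun ω => H (S.localParam ω₀ ω)) U := fun ω h => by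
    have h2 := (hball ω h.2).1.2 (ball_subset_closedBall h.1)
    exact ContinuousAt.comp_continuousWithinAt (g := H) h2
      ((S.continuousOn_localParam ω₀ ω (ball_subset_closedBall h.1)).mono
        (inter_subset_left.trans ball_subset_closedBall))
  have hsq : EqOn (u ^ 2) ((fun ω => H (S.localParam ω₀ ω)) ^ 2) U := fun ω h => by
    have h2 := (S.smallRoot_invTrace_spec γ h.1 (hne ω h))
    have h3 := S.zhukovskii_eq_lam_iff.mp h2.2
    have h4 : smallRoot (S.invTrace γ ω) ≠ 0 := h2.1.2
    simp only [Pi.pow_apply, ← (hball ω h.2).1.1, u]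
    rw [← h3]
    field_simp
    ring
  have hHne : ∀ {ω}, ω ∈ U → H (S.localParam ω₀ ω) ≠ 0 := fun {ω} h h2 => by
    have h3 := (hball ω h.2).1.1
    rw [h2] at h3
    have h4 : (S.trace γ ω - (2 : ℝ)) * (S.trace γ ω - (-2 : ℝ)) = 0 := by
      push_cast; linear_combination h3
    rcases mul_eq_zero.mp h4 with h5 | h5
    · exact S.trace_ne_ofReal γ h.1 (hne ω h) (c := 2) (by norm_num) (sub_eq_zero.mp h5)
    · exact S.trace_ne_ofReal γ h.1 (hne ω h) (c := -2) (by norm_num) (sub_eq_zero.mp h5)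
  have htr : AnalyticAt ℂ (S.trace γ ∘ S.chart ω₀) 0 :=
    AnalyticAt.comp (by rw [chart_zero]; exact S.analyticAt_trace γ h0) (S.analyticAt_chart ω₀ 0)
  rcases hU.eq_or_eq_neg_of_sq_eq hu hHU hsq hHne with h | h
  · refine ⟨fun t => ((S.trace γ ∘ S.chart ω₀) t + H t) / 2, (htr.add hH).div_const, ?_⟩
    filter_upwards [ball_mem_nhds ω₀ hε] with ω h2 h3
    have h4 := h ⟨h3, h2⟩
    simp only [u] at h4
    simp only [Function.comp, chart_localParam, ← h4]
    ring
  · refine ⟨fun t => ((S.trace γ ∘ S.chart ω₀) t - H t) / 2, (htr.sub hH).div_const, ?_⟩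
    filter_upwards [ball_mem_nhds ω₀ hε] with ω h2 h3
    have h4 := h ⟨h3, h2⟩
    simp only [u, Pi.neg_apply] at h4
    simp only [Function.comp, chart_localParam]
    linear_combination h4 / 2

theorem holomorphicNear_theta (γ : C) {ω₀ : ℂ} (hω : ω₀ ∈ closedBall (0 : ℂ) 1) :
    S.HolomorphicNear (S.theta γ) ω₀ := by
  by_cases hb : ω₀ ∈ ball (0 : ℂ) 1
  · refine (HolomorphicNear.of_analyticAt (S.analyticAt_smallRoot_invTrace γ hb)).congr ?_
    filter_upwards [mem_nhdsWithin_of_mem_nhds (isOpen_ball.mem_nhds hb)] with ω h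
    exact (S.theta_eq_smallRoot γ h).symm
  have hs : ω₀ ∈ sphere (0 : ℂ) 1 := by
    rw [← closedBall_sdiff_ball]; exact ⟨hω, hb⟩
  obtain ⟨Θ, hΘ, h⟩ := S.exists_theta_branch γ hs
  refine ⟨Θ, hΘ, ?_⟩
  have hcont : ∀ᶠ ω in 𝓝[closedBall (0 : ℂ) 1] ω₀, ContinuousAt Θ (S.localParam ω₀ ω) :=
    (S.tendsto_localParam hω).eventually (hΘ.eventually_analyticAt.mono fun _ h => h.continuousAt)
  filter_upwards [hcont, mem_nhdsWithin_of_mem_nhds (eventually_eventually_nhds.mpr h),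
    self_mem_nhdsWithin] with ω h1 h2 h3
  refine S.theta_eq_of_tendsto γ h3 ?_
  have hsub : ball (0 : ℂ) 1 \ {0} ⊆ closedBall 0 1 := sdiff_subset.trans ball_subset_closedBall
  refine Tendsto.congr' ?_ (h1.tendsto.comp ((S.continuousOn_localParam ω₀ ω h3).mono hsub))
  filter_upwards [mem_nhdsWithin_of_mem_nhds h2, self_mem_nhdsWithin] with ω' h4 h5
  exact (h4 h5.1).symm

theorem continuousOn_theta (γ : C) : ContinuousOn (S.theta γ) (closedBall 0 1) :=
  fun _ hω => (S.holomorphicNear_theta γ hω).continuousWithinAt hω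

theorem continuousWithinAt_lam {ω : ℂ} (h0 : ω ≠ 0) (s : Set ℂ) : ContinuousWithinAt S.lam s ω :=
  (S.analyticAt_lam h0).continuousAt.continuousWithinAt

/-- A closed condition that holds in the open disk off a finite set passes, by continuity, to the
closed disk. -/
theorem mem_of_forall_ball {X : Type*} [TopologicalSpace X] {f : ℂ → X} {s : Set X}
    (hs : IsClosed s) {ω : ℂ} (hω : ω ∈ closedBall (0 : ℂ) 1)
    (hf : ContinuousWithinAt f (closedBall 0 1) ω) {F : Set ℂ} (hF : F.Finite)
    (h : ∀ ω' ∈ ball (0 : ℂ) 1 \ F, f ω' ∈ s) : f ω ∈ s := by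
  have : (𝓝[ball 0 1 \ F] ω).NeBot := neBot_ball_diff hF hω
  refine hs.mem_of_tendsto (b := 𝓝[ball 0 1 \ F] ω) (hf.mono (sdiff_subset.trans ball_subset_closedBall)) ?_
  filter_upwards [self_mem_nhdsWithin] with ω' h' using h ω' h'

theorem norm_theta_le (γ : C) {ω : ℂ} (hω : ω ∈ closedBall (0 : ℂ) 1) : ‖S.theta γ ω‖ ≤ 1 := by
  have := mem_of_forall_ball (isClosed_closedBall (x := (0 : ℂ)) (ε := 1)) hω
    (S.continuousOn_theta γ ω hω) finite_empty fun ω' h => ball_subset_closedBall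
      (mem_ball_zero_iff.mpr (S.norm_theta_lt_of_mem_ball γ h.1))
  simpa using this

theorem theta_sq (γ : C) {ω : ℂ} (hω : ω ∈ closedBall (0 : ℂ) 1) (h0 : ω ≠ 0) :
    S.theta γ ω ^ 2 - S.trace γ ω * S.theta γ ω + 1 = 0 := by
  refine mem_of_forall_ball (f := fun ω => S.theta γ ω ^ 2 - S.trace γ ω * S.theta γ ω + 1)
    (isClosed_singleton (x := (0 : ℂ))) hω ?_ (finite_singleton 0) fun ω' h => ?_
  · have h1 := S.continuousOn_theta γ ω hω
    have h2 : ContinuousWithinAt (S.trace γ) (closedBall 0 1) ω :=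
      (S.analyticAt_trace γ h0).continuousAt.continuousWithinAt
    exact ((h1.pow 2).sub (h2.mul h1)).add continuousWithinAt_const
  · have h2 := S.smallRoot_invTrace_spec γ h.1 h.2
    have h3 := S.zhukovskii_eq_lam_iff.mp h2.2
    have h4 : smallRoot (S.invTrace γ ω') ≠ 0 := h2.1.2
    simp only [mem_singleton_iff]
    rw [← h3, S.theta_eq_smallRoot γ h.1]
    field_simp
    ring

theorem theta_ne_zero (γ : C) {ω : ℂ} (hω : ω ∈ closedBall (0 : ℂ) 1) (h0 : ω ≠ 0) :
    S.theta γ ω ≠ 0 := by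
  intro h
  have := S.theta_sq γ hω h0
  simp [h] at this

theorem theta_add_inv (γ : C) {ω : ℂ} (hω : ω ∈ closedBall (0 : ℂ) 1) (h0 : ω ≠ 0) :
    S.theta γ ω + (S.theta γ ω)⁻¹ = S.trace γ ω := by
  have h1 := S.theta_ne_zero γ hω h0
  have := S.theta_sq γ hω h0
  field_simp
  linear_combination this

theorem zhukovskii_theta (γ : C) {ω : ℂ} (hω : ω ∈ closedBall (0 : ℂ) 1) (h0 : ω ≠ 0) :
    zhukovskii (S.aLim γ) (S.bLim γ) (S.theta γ ω) = S.lam ω :=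
  S.zhukovskii_eq_lam_iff.mpr (S.theta_add_inv γ hω h0)

theorem finite_setOf_theta_eq (γ : C) (θ : ℂ) :
    {ω ∈ closedBall (0 : ℂ) 1 | S.theta γ ω = θ}.Finite := by
  refine ((finite_singleton (0 : ℂ)).union (finite_setOf_zhukovskii_eq (a := S.a) S.b_pos.ne'
    (zhukovskii (S.aLim γ) (S.bLim γ) θ))).subset fun ω hω => ?_
  by_cases h0 : ω = 0
  · exact Or.inl h0
  · exact Or.inr (by rw [mem_ofPred_eq, ← hω.2, S.zhukovskii_theta γ hω.1 h0]; rfl)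

/-- `θ_γ` maps the upper half of the disk to itself, and the lower half as well. -/
theorem im_mul_im_theta_nonneg (γ : C) {ω : ℂ} (hω : ω ∈ closedBall (0 : ℂ) 1) :
    0 ≤ ω.im * (S.theta γ ω).im := by
  refine mem_of_forall_ball (f := fun ω => ω.im * (S.theta γ ω).im) isClosed_Ici hω ?_
    (finite_singleton 0) fun ω' h => ?_
  · exact (Complex.continuous_im.continuousWithinAt).mul
      (Complex.continuous_im.continuousAt.comp_continuousWithinAt (S.continuousOn_theta γ ω hω))
  · have h1 := S.zhukovskii_theta γ (ball_subset_closedBall h.1) h.2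
    have h2 := congrArg Complex.im h1
    rw [lam, im_zhukovskii, im_zhukovskii] at h2
    have hp : ∀ z : ℂ, z ≠ 0 → ‖z‖ < 1 → 0 < 1 / Complex.normSq z - 1 := fun z hz hz1 => by
      have hz0 := norm_pos_iff.mpr hz
      rw [Complex.normSq_eq_norm_sq, sub_pos, lt_div_iff₀ (by positivity)]
      nlinarith
    have h3 := hp _ h.2 (mem_ball_zero_iff.mp h.1)
    have h4 := hp _ (S.theta_ne_zero γ (ball_subset_closedBall h.1) h.2)
      (S.norm_theta_lt_of_mem_ball γ h.1)
    have h5 : 0 ≤ (S.bLim γ * (1 / Complex.normSq (S.theta γ ω') - 1)) *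
        (ω'.im * (S.theta γ ω').im) := by
      have : (S.bLim γ * (1 / Complex.normSq (S.theta γ ω') - 1)) * (ω'.im * (S.theta γ ω').im)
        = (S.b * (1 / Complex.normSq ω' - 1)) * ω'.im ^ 2 := by
          linear_combination ω'.im * h2
      rw [this]
      have := S.b_pos
      positivity
    exact nonneg_of_mul_nonneg_right h5 (mul_pos (S.bLim_pos γ) h4)

/-! ### The arcs `T_σ⁺` -/

theorem mem_Tplus_of_lam_mem {σ : C} {ω : ℂ} (hω : ω ∈ sphere (0 : ℂ) 1) {x : ℝ}
    (hx : x ∈ Icc (S.aLim σ - 2 * S.bLim σ) (S.aLim σ + 2 * S.bLim σ)) (h : S.lam ω = x) :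
    ω ∈ S.Tplus σ := by
  have h1 : ‖ω‖ = 1 := by simpa using hω
  have h0 : ω ≠ 0 := by rintro rfl; simp at h1
  have hb := S.bLim_pos σ
  refine ⟨hω, norm_eq_one_of_add_inv_eq (c := (S.aLim σ - x) / S.bLim σ)
    (S.theta_ne_zero σ (sphere_subset_closedBall hω) h0) ?_ ?_⟩
  · rw [S.theta_add_inv σ (sphere_subset_closedBall hω) h0, trace, h]; push_cast; rfl
  · rw [abs_le]
    constructor
    · rw [le_div_iff₀ hb]; linarith [hx.2]
    · rw [div_le_iff₀ hb]; linarith [hx.1]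

theorem exists_lam_eq_of_mem_Tplus {σ : C} {ω : ℂ} (hω : ω ∈ S.Tplus σ) :
    ∃ x : ℝ, x ∈ Icc (S.aLim σ - 2 * S.bLim σ) (S.aLim σ + 2 * S.bLim σ) ∧ S.lam ω = x := by
  have h1 : ‖ω‖ = 1 := by simpa using hω.1
  have h0 : ω ≠ 0 := by rintro rfl; simp at h1
  have hb := S.bLim_pos σ
  have hre := abs_le.mp ((Complex.abs_re_le_norm (S.theta σ ω)).trans_eq hω.2)
  refine ⟨S.aLim σ - S.bLim σ * (2 * (S.theta σ ω).re), ⟨by nlinarith, by nlinarith⟩, ?_⟩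
  rw [← S.zhukovskii_theta σ (sphere_subset_closedBall hω.1) h0, zhukovskii,
    add_inv_of_norm_eq_one hω.2]
  push_cast
  rfl

theorem Tplus_subset (σ : C) : S.Tplus σ ⊆ closedBall 0 1 := fun _ h => sphere_subset_closedBall h.1

theorem ne_zero_of_mem_Tplus {σ : C} {ω : ℂ} (hω : ω ∈ S.Tplus σ) : ω ≠ 0 := by
  rintro rfl
  have := hω.1
  simp at this

/-- `T_σ⁺` has no isolated points. -/
theorem neBot_Tplus_diff {σ : C} {F : Set ℂ} (hF : F.Finite) {ω₀ : ℂ} (hω : ω₀ ∈ S.Tplus σ) :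
    (𝓝[S.Tplus σ \ F] ω₀).NeBot := by
  obtain ⟨x₀, hx₀, hlam⟩ := S.exists_lam_eq_of_mem_Tplus hω
  have h1 : ‖ω₀‖ = 1 := by simpa using hω.1
  have h0 := S.ne_zero_of_mem_Tplus hω
  have hb := S.b_pos
  -- a continuous right inverse `x ↦ c ± i √(1 - c²)` of `λ` on the band, passing through `ω₀`
  obtain ⟨s, hs1, hs⟩ : ∃ s : ℝ, s ^ 2 = 1 ∧ ω₀.im = s * Real.sqrt (1 - ω₀.re ^ 2) := by
    have hn : ω₀.im ^ 2 = 1 - ω₀.re ^ 2 := by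
      have := Complex.normSq_eq_norm_sq ω₀
      rw [h1, Complex.normSq_apply] at this
      linarith
    rw [← hn, Real.sqrt_sq_eq_abs]
    rcases abs_choice ω₀.im with h | h
    · exact ⟨1, by norm_num, by rw [h]; ring⟩
    · exact ⟨-1, by norm_num, by rw [h]; ring⟩
  let c : ℝ → ℝ := fun x => (S.a - x) / (2 * S.b)
  let j : ℝ → ℂ := fun x => (c x : ℂ) + ((s * Real.sqrt (1 - c x ^ 2) : ℝ) : ℂ) * Complex.I
  have hjc : Continuous j := by fun_prop
  have hjre : ∀ x, (j x).re = c x := fun x => by simp [j]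
  have hjim : ∀ x, (j x).im = s * Real.sqrt (1 - c x ^ 2) := fun x => by simp [j]
  have hjinj : Function.Injective j := fun x y h => by
    have := congrArg Complex.re h
    rw [hjre, hjre] at this
    simp only [c] at this
    field_simp at this
    linarith
  have hcl : ∀ x ∈ Icc (S.a - 2 * S.b) (S.a + 2 * S.b), c x ^ 2 ≤ 1 := fun x hx => by
    have h1 : c x ≤ 1 := by simp only [c]; rw [div_le_iff₀ (by linarith)]; linarith [hx.1]
    have h2 : -1 ≤ c x := by simp only [c]; rw [le_div_iff₀ (by linarith)]; linarith [hx.2]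
    nlinarith
  have hjn : ∀ x ∈ Icc (S.a - 2 * S.b) (S.a + 2 * S.b), ‖j x‖ = 1 := fun x hx => by
    have h2 : ‖j x‖ ^ 2 = 1 := by
      rw [← Complex.normSq_eq_norm_sq, Complex.normSq_apply, hjre, hjim]
      have := Real.sq_sqrt (sub_nonneg.mpr (hcl x hx))
      linear_combination hs1 * Real.sqrt (1 - c x ^ 2) ^ 2 + this
    nlinarith [norm_nonneg (j x)]
  have hjl : ∀ x ∈ Icc (S.a - 2 * S.b) (S.a + 2 * S.b), S.lam (j x) = x := fun x hx => by
    rw [lam, zhukovskii, add_inv_of_norm_eq_one (hjn x hx), hjre]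
    simp only [c]
    have := S.b_ne_zero
    push_cast
    field_simp
    ring
  have hj0 : j x₀ = ω₀ := by
    have hre : c x₀ = ω₀.re := by
      rw [lam, zhukovskii, add_inv_of_norm_eq_one h1] at hlam
      have : S.a - S.b * (2 * ω₀.re) = x₀ := by exact_mod_cast hlam
      simp only [c, ← this]
      field_simp
      ring
    refine Complex.ext ((hjre _).trans hre) ?_
    rw [hjim, hre, hs]
  have hlt : S.aLim σ - 2 * S.bLim σ < S.aLim σ + 2 * S.bLim σ := by linarith [S.bLim_pos σ]
  rw [← mem_closure_iff_nhdsWithin_neBot]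
  have hx : x₀ ∈ closure (Ioo (S.aLim σ - 2 * S.bLim σ) (S.aLim σ + 2 * S.bLim σ) \ (j ⁻¹' F)) := by
    have hfin : (j ⁻¹' F).Finite := hF.preimage hjinj.injOn
    have hd : Dense ((j ⁻¹' F)ᶜ) := hfin.countable.dense_compl ℝ
    have := closure_mono (hd.open_subset_closure_inter
      (isOpen_Ioo (a := S.aLim σ - 2 * S.bLim σ) (b := S.aLim σ + 2 * S.bLim σ)))
    rw [closure_Ioo hlt.ne, closure_closure] at this
    exact this hx₀
  rw [← hj0]
  refine closure_mono ?_ (image_closure_subset_closure_image hjc ⟨x₀, hx, rfl⟩)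
  rintro _ ⟨x, ⟨hx1, hx2⟩, rfl⟩
  have hx3 := S.band_subset σ (Ioo_subset_Icc_self hx1)
  exact ⟨S.mem_Tplus_of_lam_mem (by simpa using hjn x hx3) (Ioo_subset_Icc_self hx1) (hjl x hx3),
    hx2⟩

end WebSystem

/-! ### Solutions of the three-term recurrence -/

/-- `u` solves the difference equation of a channel at the spectral parameter `l`. -/
def IsChannelSolution (𝔞 𝔟 : ℕ → ℝ) (l : ℂ) (u : ℕ → ℂ) : Prop :=
  ∀ k, -(𝔟 k : ℂ) * u k + 𝔞 (k + 1) * u (k + 1) - 𝔟 (k + 1) * u (k + 2) = l * u (k + 1)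

/-- The Wronskian of two sequences, weighted by `𝔟`: for solutions at the same spectral parameter
it does not depend on `k`. -/
def casoratian (𝔟 : ℕ → ℝ) (u v : ℕ → ℂ) (k : ℕ) : ℂ := 𝔟 k * (u k * v (k + 1) - u (k + 1) * v k)

section Recurrence

variable {𝔞 𝔟 : ℕ → ℝ} {l m : ℂ} {u v : ℕ → ℂ}

theorem IsChannelSolution.add (hu : IsChannelSolution 𝔞 𝔟 l u) (hv : IsChannelSolution 𝔞 𝔟 l v) :
    IsChannelSolution 𝔞 𝔟 l fun k => u k + v k := fun k => by
  linear_combination hu k + hv k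

theorem IsChannelSolution.const_mul (c : ℂ) (hu : IsChannelSolution 𝔞 𝔟 l u) :
    IsChannelSolution 𝔞 𝔟 l fun k => c * u k := fun k => by
  linear_combination c * hu k

theorem IsChannelSolution.conj (hu : IsChannelSolution 𝔞 𝔟 l u) :
    IsChannelSolution 𝔞 𝔟 (starRingEnd ℂ l) fun k => starRingEnd ℂ (u k) := fun k => by
  have := congrArg (starRingEnd ℂ) (hu k)
  simpa using this

theorem isChannelSolution_regularSolution (h𝔟 : ∀ k, 0 < 𝔟 k) (l : ℂ) :
    IsChannelSolution 𝔞 𝔟 l (regularSolution 𝔞 𝔟 l) := fun k => by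
  have : (𝔟 (k + 1) : ℂ) ≠ 0 := by exact_mod_cast (h𝔟 (k + 1)).ne'
  rw [regularSolution]
  field_simp
  ring

theorem casoratian_succ (hu : IsChannelSolution 𝔞 𝔟 l u) (hv : IsChannelSolution 𝔞 𝔟 m v) (k : ℕ) :
    casoratian 𝔟 u v (k + 1) = casoratian 𝔟 u v k + (l - m) * (u (k + 1) * v (k + 1)) := by
  unfold casoratian
  linear_combination v (k + 1) * hu k - u (k + 1) * hv k

theorem casoratian_eq_add_sum (hu : IsChannelSolution 𝔞 𝔟 l u) (hv : IsChannelSolution 𝔞 𝔟 m v)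
    (n : ℕ) : casoratian 𝔟 u v n =
      casoratian 𝔟 u v 0 + (l - m) * ∑ k ∈ Finset.range n, u (k + 1) * v (k + 1) := by
  induction n with
  | zero => simp
  | succ n ih => rw [casoratian_succ hu hv, ih, Finset.sum_range_succ]; ring

theorem casoratian_eq (hu : IsChannelSolution 𝔞 𝔟 l u) (hv : IsChannelSolution 𝔞 𝔟 l v) (n : ℕ) :
    casoratian 𝔟 u v n = casoratian 𝔟 u v 0 := by
  rw [casoratian_eq_add_sum hu hv n]; ring

theorem IsChannelSolution.eq_zero_of_eventually (h𝔟 : ∀ k, 0 < 𝔟 k)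
    (hu : IsChannelSolution 𝔞 𝔟 l u) (h : ∀ᶠ k in atTop, u k = 0) (k : ℕ) : u k = 0 := by
  obtain ⟨K, hK⟩ := eventually_atTop.mp h
  have key : ∀ n j, K ≤ j + n → u j = 0 := by
    intro n
    induction n using Nat.strong_induction_on with
    | _ n ih =>
      intro j hj
      rcases n with _ | n
      · exact hK j (by omega)
      · have h1 := ih n (by omega) (j + 1) (by omega)
        have h2 := ih n (by omega) (j + 2) (by omega)
        have h3 := hu j
        have : (𝔟 j : ℂ) ≠ 0 := by exact_mod_cast (h𝔟 j).ne'
        rw [h1, h2] at h3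
        simpa [this] using h3
  exact key K k (by omega)

/-- Solutions with vanishing Wronskian are proportional. -/
theorem IsChannelSolution.mul_eq_mul (h𝔟 : ∀ k, 0 < 𝔟 k)
    (hu : IsChannelSolution 𝔞 𝔟 l u) (hv : IsChannelSolution 𝔞 𝔟 l v)
    (hcas : casoratian 𝔟 u v 0 = 0) (K k : ℕ) :
    u k * v K = u K * v k := by
  have hd := (hu.const_mul (v K)).add (hv.const_mul (-u K))
  have h1 : v K * u (K + 1) + -u K * v (K + 1) = 0 := by
    have h2 := casoratian_eq hu hv K
    have : (𝔟 K : ℂ) ≠ 0 := by exact_mod_cast (h𝔟 K).ne'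
    rw [hcas, casoratian, mul_eq_zero, or_iff_right this] at h2
    linear_combination -h2
  have h3 : ∀ n, v K * u (K + n) + -u K * v (K + n) = 0 ∧
      v K * u (K + n + 1) + -u K * v (K + n + 1) = 0 := fun n => by
    induction n with
    | zero => exact ⟨by rw [add_zero]; ring, h1⟩
    | succ n ih =>
      refine ⟨ih.2, ?_⟩
      have h4 := hd (K + n)
      simp only [ih.1, ih.2, mul_zero, zero_sub, zero_add] at h4
      have : (𝔟 (K + n + 1) : ℂ) ≠ 0 := by exact_mod_cast (h𝔟 _).ne'
      simpa [this, ← add_assoc] using h4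
  have h4 := hd.eq_zero_of_eventually h𝔟 (eventually_atTop.mpr ⟨K, fun n hn => by
    obtain ⟨j, rfl⟩ := Nat.exists_eq_add_of_le hn
    exact (h3 j).1⟩) k
  linear_combination h4

variable {a b : ℝ} {θ : ℂ}

theorem tendsto_casoratian_zero (h𝔟l : Tendsto 𝔟 atTop (𝓝 b)) {θ₁ θ₂ : ℂ} (h₁ : θ₁ ≠ 0)
    (h₂ : θ₂ ≠ 0) (hθ : ‖θ₁ * θ₂‖ < 1)
    (hu : ∃ c, Tendsto (fun k => u k / θ₁ ^ k) atTop (𝓝 c))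
    (hv : ∃ c, Tendsto (fun k => v k / θ₂ ^ k) atTop (𝓝 c)) :
    Tendsto (casoratian 𝔟 u v) atTop (𝓝 0) := by
  obtain ⟨c, hu⟩ := hu
  obtain ⟨d, hv⟩ := hv
  have h𝔟c : Tendsto (fun k => (𝔟 k : ℂ)) atTop (𝓝 b) :=
    (Complex.continuous_ofReal.tendsto b).comp h𝔟l
  have h1 := ((hu.mul (hv.comp (tendsto_add_atTop_nat 1))).const_mul θ₂).sub
    (((hu.comp (tendsto_add_atTop_nat 1)).mul hv).const_mul θ₁)
  have h2 := (h𝔟c.mul h1).mul (tendsto_pow_atTop_nhds_zero_of_norm_lt_one hθ)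
  rw [mul_zero] at h2
  refine h2.congr fun k => ?_
  simp only [casoratian, Function.comp, mul_pow, pow_succ]
  field_simp

/-- A solution of the recurrence is determined by the normalization `u k ∼ θ ^ k`, also when
`‖θ‖ = 1`: the Wronskian of two such solutions is constant and tends to zero, so that their ratio
is constant. -/
theorem IsChannelSolution.eq_of_tendsto (h𝔟 : ∀ k, 0 < 𝔟 k) (h𝔟l : Tendsto 𝔟 atTop (𝓝 b))
    (h0 : θ ≠ 0) (h1 : ‖θ‖ ≤ 1) (hu : IsChannelSolution 𝔞 𝔟 l u) (hv : IsChannelSolution 𝔞 𝔟 l v)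
    (hul : Tendsto (fun k => u k / θ ^ k) atTop (𝓝 1))
    (hvl : Tendsto (fun k => v k / θ ^ k) atTop (𝓝 1)) (k : ℕ) : u k = v k := by
  have h𝔟c : Tendsto (fun k => (𝔟 k : ℂ)) atTop (𝓝 b) :=
    (Complex.continuous_ofReal.tendsto b).comp h𝔟l
  have hcas : Tendsto (casoratian 𝔟 u v) atTop (𝓝 0) := by
    have h2 := (h𝔟c.mul ((hul.mul (hvl.comp (tendsto_add_atTop_nat 1))).sub
      ((hul.comp (tendsto_add_atTop_nat 1)).mul hvl)))
    replace h2 := h2.norm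
    simp only [mul_one, sub_self, mul_zero, norm_zero] at h2
    refine squeeze_zero_norm (fun k => ?_) h2
    have : casoratian 𝔟 u v k = (𝔟 k * (u k / θ ^ k * (v (k + 1) / θ ^ (k + 1)) -
        u (k + 1) / θ ^ (k + 1) * (v k / θ ^ k))) * θ ^ (2 * k + 1) := by
      simp only [casoratian]; field_simp; ring
    rw [this, norm_mul, norm_pow]
    exact mul_le_of_le_one_right (norm_nonneg _) (pow_le_one₀ (norm_nonneg _) h1)
  have hcas0 : ∀ k, casoratian 𝔟 u v k = 0 := fun k => by
    have : casoratian 𝔟 u v = fun _ => casoratian 𝔟 u v 0 := funext fun n => casoratian_eq hu hv n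
    rw [this] at hcas ⊢
    exact tendsto_nhds_unique tendsto_const_nhds hcas
  have hcross : ∀ k, u k * v (k + 1) = u (k + 1) * v k := fun k => by
    have h2 := hcas0 k
    have : (𝔟 k : ℂ) ≠ 0 := by exact_mod_cast (h𝔟 k).ne'
    simpa [casoratian, this, sub_eq_zero] using h2
  have hvne : ∀ᶠ k in atTop, v k ≠ 0 := by
    filter_upwards [hvl.eventually_ne one_ne_zero] with k hk h
    simp [h] at hk
  obtain ⟨K, hK⟩ := eventually_atTop.mp hvne
  have hratio : ∀ n, u (K + n) / v (K + n) = u K / v K := fun n => by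
    induction n with
    | zero => rfl
    | succ n ih =>
      rw [← ih, div_eq_div_iff (hK _ (by omega)) (hK _ (by omega))]
      exact (hcross (K + n)).symm
  have hone : u K / v K = 1 := by
    have h2 : Tendsto (fun k => u k / v k) atTop (𝓝 1) := by
      have := hul.div hvl one_ne_zero
      rw [div_one] at this
      refine this.congr fun k => ?_
      rw [Pi.div_apply, div_div_div_cancel_right₀ (pow_ne_zero k h0)]
    have h3 := h2.comp (tendsto_add_atTop_nat K)
    refine tendsto_nhds_unique (tendsto_const_nhds.congr fun n => ?_) h3
    rw [Function.comp, add_comm n K, hratio]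
  have hd : IsChannelSolution 𝔞 𝔟 l fun k => u k + (-1) * v k := hu.add (hv.const_mul _)
  have := hd.eq_zero_of_eventually h𝔟 (eventually_atTop.mpr ⟨K, fun n hn => by
    obtain ⟨j, rfl⟩ := Nat.exists_eq_add_of_le hn
    have h4 := hratio j
    rw [hone, div_eq_one_iff_eq (hK _ hn)] at h4
    simp only [h4]; ring⟩) k
  linear_combination this

theorem tendsto_of_linear_recurrence {w h : ℕ → ℂ} {ρ c : ℂ} (hρ : ‖ρ‖ < 1)
    (hw : ∀ᶠ k in atTop, w (k + 1) = ρ * w k + h k) (hh : Tendsto h atTop (𝓝 ((1 - ρ) * c))) :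
    Tendsto w atTop (𝓝 c) := by
  rw [Metric.tendsto_atTop] at hh ⊢
  intro δ hδ
  have hpos : 0 < (1 - ‖ρ‖) * (δ / 2) := mul_pos (by linarith) (by linarith)
  obtain ⟨K₁, hK₁⟩ := hh _ hpos
  obtain ⟨K₂, hK₂⟩ := eventually_atTop.mp hw
  set K := max K₁ K₂ with hK
  have key : ∀ n, ‖w (K + n) - c‖ ≤ ‖ρ‖ ^ n * ‖w K - c‖ + δ / 2 := fun n => by
    induction n with
    | zero => simp; linarith
    | succ n ih =>
      have h1 := hK₂ (K + n) (by omega)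
      have h2 := hK₁ (K + n) (by omega)
      rw [dist_eq_norm] at h2
      have h3 : w (K + (n + 1)) - c = ρ * (w (K + n) - c) + (h (K + n) - (1 - ρ) * c) := by
        rw [← add_assoc, h1]; ring
      calc ‖w (K + (n + 1)) - c‖ ≤ ‖ρ‖ * ‖w (K + n) - c‖ + ‖h (K + n) - (1 - ρ) * c‖ := by
            rw [h3, ← norm_mul]; exact norm_add_le _ _
        _ ≤ ‖ρ‖ * (‖ρ‖ ^ n * ‖w K - c‖ + δ / 2) + (1 - ‖ρ‖) * (δ / 2) := by gcongr
        _ = _ := by ring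
  have h4 : Tendsto (fun n => ‖ρ‖ ^ n * ‖w K - c‖) atTop (𝓝 0) := by
    simpa using (tendsto_pow_atTop_nhds_zero_of_lt_one (norm_nonneg ρ) hρ).mul_const ‖w K - c‖
  obtain ⟨N, hN⟩ := eventually_atTop.mp (h4.eventually (gt_mem_nhds (half_pos hδ)))
  refine ⟨K + N, fun n hn => ?_⟩
  obtain ⟨j, rfl⟩ := Nat.exists_eq_add_of_le hn
  rw [dist_eq_norm, add_assoc]
  linarith [key (N + j), hN (N + j) (by omega)]

/-- Inside the disk, the Wronskian with the decaying solution fixes the growth of a solution. -/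
theorem tendsto_mul_pow_of_casoratian (h𝔟l : Tendsto 𝔟 atTop (𝓝 b)) (hb : b ≠ 0)
    (h0 : θ ≠ 0) (h1 : ‖θ‖ < 1) (hvl : Tendsto (fun k => v k / θ ^ k) atTop (𝓝 1))
    (hcas : ∀ k, casoratian 𝔟 u v k = b * (θ - θ⁻¹)) :
    Tendsto (fun k => u k * θ ^ k) atTop (𝓝 1) := by
  have h𝔟c : Tendsto (fun k => (𝔟 k : ℂ)) atTop (𝓝 b) :=
    (Complex.continuous_ofReal.tendsto b).comp h𝔟l
  have hb' : (b : ℂ) ≠ 0 := by exact_mod_cast hb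
  have hlim : Tendsto (fun k => (1 - θ ^ 2) * (b / 𝔟 k) / ((v k / θ ^ k) *
      (v (k + 1) / θ ^ (k + 1)))) atTop (𝓝 ((1 - θ ^ 2) * 1)) := by
    have h2 := ((tendsto_const_nhds (x := (b : ℂ))).div h𝔟c hb').const_mul (1 - θ ^ 2)
    have h3 := h2.div (hvl.mul (hvl.comp (tendsto_add_atTop_nat 1))) (by norm_num)
    rw [div_self hb', one_mul, div_one] at h3
    exact h3
  have hrec := tendsto_of_linear_recurrence (w := fun k => u k * θ ^ k / (v k / θ ^ k))
    (ρ := θ ^ 2) (c := 1) (by rw [norm_pow]; exact pow_lt_one₀ (norm_nonneg _) h1 two_ne_zero)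
    ?_ hlim
  · refine ((hrec.mul hvl).congr' ?_).trans (by simp)
    filter_upwards [hvl.eventually_ne one_ne_zero] with k hk
    exact div_mul_cancel₀ _ hk
  · filter_upwards [hvl.eventually_ne one_ne_zero,
      (tendsto_add_atTop_nat 1).eventually (hvl.eventually_ne one_ne_zero),
      h𝔟c.eventually_ne hb'] with k hk hk' hbk
    have hc := hcas k
    have hv0 : v k ≠ 0 := by intro h; simp [h] at hk
    have hv1 : v (k + 1) ≠ 0 := by intro h; simp [h] at hk'
    simp only [casoratian] at hc
    field_simp at hc
    field_simp
    linear_combination (-θ * θ ^ (2 * k)) * hc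

end Recurrence

/-! ### Construction of the Jost solutions -/

section Construction

/-- One step of the recurrence for the Jost solutions, run backwards from infinity: it takes
the pair `(g (k + 1), F (k + 1))` to `(g k, F k)`, where `θ ^ k * g k` is the solution and
`F k = 𝔟 k * (g k - g (k + 1))`. -/
noncomputable def jostStep (𝔞 𝔟 : ℕ → ℝ) (a b : ℝ) (θ : ℂ) (k : ℕ) (x : ℂ × ℂ) : ℂ × ℂ :=
  let F := θ ^ 2 * x.2 +
    ((𝔞 (k + 1) - a) * θ + (b - 𝔟 (k + 1)) * θ ^ 2 + (b - 𝔟 k)) * x.1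
  (x.1 + F / 𝔟 k, F)

/-- The result of `n` backward steps that end at the index `k`. -/
noncomputable def jostIter (𝔞 𝔟 : ℕ → ℝ) (a b : ℝ) (θ : ℂ) : ℕ → ℕ → ℂ × ℂ → ℂ × ℂ
  | _, 0, x => x
  | k, n + 1, x => jostStep 𝔞 𝔟 a b θ k (jostIter 𝔞 𝔟 a b θ (k + 1) n x)

variable {𝔞 𝔟 : ℕ → ℝ} {a b : ℝ} {θ : ℂ}

theorem jostStep_sub (k : ℕ) (x y : ℂ × ℂ) :
    jostStep 𝔞 𝔟 a b θ k (x - y) = jostStep 𝔞 𝔟 a b θ k x - jostStep 𝔞 𝔟 a b θ k y := by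
  ext <;> simp [jostStep] <;> ring

theorem jostIter_sub (n k : ℕ) (x y : ℂ × ℂ) :
    jostIter 𝔞 𝔟 a b θ k n (x - y) = jostIter 𝔞 𝔟 a b θ k n x - jostIter 𝔞 𝔟 a b θ k n y := by
  induction n generalizing k with
  | zero => rfl
  | succ n ih => simp only [jostIter, ih, jostStep_sub]

theorem jostIter_succ' (n k : ℕ) (x : ℂ × ℂ) : jostIter 𝔞 𝔟 a b θ k (n + 1) x =
    jostIter 𝔞 𝔟 a b θ k n (jostStep 𝔞 𝔟 a b θ (k + n) x) := by
  induction n generalizing k with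
  | zero => rfl
  | succ n ih =>
    rw [jostIter, ih, jostIter, show k + 1 + n = k + (n + 1) by ring]

theorem differentiable_jostIter (n k : ℕ) (x : ℂ × ℂ) :
    Differentiable ℂ (fun θ => (jostIter 𝔞 𝔟 a b θ k n x).1) ∧
      Differentiable ℂ (fun θ => (jostIter 𝔞 𝔟 a b θ k n x).2) := by
  induction n generalizing k with
  | zero => simp [jostIter]
  | succ n ih =>
    obtain ⟨h1, h2⟩ := ih (k + 1)
    simp only [jostIter, jostStep]
    exact ⟨by fun_prop, by fun_prop⟩

/-- The first components satisfy the recurrence exactly. -/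
theorem jostIter_recurrence (h𝔟 : ∀ k, 0 < 𝔟 k) (n k : ℕ) (x : ℂ × ℂ) :
    𝔟 k * (jostIter 𝔞 𝔟 a b θ k (n + 2) x).1 =
      ((𝔞 (k + 1) - a) * θ + b * θ ^ 2 + b) * (jostIter 𝔞 𝔟 a b θ (k + 1) (n + 1) x).1
        - 𝔟 (k + 1) * θ ^ 2 * (jostIter 𝔞 𝔟 a b θ (k + 2) n x).1 := by
  have h0 : (𝔟 k : ℂ) ≠ 0 := by exact_mod_cast (h𝔟 k).ne'
  have h1 : (𝔟 (k + 1) : ℂ) ≠ 0 := by exact_mod_cast (h𝔟 (k + 1)).ne'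
  simp only [jostIter]
  generalize jostIter 𝔞 𝔟 a b θ (k + 1 + 1) n x = y
  simp only [jostStep]
  field_simp
  ring

/-- The weighted norm in which the backward steps are almost contractions. -/
noncomputable def jostNorm (s : ℝ) (k : ℕ) (x : ℂ × ℂ) : ℝ := ‖x.1‖ + s⁻¹ ^ k * ‖x.2‖

theorem jostNorm_step_le {s c β : ℝ} (hs : 0 < s) (hs1 : s < 1) (hc : 0 ≤ c) (hβ : 0 < β)
    (h𝔟 : ∀ k, β ≤ 𝔟 k) (hθ : ‖θ‖ ^ 2 ≤ s⁻¹)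
    (hζ : ∀ k, ‖((𝔞 (k + 1) - a) * θ + (b - 𝔟 (k + 1)) * θ ^ 2 + (b - 𝔟 k) : ℂ)‖ ≤ c * s ^ (2 * k))
    (k : ℕ) (x : ℂ × ℂ) :
    jostNorm s k (jostStep 𝔞 𝔟 a b θ k x) ≤
      (1 + ((β⁻¹ + 1) * c + β⁻¹) * s ^ k) * jostNorm s (k + 1) x := by
  set ζ : ℂ := ((𝔞 (k + 1) - a) * θ + (b - 𝔟 (k + 1)) * θ ^ 2 + (b - 𝔟 k) : ℂ) with hζd
  have hζk : ‖ζ‖ ≤ c * s ^ (2 * k) := hζ k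
  have hF : ‖θ ^ 2 * x.2 + ζ * x.1‖ ≤ s⁻¹ * ‖x.2‖ + c * s ^ (2 * k) * ‖x.1‖ := by
    refine (norm_add_le _ _).trans ?_
    rw [norm_mul, norm_mul, norm_pow]
    gcongr
  have h𝔟k : ‖(𝔟 k : ℂ)‖⁻¹ ≤ β⁻¹ := by
    rw [Complex.norm_real, Real.norm_of_nonneg (hβ.le.trans (h𝔟 k))]
    exact inv_anti₀ hβ (h𝔟 k)
  have hsk : s ^ k ≤ 1 := pow_le_one₀ hs.le hs1.le
  have hsk0 : 0 < s ^ k := pow_pos hs k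
  have hβi : 0 < β⁻¹ := inv_pos.mpr hβ
  have hn1 := norm_nonneg x.1
  have hn2 := norm_nonneg x.2
  have e1 : s⁻¹ ^ k * s ^ k = 1 := by rw [← mul_pow, inv_mul_cancel₀ hs.ne', one_pow]
  have hik : 1 ≤ s⁻¹ ^ k := one_le_pow₀ (one_le_inv_iff₀.mpr ⟨hs, hs1.le⟩)
  have hsi : 0 < s⁻¹ := inv_pos.mpr hs
  calc jostNorm s k (jostStep 𝔞 𝔟 a b θ k x)
      = ‖x.1 + (θ ^ 2 * x.2 + ζ * x.1) / 𝔟 k‖ + s⁻¹ ^ k * ‖θ ^ 2 * x.2 + ζ * x.1‖ := rfl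
    _ ≤ (‖x.1‖ + β⁻¹ * ‖θ ^ 2 * x.2 + ζ * x.1‖) + s⁻¹ ^ k * ‖θ ^ 2 * x.2 + ζ * x.1‖ := by
        gcongr
        refine (norm_add_le _ _).trans ?_
        rw [norm_div, div_eq_inv_mul]
        gcongr
    _ = ‖x.1‖ + (β⁻¹ + s⁻¹ ^ k) * ‖θ ^ 2 * x.2 + ζ * x.1‖ := by ring
    _ ≤ ‖x.1‖ + (β⁻¹ + s⁻¹ ^ k) * (s⁻¹ * ‖x.2‖ + c * s ^ (2 * k) * ‖x.1‖) := by gcongr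
    _ = ‖x.1‖ + (β⁻¹ * s ^ k + s⁻¹ ^ k * s ^ k) * (c * s ^ k) * ‖x.1‖
        + (β⁻¹ + s⁻¹ ^ k) * (s⁻¹ * ‖x.2‖) := by ring
    _ = ‖x.1‖ + (β⁻¹ * s ^ k + 1) * (c * s ^ k) * ‖x.1‖
        + (β⁻¹ * (s⁻¹ ^ k * s ^ k) + s⁻¹ ^ k) * (s⁻¹ * ‖x.2‖) := by rw [e1, mul_one]
    _ = ‖x.1‖ + (β⁻¹ * s ^ k + 1) * (c * s ^ k) * ‖x.1‖
        + (1 + β⁻¹ * s ^ k) * (s⁻¹ ^ (k + 1) * ‖x.2‖) := by ring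
    _ ≤ ‖x.1‖ + (β⁻¹ * 1 + 1) * (c * s ^ k) * ‖x.1‖ + β⁻¹ * s ^ k * ‖x.1‖
        + (1 + β⁻¹ * s ^ k + (β⁻¹ + 1) * c * s ^ k) * (s⁻¹ ^ (k + 1) * ‖x.2‖) := by
        have : 0 ≤ β⁻¹ * s ^ k * ‖x.1‖ := by positivity
        have h3 : 0 ≤ (β⁻¹ + 1) * c * s ^ k := by positivity
        have h4 : ‖x.1‖ + (β⁻¹ * s ^ k + 1) * (c * s ^ k) * ‖x.1‖
            ≤ ‖x.1‖ + (β⁻¹ * 1 + 1) * (c * s ^ k) * ‖x.1‖ := by gcongr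
        have h5 : (1 + β⁻¹ * s ^ k) * (s⁻¹ ^ (k + 1) * ‖x.2‖) ≤
          (1 + β⁻¹ * s ^ k + (β⁻¹ + 1) * c * s ^ k) * (s⁻¹ ^ (k + 1) * ‖x.2‖) :=
          mul_le_mul_of_nonneg_right (by linarith) (by positivity)
        linarith
    _ = _ := by simp only [jostNorm]; ring

/-- Jost solutions exist and, divided by `θ ^ k`, extend holomorphically to a disk of radius larger
than `1`. The quotient `g k` is the limit, as `n → ∞`, of `n` backward steps that start from `(1, 0)`
at the index `k + n`; the perturbation decays fast enough for this sequence to be Cauchy at a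
geometric rate, uniformly in the larger disk. -/
theorem exists_jost (hb : 0 < b) (h𝔟 : ∀ k, 0 < 𝔟 k) {ε : ℝ} (hε : 0 < ε)
    (hsum : Summable fun k : ℕ => (1 + ε) ^ (k + 1) * (|𝔞 (k + 1) - a| + |𝔟 (k + 1) - b|)) :
    ∃ (R : ℝ) (g : ℕ → ℂ → ℂ) (c s : ℝ), 1 < R ∧ 0 < s ∧ s < 1 ∧
      (∀ k, DifferentiableOn ℂ (g k) (ball 0 R)) ∧
      (∀ k, ∀ θ ∈ ball (0 : ℂ) R, 𝔟 k * g k θ = ((𝔞 (k + 1) - a) * θ + b * θ ^ 2 + b) * g (k + 1) θ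
        - 𝔟 (k + 1) * θ ^ 2 * g (k + 2) θ) ∧
      ∀ k, ∀ θ ∈ ball (0 : ℂ) R, ‖g k θ - 1‖ ≤ c * s ^ k := by
  -- with `s = (1 + ε) ^ (-1/2)` and `R = s ^ (-1/2)` the perturbation decays like `s ^ (2 * k)`
  obtain ⟨s, hs, hs1, hsε⟩ : ∃ s : ℝ, 0 < s ∧ s < 1 ∧ s ^ 2 = (1 + ε)⁻¹ := by
    have h1 : 1 < Real.sqrt (1 + ε) := by rw [Real.lt_sqrt] <;> linarith
    refine ⟨(Real.sqrt (1 + ε))⁻¹, by positivity, inv_lt_one_of_one_lt₀ h1, ?_⟩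
    rw [inv_pow, Real.sq_sqrt (by linarith)]
  have hs2 : ∀ k : ℕ, s ^ (2 * k) * (1 + ε) ^ k = 1 := fun k => by
    rw [pow_mul, hsε, ← mul_pow, inv_mul_cancel₀ (by linarith), one_pow]
  obtain ⟨M, hM0, hM⟩ : ∃ M, 0 ≤ M ∧ ∀ k, |𝔞 (k + 1) - a| + |𝔟 (k + 1) - b| ≤ M * s ^ (2 * (k + 1)) := by
    refine ⟨∑' k, (1 + ε) ^ (k + 1) * (|𝔞 (k + 1) - a| + |𝔟 (k + 1) - b|),
      tsum_nonneg fun k => by positivity, fun k => ?_⟩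
    have h1 := hsum.le_tsum k fun j _ => by positivity
    calc |𝔞 (k + 1) - a| + |𝔟 (k + 1) - b|
        = ((1 + ε) ^ (k + 1) * (|𝔞 (k + 1) - a| + |𝔟 (k + 1) - b|)) * s ^ (2 * (k + 1)) := by
          linear_combination -(|𝔞 (k + 1) - a| + |𝔟 (k + 1) - b|) * hs2 (k + 1)
      _ ≤ _ := by gcongr
  obtain ⟨M', hM'0, hM'⟩ : ∃ M', 0 ≤ M' ∧ ∀ k, |𝔟 k - b| ≤ M' * s ^ (2 * k) := by
    refine ⟨M + |𝔟 0 - b|, by positivity, fun k => ?_⟩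
    rcases k with _ | k
    · simp [hM0]
    · have h1 := hM k
      have h2 := abs_nonneg (𝔞 (k + 1) - a)
      have h3 : 0 ≤ |𝔟 0 - b| * s ^ (2 * (k + 1)) := by positivity
      linarith
  have h𝔟l : Tendsto 𝔟 atTop (𝓝 b) := by
    rw [tendsto_iff_norm_sub_tendsto_zero]
    have h1 : Tendsto (fun k : ℕ => M' * (s ^ 2) ^ k) atTop (𝓝 0) := by
      simpa using (tendsto_pow_atTop_nhds_zero_of_lt_one (sq_nonneg s)
        (pow_lt_one₀ hs.le hs1 two_ne_zero)).const_mul M'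
    exact squeeze_zero (fun _ => norm_nonneg _) (fun k => by
      rw [Real.norm_eq_abs, ← pow_mul]; exact hM' k) h1
  obtain ⟨β, hβ, h𝔟β⟩ : ∃ β, 0 < β ∧ ∀ k, β ≤ 𝔟 k := by
    obtain ⟨K, hK⟩ := eventually_atTop.mp (h𝔟l.eventually (lt_mem_nhds (half_lt_self hb)))
    obtain ⟨j, -, hj⟩ := (Finset.range (K + 1)).exists_min_image 𝔟 ⟨0, by simp⟩
    refine ⟨min (b / 2) (𝔟 j), lt_min (by linarith) (h𝔟 j), fun k => ?_⟩
    by_cases hk : k < K + 1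
    · exact (min_le_right _ _).trans (hj k (by simpa using hk))
    · exact (min_le_left _ _).trans (hK k (by omega)).le
  set c : ℝ := M * s⁻¹ + M * s⁻¹ + M' with hc
  have hc0 : 0 ≤ c := by positivity
  have hsi : 1 < s⁻¹ := (one_lt_inv₀ hs).mpr hs1
  have hζ : ∀ θ : ℂ, ‖θ‖ ^ 2 ≤ s⁻¹ → ∀ k,
      ‖((𝔞 (k + 1) - a) * θ + (b - 𝔟 (k + 1)) * θ ^ 2 + (b - 𝔟 k) : ℂ)‖ ≤ c * s ^ (2 * k) := by
    intro θ hθ k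
    have hθ1 : ‖θ‖ ≤ s⁻¹ := by
      by_contra hcon
      push Not at hcon
      nlinarith
    have e1 : ‖((𝔞 (k + 1) : ℂ) - a)‖ = |𝔞 (k + 1) - a| := by
      rw [← Complex.ofReal_sub, Complex.norm_real, Real.norm_eq_abs]
    have e2 : ∀ j, ‖((b : ℂ) - 𝔟 j)‖ = |𝔟 j - b| := fun j => by
      rw [← Complex.ofReal_sub, Complex.norm_real, Real.norm_eq_abs, abs_sub_comm]
    have hmono : s ^ (2 * (k + 1)) ≤ s ^ (2 * k) := pow_le_pow_of_le_one hs.le hs1.le (by omega)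
    have h1 : |𝔞 (k + 1) - a| ≤ M * s ^ (2 * k) := by
      have := hM k
      have h2 := abs_nonneg (𝔟 (k + 1) - b)
      have h3 : M * s ^ (2 * (k + 1)) ≤ M * s ^ (2 * k) := by gcongr
      linarith
    have h2 : |𝔟 (k + 1) - b| ≤ M * s ^ (2 * k) := by
      have := hM k
      have h2 := abs_nonneg (𝔞 (k + 1) - a)
      have h3 : M * s ^ (2 * (k + 1)) ≤ M * s ^ (2 * k) := by gcongr
      linarith
    calc _ ≤ ‖((𝔞 (k + 1) : ℂ) - a)‖ * ‖θ‖ + ‖((b : ℂ) - 𝔟 (k + 1))‖ * ‖θ‖ ^ 2 + ‖((b : ℂ) - 𝔟 k)‖ := by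
          refine (norm_add_le _ _).trans (add_le_add ((norm_add_le _ _).trans ?_) le_rfl)
          rw [norm_mul, norm_mul, norm_pow]
      _ ≤ M * s ^ (2 * k) * s⁻¹ + M * s ^ (2 * k) * s⁻¹ + M' * s ^ (2 * k) := by
          rw [e1, e2, e2]; gcongr; exact hM' k
      _ = c * s ^ (2 * k) := by rw [hc]; ring
  set K : ℝ := (β⁻¹ + 1) * c + β⁻¹ with hK
  have hK0 : 0 ≤ K := by positivity
  set P : ℝ := Real.exp (K * (1 - s)⁻¹) with hP
  -- the product of the factors `1 + K s ^ k` stays bounded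
  have hiter : ∀ θ : ℂ, ‖θ‖ ^ 2 ≤ s⁻¹ → ∀ n k x,
      jostNorm s k (jostIter 𝔞 𝔟 a b θ k n x) ≤ P * jostNorm s (k + n) x := by
    intro θ hθ n k x
    have h1 : ∀ n k, jostNorm s k (jostIter 𝔞 𝔟 a b θ k n x) ≤
        Real.exp (∑ j ∈ Finset.range n, K * s ^ (k + j)) * jostNorm s (k + n) x := by
      intro n
      induction n with
      | zero => intro k; simp [jostIter]
      | succ n ih =>
        intro k
        refine (jostNorm_step_le hs hs1 hc0 hβ h𝔟β hθ (hζ θ hθ) k _).trans ?_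
        rw [Finset.sum_range_succ', Real.exp_add, add_zero]
        have h2 : 1 + K * s ^ k ≤ Real.exp (K * s ^ k) := by
          rw [add_comm]; exact Real.add_one_le_exp _
        have h3 := ih (k + 1)
        have h4 : ∀ j, k + (j + 1) = k + 1 + j := fun j => by ring
        have h6 : ∑ j ∈ Finset.range n, K * s ^ (k + (j + 1)) =
            ∑ j ∈ Finset.range n, K * s ^ (k + 1 + j) :=
          Finset.sum_congr rfl fun j _ => by rw [h4]
        have h5 : 0 ≤ jostNorm s (k + 1) (jostIter 𝔞 𝔟 a b θ (k + 1) n x) := by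
          unfold jostNorm; positivity
        rw [h6, h4 n]
        calc _ ≤ Real.exp (K * s ^ k) * (Real.exp (∑ j ∈ Finset.range n, K * s ^ (k + 1 + j)) *
              jostNorm s (k + 1 + n) x) := by gcongr
          _ = _ := by ring
    refine (h1 n k).trans ?_
    have h5 : 0 ≤ jostNorm s (k + n) x := by unfold jostNorm; positivity
    rw [hP]
    gcongr
    rw [← Finset.mul_sum]
    gcongr
    calc ∑ j ∈ Finset.range n, s ^ (k + j) ≤ ∑ j ∈ Finset.range n, s ^ j :=
          Finset.sum_le_sum fun j _ => pow_le_pow_of_le_one hs.le hs1.le (by omega)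
      _ ≤ ∑' j : ℕ, s ^ j := (summable_geometric_of_lt_one hs.le hs1).sum_le_tsum _
          fun j _ => by positivity
      _ = (1 - s)⁻¹ := tsum_geometric_of_lt_one hs.le hs1
  let G : ℕ → ℕ → ℂ → ℂ := fun k n θ => (jostIter 𝔞 𝔟 a b θ k n (1, 0)).1
  have hdist : ∀ θ : ℂ, ‖θ‖ ^ 2 ≤ s⁻¹ → ∀ k n, dist (G k n θ) (G k (n + 1) θ) ≤ P * K * s ^ k * s ^ n := by
    intro θ hθ k n
    have h1 : G k (n + 1) θ - G k n θ =
        (jostIter 𝔞 𝔟 a b θ k n (jostStep 𝔞 𝔟 a b θ (k + n) (1, 0) - (1, 0))).1 := by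
      rw [jostIter_sub, ← jostIter_succ']; rfl
    rw [dist_comm, dist_eq_norm, h1]
    have h2 : ∀ j (y : ℂ × ℂ), ‖y.1‖ ≤ jostNorm s j y := fun j y => by
      unfold jostNorm
      have : 0 ≤ s⁻¹ ^ j * ‖y.2‖ := by positivity
      linarith
    refine (h2 k _).trans ((hiter θ hθ n k _).trans ?_)
    rw [mul_assoc P, mul_assoc P, mul_assoc, ← pow_add]
    gcongr
    set N := k + n
    have h𝔟k : ‖(𝔟 N : ℂ)‖⁻¹ ≤ β⁻¹ := by
      rw [Complex.norm_real, Real.norm_of_nonneg (hβ.le.trans (h𝔟β N))]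
      exact inv_anti₀ hβ (h𝔟β N)
    have h3 := hζ θ hθ N
    simp only [jostNorm, jostStep, Prod.fst_sub, Prod.snd_sub, mul_zero, zero_add, mul_one,
      add_sub_cancel_left, sub_zero]
    generalize ((𝔞 (N + 1) - a) * θ + (b - 𝔟 (N + 1)) * θ ^ 2 + (b - 𝔟 N) : ℂ) = ζ at h3
    have e1 : s⁻¹ ^ N * s ^ N = 1 := by rw [← mul_pow, inv_mul_cancel₀ hs.ne', one_pow]
    have hsN : s ^ N ≤ 1 := pow_le_one₀ hs.le hs1.le
    calc ‖ζ / 𝔟 N‖ + s⁻¹ ^ N * ‖ζ‖ ≤ β⁻¹ * (c * s ^ (2 * N)) + s⁻¹ ^ N * (c * s ^ (2 * N)) := by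
          rw [norm_div, div_eq_inv_mul]; gcongr
      _ = β⁻¹ * c * s ^ N * s ^ N + c * s ^ N * (s⁻¹ ^ N * s ^ N) := by ring
      _ ≤ β⁻¹ * c * s ^ N * 1 + c * s ^ N * 1 + β⁻¹ * s ^ N := by
          rw [e1]
          have : 0 ≤ β⁻¹ * s ^ N := by positivity
          have h4 : β⁻¹ * c * s ^ N * s ^ N ≤ β⁻¹ * c * s ^ N * 1 := by gcongr
          linarith
      _ = K * s ^ N := by rw [hK]; ring
  have hlim : ∀ k (θ : ℂ), ∃ y, ‖θ‖ ^ 2 ≤ s⁻¹ → Tendsto (fun n => G k n θ) atTop (𝓝 y) := by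
    intro k θ
    by_cases hθ : ‖θ‖ ^ 2 ≤ s⁻¹
    · obtain ⟨y, hy⟩ := cauchySeq_tendsto_of_complete
        (cauchySeq_of_le_geometric s _ hs1 (hdist θ hθ k))
      exact ⟨y, fun _ => hy⟩
    · exact ⟨0, fun h => absurd h hθ⟩
  choose g hg using hlim
  have hR : ∀ θ ∈ ball (0 : ℂ) (Real.sqrt s⁻¹), ‖θ‖ ^ 2 ≤ s⁻¹ := fun θ hθ => by
    rw [mem_ball_zero_iff] at hθ
    have := Real.sq_sqrt (inv_pos.mpr hs).le
    nlinarith [norm_nonneg θ]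
  refine ⟨Real.sqrt s⁻¹, g, P * K / (1 - s), s, ?_, hs, hs1, fun k => ?_, fun k θ hθ => ?_,
    fun k θ hθ => ?_⟩
  · rw [Real.lt_sqrt] <;> linarith
  · have hunif : TendstoUniformlyOn (G k) (g k) atTop (ball 0 (Real.sqrt s⁻¹)) := by
      rw [Metric.tendstoUniformlyOn_iff]
      intro δ hδ
      have h1 : Tendsto (fun n : ℕ => P * K * s ^ k * s ^ n / (1 - s)) atTop (𝓝 0) := by
        simpa using ((tendsto_pow_atTop_nhds_zero_of_lt_one hs.le hs1).const_mul
          (P * K * s ^ k)).div_const (1 - s)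
      filter_upwards [h1.eventually (gt_mem_nhds hδ)] with n hn θ hθ
      rw [dist_comm]
      exact (dist_le_of_le_geometric_of_tendsto s _ hs1 (hdist θ (hR θ hθ) k)
        (hg k θ (hR θ hθ)) n).trans_lt hn
    exact hunif.tendstoLocallyUniformlyOn.differentiableOn
      (Eventually.of_forall fun n => (differentiable_jostIter n k (1, 0)).1.differentiableOn)
      isOpen_ball
  · have h1 := hR θ hθ
    have h2 := ((hg k θ h1).comp (tendsto_add_atTop_nat 2)).const_mul (𝔟 k : ℂ)
    have h3 := (((hg (k + 1) θ h1).comp (tendsto_add_atTop_nat 1)).const_mul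
      ((𝔞 (k + 1) - a) * θ + b * θ ^ 2 + b : ℂ)).sub
      ((hg (k + 2) θ h1).const_mul (𝔟 (k + 1) * θ ^ 2 : ℂ))
    refine tendsto_nhds_unique h2 (h3.congr fun n => ?_)
    exact (jostIter_recurrence h𝔟 n k (1, 0)).symm
  · have h1 := dist_le_of_le_geometric_of_tendsto₀ s _ hs1 (hdist θ (hR θ hθ) k)
      (hg k θ (hR θ hθ))
    rw [dist_comm, dist_eq_norm] at h1
    calc ‖g k θ - 1‖ ≤ P * K * s ^ k / (1 - s) := h1
      _ = _ := by ring

end Construction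

namespace WebSystem

variable {A C : Type*} [Fintype C] (S : WebSystem A C)

/-! ### The Jost solutions of a channel -/

theorem coefB_pos (γ : C) (k : ℕ) : 0 < S.coefB γ k := S.coupling_pos γ k

theorem coefB_ne_zero (γ : C) (k : ℕ) : (S.coefB γ k : ℂ) ≠ 0 := by
  exact_mod_cast (S.coefB_pos γ k).ne'

theorem tendsto_coefB (γ : C) : Tendsto (S.coefB γ) atTop (𝓝 (S.bLim γ)) := by
  obtain ⟨ε, hε, hsum⟩ := S.decay
  have h1 := (hsum γ).tendsto_atTop_zero
  rw [← tendsto_add_atTop_iff_nat 1, tendsto_iff_norm_sub_tendsto_zero]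
  refine squeeze_zero (fun _ => norm_nonneg _) (fun k => ?_) h1
  have h2 : 1 ≤ (1 + ε) ^ (k + 1) := one_le_pow₀ (by linarith)
  have h3 := abs_nonneg (S.L (S.pt γ (k + 1)) (S.pt γ (k + 1)) - S.aLim γ)
  have h4 := abs_nonneg (-S.L (S.pt γ (k + 1)) (S.pt γ (k + 2)) - S.bLim γ)
  rw [Real.norm_eq_abs, coefB]
  nlinarith

/-- The Jost solutions divided by `θ ^ k`: they extend holomorphically beyond the unit disk,
do not vanish at the origin, and tend to `1` geometrically. -/
theorem exists_jost_factor (γ : C) : ∃ (R : ℝ) (g : ℕ → ℂ → ℂ) (c s : ℝ), 1 < R ∧ 0 < s ∧ s < 1 ∧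
    (∀ k, DifferentiableOn ℂ (g k) (ball 0 R)) ∧
    (∀ k, ∀ θ ∈ closedBall (0 : ℂ) 1, S.jost γ k θ = θ ^ k * g k θ) ∧ (∀ k, g k 0 ≠ 0) ∧
    (∀ k, ∀ θ ∈ closedBall (0 : ℂ) 1, ‖g k θ - 1‖ ≤ c * s ^ k) ∧
    IsJostFamily (S.coefA γ) (S.coefB γ) (S.aLim γ) (S.bLim γ) (S.jost γ) := by
  obtain ⟨ε, hε, hsum⟩ := S.decay
  obtain ⟨R, g, c, s, hR, hs, hs1, hdiff, hrec, hbd⟩ := exists_jost (𝔞 := S.coefA γ)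
    (𝔟 := S.coefB γ) (a := S.aLim γ) (S.bLim_pos γ) (S.coefB_pos γ) hε (hsum γ)
  have hsub : closedBall (0 : ℂ) 1 ⊆ ball 0 R := closedBall_subset_ball hR
  have hgeo : Tendsto (fun k : ℕ => c * s ^ k) atTop (𝓝 0) := by
    simpa using (tendsto_pow_atTop_nhds_zero_of_lt_one hs.le hs1).const_mul c
  have hglim : ∀ θ ∈ closedBall (0 : ℂ) 1, Tendsto (fun k => g k θ) atTop (𝓝 1) := fun θ hθ => by
    rw [tendsto_iff_norm_sub_tendsto_zero]
    exact squeeze_zero (fun _ => norm_nonneg _) (fun k => hbd k θ (hsub hθ)) hgeo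
  have hfam : IsJostFamily (S.coefA γ) (S.coefB γ) (S.aLim γ) (S.bLim γ)
      fun k θ => θ ^ k * g k θ := by
    refine ⟨fun k => ?_, fun k => ?_, fun θ hθ h0 k => ?_, ?_⟩
    · have := (hdiff k).mono (ball_subset_ball hR.le)
      fun_prop
    · have := (hdiff k).continuousOn.mono hsub
      fun_prop
    · have := hrec k θ (hsub hθ)
      simp only [zhukovskii]
      field_simp
      linear_combination (-θ ^ (k + 1)) * this
    · rw [Metric.tendstoUniformlyOn_iff]
      intro δ hδ
      filter_upwards [hgeo.eventually (gt_mem_nhds hδ)] with k hk θ hθ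
      rw [mul_div_cancel_left₀ _ (pow_ne_zero k hθ.2), dist_comm, dist_eq_norm]
      exact (hbd k θ (hsub hθ.1)).trans_lt hk
  have hjost : IsJostFamily (S.coefA γ) (S.coefB γ) (S.aLim γ) (S.bLim γ) (S.jost γ) :=
    Classical.epsilon_spec ⟨_, hfam⟩
  have heq : ∀ k, ∀ θ ∈ closedBall (0 : ℂ) 1 \ {0}, S.jost γ k θ = θ ^ k * g k θ := by
    intro k θ hθ
    exact IsChannelSolution.eq_of_tendsto (u := fun k => S.jost γ k θ)
      (v := fun k => θ ^ k * g k θ) (S.coefB_pos γ) (S.tendsto_coefB γ) hθ.2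
      (by simpa using hθ.1) (hjost.equation θ hθ.1 hθ.2) (hfam.equation θ hθ.1 hθ.2)
      (hjost.asymptotics.tendsto_at hθ) (hfam.asymptotics.tendsto_at hθ) k
  refine ⟨R, g, c, s, hR, hs, hs1, hdiff, fun k θ hθ => ?_, fun k hk => ?_,
    fun k θ hθ => hbd k θ (hsub hθ), hjost⟩
  · by_cases h0 : θ = 0
    · subst h0
      have hne : (𝓝[closedBall (0 : ℂ) 1 \ {0}] 0).NeBot :=
        neBot_closedBall_diff (finite_singleton _) hθ
      have h1 := (hjost.continuous k 0 hθ).mono (sdiff_subset (t := {0}))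
      have h2 := (hfam.continuous k 0 hθ).mono (sdiff_subset (t := {0}))
      refine tendsto_nhds_unique h1 (Tendsto.congr' ?_ h2)
      filter_upwards [self_mem_nhdsWithin] with θ' h' using (heq k θ' h').symm
    · exact heq k θ ⟨hθ, h0⟩
  · have hR0 : (0 : ℂ) ∈ ball (0 : ℂ) R := hsub (by simp)
    have hz : ∀ n, g (k + n) 0 = 0 := fun n => by
      induction n with
      | zero => exact hk
      | succ n ih =>
        have := hrec (k + n) 0 hR0
        rw [ih] at this
        simpa [S.bLim_ne_zero, ← add_assoc] using this
    have h1 := (hglim 0 (by simp)).comp (tendsto_add_atTop_nat k)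
    refine zero_ne_one (tendsto_nhds_unique (tendsto_const_nhds.congr fun n => ?_) h1)
    rw [Function.comp, add_comm, hz]

theorem isJostFamily_jost (γ : C) :
    IsJostFamily (S.coefA γ) (S.coefB γ) (S.aLim γ) (S.bLim γ) (S.jost γ) := by
  obtain ⟨R, g, c, s, h⟩ := S.exists_jost_factor γ
  exact h.2.2.2.2.2.2.2

theorem isChannelSolution_jost (γ : C) {θ : ℂ} (hθ : ‖θ‖ ≤ 1) (h0 : θ ≠ 0) :
    IsChannelSolution (S.coefA γ) (S.coefB γ) (zhukovskii (S.aLim γ) (S.bLim γ) θ)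
      fun k => S.jost γ k θ :=
  (S.isJostFamily_jost γ).equation θ (mem_closedBall_zero_iff.mpr hθ) h0

theorem tendsto_jost (γ : C) {θ : ℂ} (hθ : ‖θ‖ ≤ 1) (h0 : θ ≠ 0) :
    Tendsto (fun k => S.jost γ k θ / θ ^ k) atTop (𝓝 1) :=
  (S.isJostFamily_jost γ).asymptotics.tendsto_at ⟨mem_closedBall_zero_iff.mpr hθ, h0⟩

theorem exists_analyticAt_jost (γ : C) (k : ℕ) {θ₀ : ℂ} (hθ : ‖θ₀‖ ≤ 1) :
    ∃ G : ℂ → ℂ, AnalyticAt ℂ G θ₀ ∧ ∀ θ, ‖θ‖ ≤ 1 → S.jost γ k θ = G θ := by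
  obtain ⟨R, g, c, s, hR, -, -, hdiff, heq, -⟩ := S.exists_jost_factor γ
  refine ⟨fun θ => θ ^ k * g k θ, ?_, fun θ hθ => heq k θ (mem_closedBall_zero_iff.mpr hθ)⟩
  have : AnalyticAt ℂ (g k) θ₀ := (hdiff k).analyticAt
    (isOpen_ball.mem_nhds (mem_ball_zero_iff.mpr (hθ.trans_lt hR)))
  fun_prop

/-- Far enough in the channels no Jost solution vanishes on the closed punctured disk. -/
theorem exists_forall_jost_ne_zero : ∃ K, ∀ γ, ∀ θ : ℂ, ‖θ‖ ≤ 1 → θ ≠ 0 → S.jost γ K θ ≠ 0 := by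
  have h : ∀ᶠ k in atTop, ∀ γ, ∀ θ ∈ closedBall (0 : ℂ) 1 \ {0}, dist 1 (S.jost γ k θ / θ ^ k) < 1 :=
    eventually_all.mpr fun γ =>
      Metric.tendstoUniformlyOn_iff.mp (S.isJostFamily_jost γ).asymptotics 1 one_pos
  obtain ⟨K, hK⟩ := h.exists
  refine ⟨K, fun γ θ hθ h0 h => ?_⟩
  have := hK γ θ ⟨mem_closedBall_zero_iff.mpr hθ, h0⟩
  simp [h] at this

theorem jost_zero_zero_ne_zero (γ : C) : S.jost γ 0 0 ≠ 0 := by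
  obtain ⟨R, g, c, s, hR, -, -, hdiff, heq, hg, -⟩ := S.exists_jost_factor γ
  rw [heq 0 0 (by simp), pow_zero, one_mul]
  exact hg 0

theorem jost_succ_zero (γ : C) (k : ℕ) : S.jost γ (k + 1) 0 = 0 := by
  obtain ⟨R, g, c, s, hR, -, -, hdiff, heq, hg, -⟩ := S.exists_jost_factor γ
  rw [heq (k + 1) 0 (by simp)]
  simp

theorem exists_tendsto_jost_one_div (γ : C) : ∃ y : ℂ, y ≠ 0 ∧
    Tendsto (fun θ => S.jost γ 1 θ / θ) (𝓝[closedBall 0 1 \ {0}] 0) (𝓝 y) := by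
  obtain ⟨R, g, c, s, hR, -, -, hdiff, heq, hg, -⟩ := S.exists_jost_factor γ
  refine ⟨g 1 0, hg 1, ?_⟩
  have h1 : ContinuousAt (g 1) 0 := ((hdiff 1).continuousOn).continuousAt
    (isOpen_ball.mem_nhds (by simp; linarith))
  refine (h1.tendsto.mono_left nhdsWithin_le_nhds).congr' ?_
  filter_upwards [self_mem_nhdsWithin] with θ hθ
  rw [heq 1 θ hθ.1, pow_one, mul_div_cancel_left₀ _ hθ.2]

theorem exists_norm_jost_le (γ : C) :
    ∃ M, 0 ≤ M ∧ ∀ k, ∀ θ : ℂ, ‖θ‖ ≤ 1 → ‖S.jost γ k θ‖ ≤ M * ‖θ‖ ^ k := by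
  obtain ⟨R, g, c, s, hR, hs, hs1, hdiff, heq, hg, hbd, -⟩ := S.exists_jost_factor γ
  have hc : 0 ≤ c := by
    have := (norm_nonneg _).trans (hbd 0 0 (by simp))
    simpa using this
  refine ⟨c + 1, by positivity, fun k θ hθ => ?_⟩
  have hθ' := mem_closedBall_zero_iff.mpr hθ
  rw [heq k θ hθ', norm_mul, norm_pow, mul_comm]
  gcongr
  calc ‖g k θ‖ = ‖(g k θ - 1) + 1‖ := by ring_nf
    _ ≤ ‖g k θ - 1‖ + ‖(1 : ℂ)‖ := norm_add_le _ _
    _ ≤ c * 1 + 1 := by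
      rw [norm_one]
      gcongr
      exact (hbd k θ hθ').trans (by gcongr; exact pow_le_one₀ hs.le hs1.le)
    _ = c + 1 := by ring

theorem conj_zhukovskii (a b : ℝ) {θ : ℂ} (hθ : ‖θ‖ = 1) :
    starRingEnd ℂ (zhukovskii a b θ) = zhukovskii a b θ := by
  simp only [zhukovskii, map_sub, map_mul, map_add, Complex.conj_ofReal, map_inv₀]
  rw [← Complex.inv_eq_conj hθ, inv_inv, add_comm]

/-- On the unit circle the Jost solution at `θ⁻¹` is the complex conjugate of that at `θ`. -/
theorem conj_jost (γ : C) {θ : ℂ} (hθ : ‖θ‖ = 1) (k : ℕ) :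
    starRingEnd ℂ (S.jost γ k θ) = S.jost γ k θ⁻¹ := by
  have h0 : θ ≠ 0 := by rintro rfl; simp at hθ
  have h1 := (S.isChannelSolution_jost γ hθ.le h0).conj
  rw [conj_zhukovskii _ _ hθ] at h1
  have hθi : ‖θ⁻¹‖ = 1 := by rw [norm_inv, hθ, inv_one]
  have h2 := S.isChannelSolution_jost γ hθi.le (inv_ne_zero h0)
  have hz : zhukovskii (S.aLim γ) (S.bLim γ) θ⁻¹ = zhukovskii (S.aLim γ) (S.bLim γ) θ := by
    simp [zhukovskii, add_comm]
  rw [hz] at h2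
  refine h1.eq_of_tendsto (S.coefB_pos γ) (S.tendsto_coefB γ) (inv_ne_zero h0) hθi.le h2 ?_
    (S.tendsto_jost γ hθi.le (inv_ne_zero h0)) k
  have h3 := ((Complex.continuous_conj.tendsto 1).comp (S.tendsto_jost γ hθ.le h0))
  rw [map_one] at h3
  refine h3.congr fun k => ?_
  simp only [Function.comp, map_div₀, map_pow]
  rw [← Complex.inv_eq_conj hθ]

theorem casoratian_jost_inv (γ : C) {θ : ℂ} (hθ : ‖θ‖ = 1) (k : ℕ) :
    casoratian (S.coefB γ) (fun k => S.jost γ k θ⁻¹) (fun k => S.jost γ k θ) k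
      = S.bLim γ * (θ - θ⁻¹) := by
  have h0 : θ ≠ 0 := by rintro rfl; simp at hθ
  have hθi : ‖θ⁻¹‖ = 1 := by rw [norm_inv, hθ, inv_one]
  have h1 := S.isChannelSolution_jost γ hθ.le h0
  have h2 := S.isChannelSolution_jost γ hθi.le (inv_ne_zero h0)
  have hz : zhukovskii (S.aLim γ) (S.bLim γ) θ⁻¹ = zhukovskii (S.aLim γ) (S.bLim γ) θ := by
    simp [zhukovskii, add_comm]
  rw [hz] at h2
  have hconst := casoratian_eq h2 h1
  have h3 := S.tendsto_jost γ hθ.le h0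
  have h4 := S.tendsto_jost γ hθi.le (inv_ne_zero h0)
  have h𝔟c : Tendsto (fun k => (S.coefB γ k : ℂ)) atTop (𝓝 (S.bLim γ)) :=
    (Complex.continuous_ofReal.tendsto _).comp (S.tendsto_coefB γ)
  have h5 := h𝔟c.mul (((h4.mul (h3.comp (tendsto_add_atTop_nat 1))).mul_const θ).sub
    (((h4.comp (tendsto_add_atTop_nat 1)).mul h3).mul_const θ⁻¹))
  rw [hconst k]
  refine tendsto_nhds_unique (tendsto_const_nhds.congr fun n => ?_) (h5.trans (by simp))
  rw [← hconst n]
  simp only [casoratian, Function.comp, inv_pow]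
  field_simp
  ring

/-- On the unit circle the Jost solutions oscillate without decay, so their energy is infinite. -/
theorem tendsto_sum_norm_jost (γ : C) {θ : ℂ} (hθ : ‖θ‖ = 1) :
    Tendsto (fun n => ∑ k ∈ Finset.range n, ‖S.jost γ (k + 1) θ‖ ^ 2) atTop atTop := by
  have h0 : θ ≠ 0 := by rintro rfl; simp at hθ
  have h1 : Tendsto (fun k => ‖S.jost γ (k + 1) θ‖ ^ 2) atTop (𝓝 1) := by
    have := (((S.tendsto_jost γ hθ.le h0).norm.pow 2).comp (tendsto_add_atTop_nat 1))
    simpa [Function.comp_def, hθ] using this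
  refine (not_summable_iff_tendsto_nat_atTop_of_nonneg fun k => by positivity).mp fun h => ?_
  exact zero_ne_one (tendsto_nhds_unique h.tendsto_atTop_zero h1)

/-! ### The Jost solutions as functions on the disk -/

variable {S}

theorem holomorphicNear_jost_theta (γ : C) (k : ℕ) {ω₀ : ℂ} (hω : ω₀ ∈ closedBall (0 : ℂ) 1) :
    S.HolomorphicNear (fun ω => S.jost γ k (S.theta γ ω)) ω₀ := by
  obtain ⟨G, hG, h⟩ := S.exists_analyticAt_jost γ k (S.norm_theta_le γ hω)
  refine ((S.holomorphicNear_theta γ hω).comp_analyticAt hω hG).congr ?_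
  filter_upwards [self_mem_nhdsWithin] with ω h'
  exact (h _ (S.norm_theta_le γ h')).symm

variable (S)

theorem continuousOn_jost_theta (γ : C) (k : ℕ) :
    ContinuousOn (fun ω => S.jost γ k (S.theta γ ω)) (closedBall 0 1) :=
  fun _ hω => (holomorphicNear_jost_theta γ k hω).continuousWithinAt hω

theorem continuousOn_jost_inv_theta (γ : C) (k : ℕ) :
    ContinuousOn (fun ω => S.jost γ k (S.theta γ ω)⁻¹) (S.Tplus γ) := by
  refine ((Complex.continuous_conj.comp_continuousOn ((S.continuousOn_jost_theta γ k).mono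
    (S.Tplus_subset γ)))).congr fun ω hω => ?_
  exact (S.conj_jost γ hω.2 k).symm

theorem isChannelSolution_jost_theta (γ : C) {ω : ℂ} (hω : ω ∈ closedBall (0 : ℂ) 1)
    (h0 : ω ≠ 0) : IsChannelSolution (S.coefA γ) (S.coefB γ) (S.lam ω)
      fun k => S.jost γ k (S.theta γ ω) := by
  have := S.isChannelSolution_jost γ (S.norm_theta_le γ hω) (S.theta_ne_zero γ hω h0)
  rwa [S.zhukovskii_theta γ hω h0] at this

/-! ### The equation on the whole system -/

theorem pt_inj {γ ν : C} {k j : ℕ} : S.pt γ k = S.pt ν j ↔ γ = ν ∧ k = j := by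
  constructor
  · intro h
    have := S.pt_injective (a₁ := (γ, k)) (a₂ := (ν, j)) h
    simpa using this
  · rintro ⟨rfl, rfl⟩; rfl

theorem pt_succ_notMem_central (γ : C) (k : ℕ) : S.pt γ (k + 1) ∉ S.central :=
  fun h => h γ k rfl

theorem exists_pt_of_notMem_central {α : A} (h : α ∉ S.central) : ∃ γ k, α = S.pt γ (k + 1) := by
  by_contra! hcon
  exact h hcon

open scoped Classical in
theorem L_central_pt_one (α : S.central) (γ : C) :
    S.L α (S.pt γ 1) = if α = S.attach γ then -S.coefB γ 0 else 0 := by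
  split_ifs with h
  · subst h
    simp [coefB, attach]
  · by_contra hne
    rw [S.L_symm] at hne
    rcases S.channel γ 0 α hne with h1 | h1 | h1
    · exact h (Subtype.ext h1)
    · exact S.pt_succ_notMem_central γ 0 (h1 ▸ α.2)
    · exact S.pt_succ_notMem_central γ 1 (h1 ▸ α.2)

open scoped Classical in
theorem apply_central (ξ : A → ℂ) (α : S.central) :
    S.apply ξ α = ∑ β : S.central, (S.L α β : ℂ) * ξ β
      - ∑ γ, if α = S.attach γ then (S.coefB γ 0 : ℂ) * ξ (S.pt γ 1) else 0 := by
  let f : S.central ⊕ C → A := Sum.elim Subtype.val fun γ => S.pt γ 1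
  have hf : Function.Injective f := by
    rintro (x | γ) (y | ν) h
    · exact congrArg _ (Subtype.ext h)
    · exact absurd x.2 (by rw [show (x : A) = S.pt ν 1 from h]; exact S.pt_succ_notMem_central ν 0)
    · exact absurd y.2 (by rw [← show S.pt γ 1 = (y : A) from h]; exact S.pt_succ_notMem_central γ 0)
    · exact congrArg _ (S.pt_inj.mp h).1
  have hsupp : (Function.support fun β => (S.L α β : ℂ) * ξ β) ⊆
      ((Finset.univ.map ⟨f, hf⟩ : Finset A) : Set A) := by
    intro β hβ
    have hL : S.L α β ≠ 0 := fun h => hβ (by simp [h])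
    simp only [Finset.coe_map, Finset.coe_univ, image_univ, mem_range, Function.Embedding.coeFn_mk]
    by_cases hc : β ∈ S.central
    · exact ⟨Sum.inl ⟨β, hc⟩, rfl⟩
    · obtain ⟨γ, k, rfl⟩ := S.exists_pt_of_notMem_central hc
      rw [S.L_symm] at hL
      rcases S.channel γ k α hL with h1 | h1 | h1
      · rcases k with _ | k
        · exact ⟨Sum.inr γ, rfl⟩
        · exact absurd α.2 (by rw [h1]; exact S.pt_succ_notMem_central γ k)
      · exact absurd α.2 (by rw [h1]; exact S.pt_succ_notMem_central γ k)
      · exact absurd α.2 (by rw [h1]; exact S.pt_succ_notMem_central γ (k + 1))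
  rw [apply, finsum_eq_sum_of_support_subset _ hsupp, Finset.sum_map, Fintype.sum_sum_type,
    sub_eq_add_neg, ← Finset.sum_neg_distrib]
  congr 1
  refine Finset.sum_congr rfl fun γ _ => ?_
  simp only [Function.Embedding.coeFn_mk, f, Sum.elim_inr, L_central_pt_one]
  split_ifs <;> simp

theorem apply_pt_succ (ξ : A → ℂ) (γ : C) (k : ℕ) :
    S.apply ξ (S.pt γ (k + 1)) = -(S.coefB γ k : ℂ) * ξ (S.pt γ k)
      + S.coefA γ (k + 1) * ξ (S.pt γ (k + 1)) - S.coefB γ (k + 1) * ξ (S.pt γ (k + 2)) := by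
  classical
  have hsupp : (Function.support fun β => (S.L (S.pt γ (k + 1)) β : ℂ) * ξ β) ⊆
      (({S.pt γ k, S.pt γ (k + 1), S.pt γ (k + 2)} : Finset A) : Set A) := by
    intro β hβ
    have hL : S.L (S.pt γ (k + 1)) β ≠ 0 := fun h => hβ (by simp [h])
    simpa using S.channel γ k β hL
  rw [apply, finsum_eq_sum_of_support_subset _ hsupp, Finset.sum_insert, Finset.sum_insert,
    Finset.sum_singleton]
  · simp only [coefA, coefB, S.L_symm (S.pt γ (k + 1)) (S.pt γ k)]
    push_cast
    ring
  · simp [S.pt_inj]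
  · simp [S.pt_inj]

theorem isChannelSolution_iff (ξ : A → ℂ) (l : ℂ) (γ : C) :
    IsChannelSolution (S.coefA γ) (S.coefB γ) l (fun k => ξ (S.pt γ k)) ↔
      ∀ k, S.apply ξ (S.pt γ (k + 1)) = l * ξ (S.pt γ (k + 1)) := by
  simp only [IsChannelSolution, apply_pt_succ]

/-- Green's formula for the central part: the boundary terms are the Wronskians at the attachment
points. -/
theorem green_central {u v : A → ℂ} {l m : ℂ} (hu : ∀ α ∈ S.central, S.apply u α = l * u α)
    (hv : ∀ α ∈ S.central, S.apply v α = m * v α) :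
    (l - m) * ∑ α : S.central, u α * v α =
      ∑ γ, casoratian (S.coefB γ) (fun k => u (S.pt γ k)) (fun k => v (S.pt γ k)) 0 := by
  classical
  have h1 : (l - m) * ∑ α : S.central, u α * v α =
      ∑ α : S.central, (S.apply u α * v α - u α * S.apply v α) := by
    rw [Finset.mul_sum]
    refine Finset.sum_congr rfl fun α _ => ?_
    rw [hu α α.2, hv α α.2]
    ring
  have hsym : ∑ α : S.central, (∑ β : S.central, (S.L α β : ℂ) * u β) * v α =
      ∑ α : S.central, u α * ∑ β : S.central, (S.L α β : ℂ) * v β := by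
    simp only [Finset.sum_mul, Finset.mul_sum]
    rw [Finset.sum_comm]
    refine Finset.sum_congr rfl fun β _ => Finset.sum_congr rfl fun α _ => ?_
    rw [S.L_symm]
    ring
  rw [h1]
  simp only [apply_central, sub_mul, mul_sub, Finset.sum_sub_distrib, hsym]
  simp only [Finset.sum_mul, Finset.mul_sum, sub_sub_sub_cancel_left, ite_mul, mul_ite, zero_mul,
    mul_zero]
  rw [Finset.sum_comm, Finset.sum_comm (s := Finset.univ (α := S.central)), ← Finset.sum_sub_distrib]
  refine Finset.sum_congr rfl fun γ _ => ?_
  rw [Finset.sum_eq_single (S.attach γ) (fun α _ h => if_neg h) (by simp),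
    Finset.sum_eq_single (S.attach γ) (fun α _ h => if_neg h) (by simp), if_pos rfl, if_pos rfl]
  simp only [casoratian, attach]
  ring

/-- Green's formula for the central part together with the first `n` particles of each channel. -/
theorem green_truncated {u v : A → ℂ} {l m : ℂ} (hu : ∀ α, S.apply u α = l * u α)
    (hv : ∀ α, S.apply v α = m * v α) (n : C → ℕ) :
    (l - m) * (∑ α : S.central, u α * v α +
        ∑ γ, ∑ k ∈ Finset.range (n γ), u (S.pt γ (k + 1)) * v (S.pt γ (k + 1))) =
      ∑ γ, casoratian (S.coefB γ) (fun k => u (S.pt γ k)) (fun k => v (S.pt γ k)) (n γ) := by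
  rw [mul_add, S.green_central (fun α _ => hu α) (fun α _ => hv α), Finset.mul_sum,
    ← Finset.sum_add_distrib]
  refine Finset.sum_congr rfl fun γ _ => ?_
  rw [casoratian_eq_add_sum ((S.isChannelSolution_iff u l γ).mpr fun k => hu _)
    ((S.isChannelSolution_iff v m γ).mpr fun k => hv _) (n γ)]

theorem apply_conj (ξ : A → ℂ) (α : A) :
    S.apply (fun β => starRingEnd ℂ (ξ β)) α = starRingEnd ℂ (S.apply ξ α) := by
  by_cases hc : α ∈ S.central
  · have h1 := S.apply_central ξ ⟨α, hc⟩
    have h2 := S.apply_central (fun β => starRingEnd ℂ (ξ β)) ⟨α, hc⟩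
    simp only at h1 h2
    rw [h1, h2]
    simp [apply_ite]
  · obtain ⟨γ, k, rfl⟩ := S.exists_pt_of_notMem_central hc
    rw [apply_pt_succ, apply_pt_succ]
    simp

/-- The action of `L` commutes with limits, since each row of `L` is finite. -/
theorem tendsto_apply {ι : Type*} {F : Filter ι} {ξ : ι → A → ℂ} {η : A → ℂ}
    (h : ∀ β, Tendsto (fun i => ξ i β) F (𝓝 (η β))) (α : A) :
    Tendsto (fun i => S.apply (ξ i) α) F (𝓝 (S.apply η α)) := by
  have hfin := S.L_locallyFinite α
  have he : ∀ ζ : A → ℂ, S.apply ζ α = ∑ β ∈ hfin.toFinset, (S.L α β : ℂ) * ζ β := fun ζ => by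
    rw [apply, finsum_eq_sum_of_support_subset]
    intro β hβ
    simp only [Finite.coe_toFinset]
    exact fun h => hβ (by simp [h])
  simp only [he]
  exact tendsto_finsetSum _ fun β _ => (h β).const_mul _

/-! ### The resolvent of the central part -/

open scoped Classical in
/-- Off the spectrum of the central part, the resolvent solves the central equations with
prescribed values at the first particles of the channels. -/
theorem apply_central_of_resolvent {l : ℂ} (hl : ¬ S.IsCentralEigenvalue l) (ξ : A → ℂ)
    (hξ : ∀ α : S.central, ξ α = ∑ ν, S.r l α (S.attach ν) * S.coefB ν 0 * ξ (S.pt ν 1))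
    (α : S.central) : S.apply ξ α = l * ξ α := by
  have hu : IsUnit (S.centralMatrix - l • 1).det := isUnit_iff_ne_zero.mpr hl
  have hinv : (S.centralMatrix - l • 1) * S.r l = 1 := by
    rw [r]; exact Matrix.mul_nonsing_inv _ hu
  have hent : ∀ ν, ∑ β : S.central, (S.L α β : ℂ) * S.r l β (S.attach ν) =
      l * S.r l α (S.attach ν) + if α = S.attach ν then 1 else 0 := fun ν => by
    have h1 := congrFun (congrFun hinv α) (S.attach ν)
    rw [sub_mul, smul_mul_assoc, one_mul, Matrix.sub_apply, Matrix.smul_apply, Matrix.mul_apply,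
      Matrix.one_apply, smul_eq_mul] at h1
    simp only [centralMatrix, Matrix.of_apply] at h1
    linear_combination h1
  rw [apply_central]
  simp only [hξ, Finset.mul_sum]
  rw [Finset.sum_comm]
  have : ∀ ν, ∑ β : S.central, (S.L α β : ℂ) * (S.r l β (S.attach ν) * S.coefB ν 0 * ξ (S.pt ν 1)) =
      (l * S.r l α (S.attach ν) + if α = S.attach ν then 1 else 0) * (S.coefB ν 0 * ξ (S.pt ν 1)) :=
    fun ν => by
      rw [← hent, Finset.sum_mul]
      exact Finset.sum_congr rfl fun β _ => by ring
  simp only [this]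
  rw [← Finset.sum_sub_distrib]
  refine Finset.sum_congr rfl fun ν _ => ?_
  split_ifs <;> ring

end WebSystem

/-! ### Inverses of complex matrices -/

theorem Matrix.inv_diagonal_of_ne_zero {n : Type*} [Fintype n] [DecidableEq n] {v : n → ℂ}
    (hv : ∀ i, v i ≠ 0) : (Matrix.diagonal v)⁻¹ = Matrix.diagonal fun i => (v i)⁻¹ := by
  refine Matrix.inv_eq_right_inv ?_
  rw [Matrix.diagonal_mul_diagonal, ← Matrix.diagonal_one]
  congr 1
  ext i
  exact mul_inv_cancel₀ (hv i)

theorem continuousAt_matrix_inv_of_det_ne_zero {n : Type*} [Fintype n] [DecidableEq n]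
    {M : Matrix n n ℂ} (hM : M.det ≠ 0) : ContinuousAt (fun N : Matrix n n ℂ => N⁻¹) M := by
  refine continuousAt_matrix_inv M ?_
  rw [Ring.inverse_eq_inv']
  exact continuousAt_inv₀ hM

namespace WebSystem

variable {A C : Type*} [Fintype C] (S : WebSystem A C)

/-! ### Behaviour at the origin -/

theorem tendsto_inv_lam_zero : Tendsto (fun ω => (S.lam ω)⁻¹) (𝓝[closedBall (0 : ℂ) 1 \ {0}] 0)
    (𝓝 0) := by
  have h1 : ContinuousAt (fun ω : ℂ => ω / (S.a * ω - S.b * (ω ^ 2 + 1))) 0 := by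
    refine ContinuousAt.div (by fun_prop) (by fun_prop) ?_
    simpa using S.b_ne_zero
  have h2 := h1.tendsto.mono_left (nhdsWithin_le_nhds (s := closedBall (0 : ℂ) 1 \ {0}))
  simp only [zero_div] at h2
  refine h2.congr' ?_
  filter_upwards [self_mem_nhdsWithin] with ω hω
  have h0 : ω ≠ 0 := hω.2
  have : (S.a * ω - S.b * (ω ^ 2 + 1) : ℂ) = S.lam ω * ω := by
    rw [lam, zhukovskii]; field_simp
  rw [this, div_mul_cancel_right₀ h0]

theorem eventually_lam_ne_zero : ∀ᶠ ω in 𝓝[closedBall (0 : ℂ) 1 \ {0}] 0, S.lam ω ≠ 0 := by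
  have h1 : ContinuousAt (fun ω : ℂ => (S.a : ℂ) * ω - S.b * (ω ^ 2 + 1)) 0 := by fun_prop
  have h2 : ∀ᶠ ω in 𝓝 (0 : ℂ), (S.a : ℂ) * ω - S.b * (ω ^ 2 + 1) ≠ 0 :=
    h1.eventually_ne (by simpa using S.b_ne_zero)
  filter_upwards [self_mem_nhdsWithin, nhdsWithin_le_nhds h2] with ω hω h3 h4
  have h0 : ω ≠ 0 := hω.2
  apply h3
  have : (S.a * ω - S.b * (ω ^ 2 + 1) : ℂ) = S.lam ω * ω := by
    rw [lam, zhukovskii]; field_simp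
  rw [this, h4, zero_mul]

open scoped Classical in
theorem eventually_det_one_sub_ne_zero : ∀ᶠ ω in 𝓝[closedBall (0 : ℂ) 1 \ {0}] 0,
    (1 - (S.lam ω)⁻¹ • S.centralMatrix).det ≠ 0 := by
  have h1 : Continuous fun t : ℂ => (1 - t • S.centralMatrix).det := by fun_prop
  have h2 := (h1.tendsto 0).comp S.tendsto_inv_lam_zero
  exact h2.eventually_ne (by simp)

open scoped Classical in
theorem centralMatrix_sub_eq {l : ℂ} (hl : l ≠ 0) :
    S.centralMatrix - l • 1 = (-l) • (1 - l⁻¹ • S.centralMatrix) := by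
  rw [smul_sub, smul_smul, neg_mul, mul_inv_cancel₀ hl, neg_smul, neg_smul, one_smul]
  abel

theorem eventually_not_isCentralEigenvalue : ∀ᶠ ω in 𝓝[closedBall (0 : ℂ) 1 \ {0}] 0,
    ¬ S.IsCentralEigenvalue (S.lam ω) := by
  classical
  filter_upwards [S.eventually_lam_ne_zero, S.eventually_det_one_sub_ne_zero] with ω h1 h2
  rw [IsCentralEigenvalue, S.centralMatrix_sub_eq h1, Matrix.det_smul]
  exact mul_ne_zero (pow_ne_zero _ (neg_ne_zero.mpr h1)) h2

theorem tendsto_r_zero (α β : S.central) :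
    Tendsto (fun ω => S.r (S.lam ω) α β) (𝓝[closedBall (0 : ℂ) 1 \ {0}] 0) (𝓝 0) := by
  classical
  have h1 : ContinuousAt (fun t : ℂ => (1 - t • S.centralMatrix)⁻¹) 0 := by
    have h2 : Continuous fun t : ℂ => 1 - t • S.centralMatrix := by fun_prop
    exact ContinuousAt.comp (g := fun N : Matrix S.central S.central ℂ => N⁻¹)
      (continuousAt_matrix_inv_of_det_ne_zero (by simp)) h2.continuousAt
  have h3 := (S.tendsto_inv_lam_zero.neg).mul
    (((continuous_apply_apply α β).tendsto _).comp (h1.tendsto.comp S.tendsto_inv_lam_zero))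
  rw [neg_zero, zero_mul] at h3
  refine h3.congr' ?_
  filter_upwards [S.eventually_lam_ne_zero, S.eventually_det_one_sub_ne_zero] with ω h4 h5
  have : S.r (S.lam ω) = (-(S.lam ω)⁻¹) • (1 - (S.lam ω)⁻¹ • S.centralMatrix)⁻¹ := by
    rw [r]
    convert Matrix.inv_eq_right_inv (A := S.centralMatrix - S.lam ω • 1) ?_
    rw [S.centralMatrix_sub_eq h4, smul_mul_smul_comm,
      Matrix.mul_nonsing_inv _ (isUnit_iff_ne_zero.mpr h5), neg_mul_neg, mul_inv_cancel₀ h4, one_smul]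
  rw [this]
  rfl

theorem tendsto_theta_zero (γ : C) : Tendsto (S.theta γ) (𝓝[closedBall (0 : ℂ) 1 \ {0}] 0)
    (𝓝[closedBall (0 : ℂ) 1 \ {0}] 0) := by
  rw [tendsto_nhdsWithin_iff]
  constructor
  · have := (S.continuousOn_theta γ 0 (by simp)).mono (sdiff_subset (t := {0}))
    rwa [ContinuousWithinAt, theta_zero] at this
  · filter_upwards [self_mem_nhdsWithin] with ω hω
    exact ⟨mem_closedBall_zero_iff.mpr (S.norm_theta_le γ hω.1), S.theta_ne_zero γ hω.1 hω.2⟩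

theorem eventually_jost_one_ne_zero (γ : C) : ∀ᶠ ω in 𝓝[closedBall (0 : ℂ) 1 \ {0}] 0,
    S.jost γ 1 (S.theta γ ω) ≠ 0 := by
  obtain ⟨y, hy, h⟩ := S.exists_tendsto_jost_one_div γ
  filter_upwards [(h.comp (S.tendsto_theta_zero γ)).eventually_ne hy] with ω hω h0
  simp [h0] at hω

theorem tendsto_jost_theta_zero (γ : C) (k : ℕ) : Tendsto (fun ω => S.jost γ k (S.theta γ ω))
    (𝓝[closedBall (0 : ℂ) 1 \ {0}] 0) (𝓝 (S.jost γ k 0)) := by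
  have := (S.continuousOn_jost_theta γ k 0 (by simp)).mono (sdiff_subset (t := {0}))
  rwa [ContinuousWithinAt, theta_zero] at this

section Central

variable {S} {ω₀ : ℂ} {s : Set ℂ}

theorem meromorphicNear_lam : S.MeromorphicNear S.lam ω₀ := .of_meromorphicAt (S.meromorphicAt_lam ω₀)

theorem meromorphicNear_r (α β : S.central) :
    S.MeromorphicNear (fun ω => S.r (S.lam ω) α β) ω₀ := by
  classical
  have h := MeromorphicNear.matrix_inv (S := S) (ω₀ := ω₀)
    (M := fun ω => S.centralMatrix - S.lam ω • 1) (fun i j =>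
      (MeromorphicNear.const _ _).sub (meromorphicNear_lam.mul (.const _ _))) α β
  refine h.congr (Eventually.of_forall fun ω => ?_)
  simp only [r]

open scoped Classical in
theorem meromorphicNear_det_central :
    S.MeromorphicNear (fun ω => (S.centralMatrix - S.lam ω • 1).det) ω₀ :=
  .det fun _ _ => (MeromorphicNear.const _ _).sub (meromorphicNear_lam.mul (.const _ _))

theorem meromorphicNear_regularSolution (𝔞 𝔟 : ℕ → ℝ) (k : ℕ) :
    S.MeromorphicNear (fun ω => regularSolution 𝔞 𝔟 (S.lam ω) k) ω₀ := by
  induction k using Nat.strong_induction_on with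
  | _ k ih =>
    match k with
    | 0 => exact .const _ _
    | 1 => exact .const _ _
    | k + 2 =>
      simp only [regularSolution]
      exact ((((MeromorphicNear.const _ _).sub meromorphicNear_lam).mul (ih (k + 1) (by omega))).sub
        ((MeromorphicNear.const _ _).mul (ih k (by omega)))).div (.const _ _)

theorem continuousWithinAt_regularSolution (h0 : ω₀ ≠ 0) (𝔞 𝔟 : ℕ → ℝ) (k : ℕ) :
    ContinuousWithinAt (fun ω => regularSolution 𝔞 𝔟 (S.lam ω) k) s ω₀ := by
  have hl := S.continuousWithinAt_lam h0 s
  induction k using Nat.strong_induction_on with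
  | _ k ih =>
    match k with
    | 0 => exact continuousWithinAt_const
    | 1 => exact continuousWithinAt_const
    | k + 2 =>
      simp only [regularSolution, div_eq_mul_inv]
      exact (((continuousWithinAt_const.sub hl).mul (ih (k + 1) (by omega))).sub
        (continuousWithinAt_const.mul (ih k (by omega)))).mul continuousWithinAt_const

theorem continuousWithinAt_r (h0 : ω₀ ≠ 0) (h : ¬ S.IsCentralEigenvalue (S.lam ω₀)) :
    ContinuousWithinAt (fun ω => S.r (S.lam ω)) s ω₀ := by
  classical
  have h1 : ContinuousWithinAt (fun ω => S.centralMatrix - S.lam ω • 1) s ω₀ :=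
    continuousWithinAt_const.sub ((S.continuousWithinAt_lam h0 s).smul continuousWithinAt_const)
  have h2 := (continuousAt_matrix_inv_of_det_ne_zero h).comp_continuousWithinAt
    (f := fun ω => S.centralMatrix - S.lam ω • 1) h1
  refine h2.congr (fun ω _ => ?_) ?_ <;> simp only [r, Function.comp]

end Central

/-! ### The matrix solution -/

variable [DecidableEq C]

/-- The normalizing factor `B B(0)⁻¹ D(ω) E(1, ω)⁻¹` of `U(k, ω)`. -/
noncomputable def normalizer (ω : ℂ) : Matrix C C ℂ := S.B * S.B0⁻¹ * S.D ω * (S.E 1 ω)⁻¹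

/-- The matrix `T(ω)⁻¹ B B(0)⁻¹ D(ω) E(1, ω)⁻¹` of the coefficients of the Jost solutions
in `U(k, ω)`. -/
noncomputable def jostCoeff (ω : ℂ) : Matrix C C ℂ := (S.T ω)⁻¹ * S.normalizer ω

theorem U_eq (k : ℕ) (ω : ℂ) :
    S.U k ω = -(S.P k ω * S.normalizer ω) + S.E k ω * S.jostCoeff ω := by
  simp only [U, normalizer, jostCoeff, Matrix.add_mul, Matrix.neg_mul, Matrix.mul_assoc]

theorem U_apply (k : ℕ) (ω : ℂ) (γ σ : C) : S.U k ω γ σ =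
    -(regularSolution (S.coefA γ) (S.coefB γ) (S.lam ω) k * S.normalizer ω γ σ)
      + S.jost γ k (S.theta γ ω) * S.jostCoeff ω γ σ := by
  rw [U_eq]
  simp [P, E, Matrix.diagonal_mul]

theorem isDiag_normalizer (ω : ℂ) {γ σ : C} (h : γ ≠ σ) : S.normalizer ω γ σ = 0 := by
  simp [normalizer, B, B0, D, E, Matrix.inv_diagonal, Matrix.diagonal_mul_diagonal, h]

theorem det_E_ne_zero_iff (k : ℕ) (ω : ℂ) :
    (S.E k ω).det ≠ 0 ↔ ∀ γ, S.jost γ k (S.theta γ ω) ≠ 0 := by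
  simp [E, Matrix.det_diagonal, Finset.prod_ne_zero_iff]

theorem normalizer_self {ω : ℂ} (h : (S.E 1 ω).det ≠ 0) (σ : C) : S.normalizer ω σ σ =
    S.bLim σ / S.coefB σ 0 * ((S.theta σ ω)⁻¹ - S.theta σ ω) / S.jost σ 1 (S.theta σ ω) := by
  rw [normalizer, B, B0, D, E, Matrix.inv_diagonal_of_ne_zero fun γ => S.coefB_ne_zero γ 0,
    Matrix.inv_diagonal_of_ne_zero ((S.det_E_ne_zero_iff 1 ω).mp h)]
  simp only [Matrix.diagonal_mul_diagonal, Matrix.diagonal_apply_eq]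
  rfl

theorem isChannelSolution_U {ω : ℂ} (hω : ω ∈ closedBall (0 : ℂ) 1) (h0 : ω ≠ 0) (γ σ : C) :
    IsChannelSolution (S.coefA γ) (S.coefB γ) (S.lam ω) fun k => S.U k ω γ σ := by
  have h1 := (isChannelSolution_regularSolution (𝔞 := S.coefA γ) (S.coefB_pos γ) (S.lam ω)).const_mul
    (-S.normalizer ω γ σ)
  have h2 := (S.isChannelSolution_jost_theta γ hω h0).const_mul (S.jostCoeff ω γ σ)
  convert h1.add h2 using 2 with k
  rw [U_apply]
  ring

theorem P_zero (ω : ℂ) : S.P 0 ω = 1 := by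
  rw [P, ← Matrix.diagonal_one]; rfl

theorem P_one (ω : ℂ) : S.P 1 ω = 0 := by
  rw [P, ← Matrix.diagonal_zero]; rfl

theorem U_boundary {ω : ℂ} (hT : (S.T ω).det ≠ 0) :
    S.U 0 ω = S.R (S.lam ω) * S.B0 * S.U 1 ω := by
  have h1 : S.R (S.lam ω) * S.B0 * S.E 1 ω = S.E 0 ω - S.T ω := by simp [T]
  rw [U_eq, U_eq, P_zero, P_one, Matrix.zero_mul, neg_zero, zero_add, ← Matrix.mul_assoc, h1,
    jostCoeff, ← Matrix.mul_assoc, ← Matrix.mul_assoc, Matrix.sub_mul, Matrix.one_mul,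
    Matrix.mul_nonsing_inv _ (isUnit_iff_ne_zero.mpr hT), Matrix.sub_mul, Matrix.one_mul]
  abel

/-! ### Meromorphy and continuity of the matrix solution -/

section Meromorphic

variable {S} {ω₀ : ℂ}

variable (hω : ω₀ ∈ closedBall (0 : ℂ) 1)
include hω

theorem meromorphicNear_E (k : ℕ) (γ ν : C) : S.MeromorphicNear (fun ω => S.E k ω γ ν) ω₀ :=
  .diagonal (fun γ => (holomorphicNear_jost_theta γ k hω).meromorphicNear) γ ν

theorem meromorphicNear_T (γ ν : C) : S.MeromorphicNear (fun ω => S.T ω γ ν) ω₀ := by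
  have h1 : ∀ γ ν, S.MeromorphicNear (fun ω => S.R (S.lam ω) γ ν) ω₀ :=
    fun γ ν => meromorphicNear_r (S.attach γ) (S.attach ν)
  have h2 := MeromorphicNear.matrix_mul h1 fun γ ν => MeromorphicNear.const (S.B0 γ ν) ω₀
  have h3 := MeromorphicNear.matrix_mul h2 (meromorphicNear_E hω 1)
  exact (meromorphicNear_E hω 0 γ ν).sub (h3 γ ν)

theorem meromorphicNear_normalizer (γ ν : C) :
    S.MeromorphicNear (fun ω => S.normalizer ω γ ν) ω₀ := by
  have h1 : ∀ γ ν, S.MeromorphicNear (fun ω => S.D ω γ ν) ω₀ := .diagonal fun γ =>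
    (S.holomorphicNear_theta γ hω).meromorphicNear.inv.sub
      (S.holomorphicNear_theta γ hω).meromorphicNear
  have h2 := MeromorphicNear.matrix_mul
    (fun γ ν => MeromorphicNear.const ((S.B * S.B0⁻¹) γ ν) ω₀) h1
  exact MeromorphicNear.matrix_mul h2 (.matrix_inv (meromorphicNear_E hω 1)) γ ν

theorem meromorphicNear_jostCoeff (γ ν : C) :
    S.MeromorphicNear (fun ω => S.jostCoeff ω γ ν) ω₀ :=
  .matrix_mul (.matrix_inv (meromorphicNear_T hω)) (meromorphicNear_normalizer hω) γ ν

theorem meromorphicNear_U (k : ℕ) (γ ν : C) : S.MeromorphicNear (fun ω => S.U k ω γ ν) ω₀ := by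
  simp only [U_apply]
  exact ((meromorphicNear_regularSolution _ _ k).mul (meromorphicNear_normalizer hω γ ν)).neg.add
    ((holomorphicNear_jost_theta γ k hω).meromorphicNear.mul (meromorphicNear_jostCoeff hω γ ν))

end Meromorphic

section Continuity

variable {S} {ω₀ : ℂ} {s : Set ℂ}

theorem continuousWithinAt_E (hω : ω₀ ∈ closedBall (0 : ℂ) 1) (k : ℕ) :
    ContinuousWithinAt (fun ω => S.E k ω) (closedBall 0 1) ω₀ :=
  (continuous_id.matrix_diagonal).continuousAt.comp_continuousWithinAt
    (continuousWithinAt_pi.mpr fun γ => S.continuousOn_jost_theta γ k ω₀ hω)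

variable (hω : ω₀ ∈ closedBall (0 : ℂ) 1 \ S.undefinedSet)
include hω

theorem ne_zero_of_notMem : ω₀ ≠ 0 := fun h => hω.2 ⟨hω.1, Or.inl h⟩

theorem not_isCentralEigenvalue_of_notMem : ¬ S.IsCentralEigenvalue (S.lam ω₀) :=
  fun h => hω.2 ⟨hω.1, Or.inr (Or.inl h)⟩

theorem det_T_ne_zero_of_notMem : (S.T ω₀).det ≠ 0 :=
  fun h => hω.2 ⟨hω.1, Or.inr (Or.inr (Or.inl h))⟩

theorem det_E_ne_zero_of_notMem : (S.E 1 ω₀).det ≠ 0 :=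
  fun h => hω.2 ⟨hω.1, Or.inr (Or.inr (Or.inr h))⟩

theorem continuousWithinAt_T : ContinuousWithinAt (fun ω => S.T ω) (closedBall 0 1) ω₀ := by
  have hR : ContinuousWithinAt (fun ω => S.R (S.lam ω)) (closedBall 0 1) ω₀ := by
    have h1 := continuousWithinAt_r (s := closedBall 0 1) (ne_zero_of_notMem hω)
      (not_isCentralEigenvalue_of_notMem hω)
    refine continuousWithinAt_pi.mpr fun γ => continuousWithinAt_pi.mpr fun ν => ?_
    exact (continuous_apply_apply (S.attach γ) (S.attach ν)).continuousAt.comp_continuousWithinAt h1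
  exact (continuousWithinAt_E hω.1 0).sub
    ((hR.mul continuousWithinAt_const).mul (continuousWithinAt_E hω.1 1))

theorem continuousWithinAt_normalizer :
    ContinuousWithinAt (fun ω => S.normalizer ω) (closedBall 0 1) ω₀ := by
  have hD : ContinuousWithinAt (fun ω => S.D ω) (closedBall 0 1) ω₀ :=
    (continuous_id.matrix_diagonal).continuousAt.comp_continuousWithinAt
      (continuousWithinAt_pi.mpr fun γ => ((S.continuousOn_theta γ ω₀ hω.1).inv₀
        (S.theta_ne_zero γ hω.1 (ne_zero_of_notMem hω))).sub (S.continuousOn_theta γ ω₀ hω.1))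
  exact (continuousWithinAt_const.mul hD).mul
    ((continuousAt_matrix_inv_of_det_ne_zero (det_E_ne_zero_of_notMem hω)).comp_continuousWithinAt
      (f := fun ω => S.E 1 ω) (continuousWithinAt_E hω.1 1))

theorem continuousWithinAt_jostCoeff :
    ContinuousWithinAt (fun ω => S.jostCoeff ω) (closedBall 0 1) ω₀ :=
  ((continuousAt_matrix_inv_of_det_ne_zero (det_T_ne_zero_of_notMem hω)).comp_continuousWithinAt
    (f := fun ω => S.T ω) (continuousWithinAt_T hω)).mul (continuousWithinAt_normalizer hω)

theorem continuousWithinAt_U (k : ℕ) (γ ν : C) :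
    ContinuousWithinAt (fun ω => S.U k ω γ ν) (closedBall 0 1) ω₀ := by
  have h1 := (continuous_apply_apply γ ν).continuousAt.comp_continuousWithinAt
    (continuousWithinAt_normalizer hω)
  have h2 := (continuous_apply_apply γ ν).continuousAt.comp_continuousWithinAt
    (continuousWithinAt_jostCoeff hω)
  simp only [U_apply]
  exact (((continuousWithinAt_regularSolution (ne_zero_of_notMem hω) _ _ k).mul h1).neg).add
    ((S.continuousOn_jost_theta γ k ω₀ hω.1).mul h2)

end Continuity

/-! ### Finiteness of the exceptional set -/

theorem tendsto_T_zero : Tendsto (fun ω => S.T ω) (𝓝[closedBall (0 : ℂ) 1 \ {0}] 0)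
    (𝓝 (Matrix.diagonal fun γ => S.jost γ 0 0)) := by
  have hE : ∀ k, Tendsto (fun ω => S.E k ω) (𝓝[closedBall (0 : ℂ) 1 \ {0}] 0)
      (𝓝 (Matrix.diagonal fun γ => S.jost γ k 0)) := fun k =>
    ((continuous_id.matrix_diagonal).tendsto _).comp
      (tendsto_pi_nhds.mpr fun γ => S.tendsto_jost_theta_zero γ k)
  have hR : Tendsto (fun ω => S.R (S.lam ω)) (𝓝[closedBall (0 : ℂ) 1 \ {0}] 0) (𝓝 0) :=
    tendsto_pi_nhds.mpr fun γ => tendsto_pi_nhds.mpr fun ν => S.tendsto_r_zero _ _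
  have := (hE 0).sub ((hR.mul_const S.B0).mul (hE 1))
  simpa [T] using this

theorem det_diagonal_jost_ne_zero : (Matrix.diagonal fun γ => S.jost γ 0 0).det ≠ 0 := by
  rw [Matrix.det_diagonal, Finset.prod_ne_zero_iff]
  exact fun γ _ => S.jost_zero_zero_ne_zero γ

theorem eventually_det_E_ne_zero : ∀ᶠ ω in 𝓝[closedBall (0 : ℂ) 1 \ {0}] 0, (S.E 1 ω).det ≠ 0 := by
  filter_upwards [eventually_all.mpr S.eventually_jost_one_ne_zero] with ω hω
  exact (S.det_E_ne_zero_iff 1 ω).mpr hω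

theorem undefinedSet_finite : S.undefinedSet.Finite := by
  classical
  have h00 : (0 : ℂ) ∈ closedBall (0 : ℂ) 1 := by simp
  have hdetT : ∀ᶠ ω in 𝓝[closedBall (0 : ℂ) 1 \ {0}] 0, (S.T ω).det ≠ 0 :=
    ((continuous_id.matrix_det.tendsto _).comp S.tendsto_T_zero).eventually_ne
      S.det_diagonal_jost_ne_zero
  have h1 := finite_zeros_of_meromorphicNear (S := S) (fun ω _ => meromorphicNear_det_central) h00
    (S.eventually_not_isCentralEigenvalue.mono fun ω h => h)
  have h2 := finite_zeros_of_meromorphicNear (S := S) (fun ω hω => .det (meromorphicNear_T hω)) h00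
    hdetT
  have h3 := finite_zeros_of_meromorphicNear (S := S) (fun ω hω => .det (meromorphicNear_E hω 1)) h00
    S.eventually_det_E_ne_zero
  refine ((finite_singleton (0 : ℂ)).union (h1.union (h2.union h3))).subset fun ω hω => ?_
  rcases hω.2 with h | h | h | h
  · exact Or.inl h
  · exact Or.inr (Or.inl ⟨hω.1, h⟩)
  · exact Or.inr (Or.inr (Or.inl ⟨hω.1, h⟩))
  · exact Or.inr (Or.inr (Or.inr ⟨hω.1, h⟩))

/-- At the origin `θ_σ(ω)⁻¹ → ∞`, while `e_σ(1, θ_σ(ω)) → 0`. -/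
theorem tendsto_norm_normalizer_zero (σ : C) :
    Tendsto (fun ω => ‖S.normalizer ω σ σ‖) (𝓝[closedBall (0 : ℂ) 1 \ {0}] 0) atTop := by
  have hb : 0 < S.bLim σ / S.coefB σ 0 := div_pos (S.bLim_pos σ) (S.coefB_pos σ 0)
  have hθ : Tendsto (fun ω => ‖S.theta σ ω‖⁻¹) (𝓝[closedBall (0 : ℂ) 1 \ {0}] 0) atTop := by
    have h1 : Tendsto (S.theta σ) (𝓝[closedBall (0 : ℂ) 1 \ {0}] 0) (𝓝[≠] 0) :=
      (S.tendsto_theta_zero σ).mono_right (nhdsWithin_mono _ fun x hx => hx.2)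
    exact (tendsto_norm_nhdsNE_zero.comp h1).inv_tendsto_nhdsGT_zero
  have h2 := (tendsto_atTop_add_const_right _ (-1) hθ).const_mul_atTop hb
  refine tendsto_atTop_mono' _ ?_ h2
  have hsmall : ∀ᶠ ω in 𝓝[closedBall (0 : ℂ) 1 \ {0}] 0, ‖S.jost σ 1 (S.theta σ ω)‖ ≤ 1 := by
    have h3 := (S.tendsto_jost_theta_zero σ 1).norm
    rw [S.jost_succ_zero σ 0, norm_zero] at h3
    exact (h3.eventually (gt_mem_nhds one_pos)).mono fun _ h => h.le
  filter_upwards [hsmall, S.eventually_det_E_ne_zero, self_mem_nhdsWithin] with ω h3 h4 h5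
  have h6 : 0 < ‖S.jost σ 1 (S.theta σ ω)‖ :=
    norm_pos_iff.mpr ((S.det_E_ne_zero_iff 1 ω).mp h4 σ)
  rw [S.normalizer_self h4, norm_div, norm_mul]
  have h7 : ‖(S.bLim σ : ℂ) / S.coefB σ 0‖ = S.bLim σ / S.coefB σ 0 := by
    rw [← Complex.ofReal_div, Complex.norm_real, Real.norm_of_nonneg hb.le]
  have h8 : ‖S.theta σ ω‖⁻¹ + -1 ≤ ‖(S.theta σ ω)⁻¹ - S.theta σ ω‖ := by
    have := norm_sub_norm_le (S.theta σ ω)⁻¹ (S.theta σ ω)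
    rw [norm_inv] at this
    linarith [S.norm_theta_le σ h5.1]
  rw [h7, le_div_iff₀ h6]
  have h9 : 0 ≤ ‖S.theta σ ω‖⁻¹ + -1 := by
    have := (one_le_inv₀ (norm_pos_iff.mpr (S.theta_ne_zero σ h5.1 h5.2))).mpr
      (S.norm_theta_le σ h5.1)
    linarith
  calc _ ≤ S.bLim σ / S.coefB σ 0 * (‖S.theta σ ω‖⁻¹ + -1) * 1 := by gcongr
    _ ≤ _ := by rw [mul_one]; gcongr

/-- The normalizing factor makes the matrix solution unbounded at the origin. -/
theorem tendsto_norm_U_zero (σ : C) :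
    Tendsto (fun ω => ‖S.U 2 ω σ σ‖) (𝓝[closedBall (0 : ℂ) 1 \ {0}] 0) atTop := by
  have hT : Tendsto (fun ω => (S.T ω)⁻¹ σ σ) (𝓝[closedBall (0 : ℂ) 1 \ {0}] 0)
      (𝓝 ((Matrix.diagonal fun γ => S.jost γ 0 0)⁻¹ σ σ)) :=
    ((continuous_apply_apply σ σ).tendsto _).comp
      ((continuousAt_matrix_inv_of_det_ne_zero S.det_diagonal_jost_ne_zero).tendsto.comp
        S.tendsto_T_zero)
  have h1 := ((S.tendsto_jost_theta_zero σ 2).mul hT).const_add ((S.coefB σ 0 : ℂ) / S.coefB σ 1)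
  rw [S.jost_succ_zero σ 1, zero_mul, add_zero] at h1
  have hne : (S.coefB σ 0 : ℂ) / S.coefB σ 1 ≠ 0 :=
    div_ne_zero (S.coefB_ne_zero σ 0) (S.coefB_ne_zero σ 1)
  have h2 := (S.tendsto_norm_normalizer_zero σ).atTop_mul_pos (norm_pos_iff.mpr hne) h1.norm
  refine h2.congr fun ω => ?_
  rw [← norm_mul, U_apply]
  congr 1
  have h3 : S.jostCoeff ω σ σ = (S.T ω)⁻¹ σ σ * S.normalizer ω σ σ := by
    rw [jostCoeff, Matrix.mul_apply, Finset.sum_eq_single σ]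
    · intro γ _ h
      rw [S.isDiag_normalizer ω h, mul_zero]
    · simp
  rw [h3]
  simp only [regularSolution]
  ring

end WebSystem

namespace WebSystem

variable {A C : Type*} [Fintype C] (S : WebSystem A C) [DecidableEq C]

/-! ### The special solutions -/

open scoped Classical in
/-- The solution on the whole system that continues the `σ`-th column of `U` to the central part.
It is meaningful off the exceptional set. -/
noncomputable def rawSolution (σ : C) (α : A) (ω : ℂ) : ℂ :=
  if h : α ∈ S.central then
    ∑ ν, S.r (S.lam ω) ⟨α, h⟩ (S.attach ν) * S.coefB ν 0 * S.U 1 ω ν σ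
  else S.U ((S.exists_pt_of_notMem_central h).choose_spec.choose + 1) ω
    (S.exists_pt_of_notMem_central h).choose σ

/-- The continuous extension of `rawSolution` to the removable points of the exceptional set. -/
noncomputable def specialSolution (σ : C) (α : A) : ℂ → ℂ :=
  extendFrom (closedBall 0 1 \ S.undefinedSet) (S.rawSolution σ α)

/-- The points of the closed disk where some component of the solution has a pole. -/
def poles (σ : C) : Set ℂ :=
  {ω₀ | ω₀ ∈ closedBall (0 : ℂ) 1 ∧ ∃ α, Tendsto (fun ω => ‖S.rawSolution σ α ω‖)
    (𝓝[closedBall (0 : ℂ) 1 \ {ω₀}] ω₀) atTop}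

variable {S} {σ : C} {ω₀ : ℂ}

theorem rawSolution_central (α : S.central) (ω : ℂ) : S.rawSolution σ α ω =
    ∑ ν, S.r (S.lam ω) α (S.attach ν) * S.coefB ν 0 * S.U 1 ω ν σ := by
  simp [rawSolution]

theorem rawSolution_pt_succ (γ : C) (k : ℕ) (ω : ℂ) :
    S.rawSolution σ (S.pt γ (k + 1)) ω = S.U (k + 1) ω γ σ := by
  have h := S.pt_succ_notMem_central γ k
  have h1 := (S.exists_pt_of_notMem_central h).choose_spec.choose_spec
  have key : ∀ γ' k', S.pt γ (k + 1) = S.pt γ' (k' + 1) →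
      S.U (k' + 1) ω γ' σ = S.U (k + 1) ω γ σ := fun γ' k' h2 => by
    obtain ⟨rfl, h3⟩ := S.pt_inj.mp h2
    rw [h3]
  rw [rawSolution, dif_neg h]
  exact key _ _ h1

theorem rawSolution_pt (hω : ω₀ ∈ closedBall (0 : ℂ) 1 \ S.undefinedSet) (γ : C) (k : ℕ) :
    S.rawSolution σ (S.pt γ k) ω₀ = S.U k ω₀ γ σ := by
  rcases k with _ | k
  · have h1 := rawSolution_central (σ := σ) (S.attach γ) ω₀
    have h2 := congrFun (congrFun (S.U_boundary (det_T_ne_zero_of_notMem hω)) γ) σ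
    rw [h2, Matrix.mul_apply]
    refine h1.trans (Finset.sum_congr rfl fun ν _ => ?_)
    rw [B0, Matrix.mul_diagonal, R, Matrix.of_apply]
  · exact rawSolution_pt_succ γ k ω₀

theorem meromorphicNear_rawSolution (hω : ω₀ ∈ closedBall (0 : ℂ) 1) (α : A) :
    S.MeromorphicNear (S.rawSolution σ α) ω₀ := by
  by_cases h : α ∈ S.central
  · have : S.rawSolution σ α = fun ω =>
        ∑ ν, S.r (S.lam ω) ⟨α, h⟩ (S.attach ν) * S.coefB ν 0 * S.U 1 ω ν σ :=
      funext fun ω => rawSolution_central ⟨α, h⟩ ω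
    rw [this]
    exact .sum _ fun ν _ => ((meromorphicNear_r _ _).mul (.const _ _)).mul
      (meromorphicNear_U hω 1 ν σ)
  · obtain ⟨γ, k, rfl⟩ := S.exists_pt_of_notMem_central h
    rw [funext (rawSolution_pt_succ γ k)]
    exact meromorphicNear_U hω (k + 1) γ σ

theorem continuousWithinAt_rawSolution (hω : ω₀ ∈ closedBall (0 : ℂ) 1 \ S.undefinedSet) (α : A) :
    ContinuousWithinAt (S.rawSolution σ α) (closedBall 0 1) ω₀ := by
  by_cases h : α ∈ S.central
  · have : S.rawSolution σ α = fun ω =>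
        ∑ ν, S.r (S.lam ω) ⟨α, h⟩ (S.attach ν) * S.coefB ν 0 * S.U 1 ω ν σ :=
      funext fun ω => rawSolution_central ⟨α, h⟩ ω
    rw [this]
    have h1 := continuousWithinAt_r (s := closedBall 0 1) (ne_zero_of_notMem hω)
      (not_isCentralEigenvalue_of_notMem hω)
    refine tendsto_finsetSum _ fun ν _ => ?_
    have h2 := (continuous_apply_apply ⟨α, h⟩ (S.attach ν)).continuousAt.comp_continuousWithinAt h1
    exact (h2.mul continuousWithinAt_const).mul (continuousWithinAt_U hω 1 ν σ)
  · obtain ⟨γ, k, rfl⟩ := S.exists_pt_of_notMem_central h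
    rw [funext (rawSolution_pt_succ γ k)]
    exact continuousWithinAt_U hω (k + 1) γ σ

theorem apply_rawSolution (hω : ω₀ ∈ closedBall (0 : ℂ) 1 \ S.undefinedSet) (α : A) :
    S.apply (fun β => S.rawSolution σ β ω₀) α = S.lam ω₀ * S.rawSolution σ α ω₀ := by
  by_cases h : α ∈ S.central
  · refine S.apply_central_of_resolvent (not_isCentralEigenvalue_of_notMem hω)
      (fun β => S.rawSolution σ β ω₀) (fun β => ?_) ⟨α, h⟩
    simp only [rawSolution_central, rawSolution_pt_succ _ 0]
  · obtain ⟨γ, k, rfl⟩ := S.exists_pt_of_notMem_central h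
    refine (S.isChannelSolution_iff (fun β => S.rawSolution σ β ω₀) _ γ).mp ?_ k
    simp only [rawSolution_pt hω]
    exact S.isChannelSolution_U hω.1 (ne_zero_of_notMem hω) γ σ

theorem specialSolution_eq (hω : ω₀ ∈ closedBall (0 : ℂ) 1 \ S.undefinedSet) (α : A) :
    S.specialSolution σ α ω₀ = S.rawSolution σ α ω₀ :=
  extendFrom_extends (fun _ h => (continuousWithinAt_rawSolution h α).mono sdiff_subset) ω₀ hω

theorem eventually_mem_sdiff_undefinedSet (ω₀ : ℂ) :
    ∀ᶠ ω in 𝓝[closedBall (0 : ℂ) 1 \ {ω₀}] ω₀, ω ∈ closedBall (0 : ℂ) 1 \ S.undefinedSet := by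
  have hnb : (S.undefinedSet \ {ω₀})ᶜ ∈ 𝓝 ω₀ :=
    (S.undefinedSet_finite.subset sdiff_subset).isClosed.isOpen_compl.mem_nhds (by simp)
  filter_upwards [mem_nhdsWithin_of_mem_nhds hnb, self_mem_nhdsWithin] with ω h2 h3
  exact ⟨h3.1, fun h => h2 ⟨h, h3.2⟩⟩

theorem holomorphicNear_specialSolution (hω : ω₀ ∈ closedBall (0 : ℂ) 1 \ S.poles σ) (α : A) :
    S.HolomorphicNear (S.specialSolution σ α) ω₀ :=
  .extendFrom S.undefinedSet_finite (fun _ h => meromorphicNear_rawSolution h α)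
    (fun _ h => continuousWithinAt_rawSolution h α) hω.1 fun h => hω.2 ⟨hω.1, α, h⟩

theorem meromorphicNear_specialSolution (hω : ω₀ ∈ closedBall (0 : ℂ) 1) (α : A) :
    S.MeromorphicNear (S.specialSolution σ α) ω₀ :=
  .extendFrom S.undefinedSet_finite (fun _ h => continuousWithinAt_rawSolution h α)
    (meromorphicNear_rawSolution hω α)

theorem continuousWithinAt_specialSolution (hω : ω₀ ∈ closedBall (0 : ℂ) 1 \ S.poles σ) (α : A) :
    ContinuousWithinAt (S.specialSolution σ α) (closedBall 0 1) ω₀ :=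
  (holomorphicNear_specialSolution hω α).continuousWithinAt hω.1

theorem poles_subset_undefinedSet : S.poles σ ⊆ S.undefinedSet := by
  rintro ω₀ ⟨hω, α, h⟩
  by_contra hcon
  have hne : (𝓝[closedBall (0 : ℂ) 1 \ {ω₀}] ω₀).NeBot :=
    neBot_closedBall_diff (finite_singleton _) hω
  have h1 := (continuousWithinAt_rawSolution (σ := σ) ⟨hω, hcon⟩ α).mono (sdiff_subset (t := {ω₀}))
  exact not_tendsto_nhds_of_tendsto_atTop h _ h1.norm

theorem zero_mem_poles : (0 : ℂ) ∈ S.poles σ := by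
  refine ⟨by simp, S.pt σ 2, ?_⟩
  rw [funext (rawSolution_pt_succ σ 1)]
  exact S.tendsto_norm_U_zero σ

theorem ne_zero_of_notMem_poles (hω : ω₀ ∈ closedBall (0 : ℂ) 1 \ S.poles σ) : ω₀ ≠ 0 := by
  rintro rfl
  exact hω.2 zero_mem_poles

/-- Identities between continuous functions extend from the regular points. -/
theorem eq_of_forall_regular {f g : ℂ → ℂ} (hω : ω₀ ∈ closedBall (0 : ℂ) 1)
    (hf : ContinuousWithinAt f (closedBall 0 1) ω₀) (hg : ContinuousWithinAt g (closedBall 0 1) ω₀)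
    (h : ∀ ω ∈ closedBall (0 : ℂ) 1 \ S.undefinedSet, f ω = g ω) : f ω₀ = g ω₀ := by
  have hne : (𝓝[closedBall (0 : ℂ) 1 \ S.undefinedSet] ω₀).NeBot :=
    neBot_closedBall_diff S.undefinedSet_finite hω
  refine tendsto_nhds_unique (l := 𝓝[closedBall 0 1 \ S.undefinedSet] ω₀) (f := f) (hf.mono sdiff_subset) (Tendsto.congr' ?_ (hg.mono sdiff_subset))
  filter_upwards [self_mem_nhdsWithin] with ω h' using (h ω h').symm

theorem apply_specialSolution (hω : ω₀ ∈ closedBall (0 : ℂ) 1 \ S.poles σ) (α : A) :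
    S.apply (fun β => S.specialSolution σ β ω₀) α = S.lam ω₀ * S.specialSolution σ α ω₀ := by
  have h0 := ne_zero_of_notMem_poles hω
  refine eq_of_forall_regular (S := S) (f := fun ω => S.apply (fun β => S.specialSolution σ β ω) α)
    (g := fun ω => S.lam ω * S.specialSolution σ α ω) hω.1 ?_ ?_ fun ω h => ?_
  · exact S.tendsto_apply (fun β => continuousWithinAt_specialSolution hω β) α
  · exact (S.continuousWithinAt_lam h0 _).mul (continuousWithinAt_specialSolution hω α)
  · simp only [specialSolution_eq h]
    exact apply_rawSolution h α

theorem isChannelSolution_specialSolution (hω : ω₀ ∈ closedBall (0 : ℂ) 1 \ S.poles σ) (γ : C) :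
    IsChannelSolution (S.coefA γ) (S.coefB γ) (S.lam ω₀)
      fun k => S.specialSolution σ (S.pt γ k) ω₀ :=
  (S.isChannelSolution_iff (fun β => S.specialSolution σ β ω₀) _ γ).mpr fun _ =>
    apply_specialSolution hω _

theorem casoratian_U_self (hω : ω₀ ∈ closedBall (0 : ℂ) 1 \ S.undefinedSet) :
    casoratian (S.coefB σ) (fun k => S.U k ω₀ σ σ) (fun k => S.jost σ k (S.theta σ ω₀)) 0
      = S.bLim σ * (S.theta σ ω₀ - (S.theta σ ω₀)⁻¹) := by
  have h1 := (S.det_E_ne_zero_iff 1 ω₀).mp (det_E_ne_zero_of_notMem hω) σ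
  have h2 := S.coefB_ne_zero σ 0
  simp only [casoratian, U_apply, S.normalizer_self (det_E_ne_zero_of_notMem hω), regularSolution]
  generalize (S.theta σ ω₀)⁻¹ = θ' at *
  field_simp
  ring

theorem casoratian_U_other (ω : ℂ) {γ : C} (h : γ ≠ σ) (k : ℕ) :
    casoratian (S.coefB γ) (fun k => S.U k ω γ σ) (fun k => S.jost γ k (S.theta γ ω)) k = 0 := by
  simp only [casoratian, U_apply, S.isDiag_normalizer ω h]
  ring

theorem casoratian_specialSolution_self (hω : ω₀ ∈ closedBall (0 : ℂ) 1 \ S.poles σ) (k : ℕ) :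
    casoratian (S.coefB σ) (fun k => S.specialSolution σ (S.pt σ k) ω₀)
      (fun k => S.jost σ k (S.theta σ ω₀)) k = S.bLim σ * (S.theta σ ω₀ - (S.theta σ ω₀)⁻¹) := by
  have h0 := ne_zero_of_notMem_poles hω
  rw [casoratian_eq (isChannelSolution_specialSolution hω σ)
    (S.isChannelSolution_jost_theta σ hω.1 h0)]
  refine eq_of_forall_regular (S := S)
    (f := fun ω => casoratian (S.coefB σ) (fun k => S.specialSolution σ (S.pt σ k) ω)
      (fun k => S.jost σ k (S.theta σ ω)) 0)
    (g := fun ω => S.bLim σ * (S.theta σ ω - (S.theta σ ω)⁻¹)) hω.1 ?_ ?_ fun ω h => ?_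
  · have h1 := fun k => continuousWithinAt_specialSolution hω (S.pt σ k)
    have h2 := fun k => S.continuousOn_jost_theta σ k ω₀ hω.1
    exact continuousWithinAt_const.mul (((h1 0).mul (h2 1)).sub ((h1 1).mul (h2 0)))
  · have h1 := S.continuousOn_theta σ ω₀ hω.1
    exact continuousWithinAt_const.mul (h1.sub (h1.inv₀ (S.theta_ne_zero σ hω.1 h0)))
  · simp only [specialSolution_eq h, rawSolution_pt h]
    exact casoratian_U_self h

theorem casoratian_specialSolution_other (hω : ω₀ ∈ closedBall (0 : ℂ) 1 \ S.poles σ) {γ : C}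
    (hγ : γ ≠ σ) (k : ℕ) : casoratian (S.coefB γ) (fun k => S.specialSolution σ (S.pt γ k) ω₀)
      (fun k => S.jost γ k (S.theta γ ω₀)) k = 0 := by
  refine eq_of_forall_regular (S := S)
    (f := fun ω => casoratian (S.coefB γ) (fun k => S.specialSolution σ (S.pt γ k) ω)
      (fun k => S.jost γ k (S.theta γ ω)) k) (g := fun _ => 0) hω.1 ?_ continuousWithinAt_const
      fun ω h => ?_
  · have h1 := fun k => continuousWithinAt_specialSolution hω (S.pt γ k)
    have h2 := fun k => S.continuousOn_jost_theta γ k ω₀ hω.1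
    exact continuousWithinAt_const.mul (((h1 k).mul (h2 (k + 1))).sub ((h1 (k + 1)).mul (h2 k)))
  · simp only [specialSolution_eq h, rawSolution_pt h]
    exact casoratian_U_other ω hγ k

/-- The scattering representation on `T_σ⁺`, with the coefficient read off at the `K`-th
particle. -/
theorem specialSolution_self_eq (hω : ω₀ ∈ closedBall (0 : ℂ) 1 \ S.poles σ)
    (hT : ω₀ ∈ S.Tplus σ) {K : ℕ} (hK : S.jost σ K (S.theta σ ω₀) ≠ 0) (k : ℕ) :
    S.specialSolution σ (S.pt σ k) ω₀ = S.jost σ k (S.theta σ ω₀)⁻¹ +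
      (S.specialSolution σ (S.pt σ K) ω₀ - S.jost σ K (S.theta σ ω₀)⁻¹) /
        S.jost σ K (S.theta σ ω₀) * S.jost σ k (S.theta σ ω₀) := by
  have h0 := ne_zero_of_notMem_poles hω
  have hg := S.isChannelSolution_jost_theta σ hω.1 h0
  have hf : IsChannelSolution (S.coefA σ) (S.coefB σ) (S.lam ω₀)
      fun k => S.jost σ k (S.theta σ ω₀)⁻¹ := by
    have h1 := hg.conj
    simp only [S.conj_jost σ hT.2] at h1
    rwa [← S.zhukovskii_theta σ hω.1 h0, conj_zhukovskii _ _ hT.2, S.zhukovskii_theta σ hω.1 h0] at h1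
  have hu := (isChannelSolution_specialSolution hω σ).add (hf.const_mul (-1))
  have hcas := casoratian_specialSolution_self hω 0
  rw [← S.casoratian_jost_inv σ hT.2 0] at hcas
  have h2 := hu.mul_eq_mul (S.coefB_pos σ) hg (by
    simp only [casoratian] at hcas ⊢
    linear_combination hcas) K k
  generalize (S.theta σ ω₀)⁻¹ = θ' at *
  field_simp
  linear_combination h2

theorem specialSolution_other_eq (hω : ω₀ ∈ closedBall (0 : ℂ) 1 \ S.poles σ) {γ : C}
    (hγ : γ ≠ σ) {K : ℕ} (hK : S.jost γ K (S.theta γ ω₀) ≠ 0) (k : ℕ) :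
    S.specialSolution σ (S.pt γ k) ω₀ = S.specialSolution σ (S.pt γ K) ω₀ /
      S.jost γ K (S.theta γ ω₀) * S.jost γ k (S.theta γ ω₀) := by
  have h0 := ne_zero_of_notMem_poles hω
  have h2 := (isChannelSolution_specialSolution hω γ).mul_eq_mul (S.coefB_pos γ)
    (S.isChannelSolution_jost_theta γ hω.1 h0) (casoratian_specialSolution_other hω hγ 0) K k
  field_simp
  linear_combination h2

theorem tendsto_specialSolution_self (hω : ω₀ ∈ closedBall (0 : ℂ) 1 \ S.poles σ)
    (hT : ω₀ ∉ S.Tplus σ) :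
    Tendsto (fun k : ℕ => S.specialSolution σ (S.pt σ k) ω₀ / (S.theta σ ω₀)⁻¹ ^ k) atTop (𝓝 1) := by
  have h0 := ne_zero_of_notMem_poles hω
  have hθ0 := S.theta_ne_zero σ hω.1 h0
  have hlt : ‖S.theta σ ω₀‖ < 1 := by
    by_cases hb : ω₀ ∈ ball (0 : ℂ) 1
    · exact S.norm_theta_lt_of_mem_ball σ hb
    · refine lt_of_le_of_ne (S.norm_theta_le σ hω.1) fun h => hT ⟨?_, h⟩
      rw [← closedBall_sdiff_ball]; exact ⟨hω.1, hb⟩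
  refine (tendsto_mul_pow_of_casoratian (S.tendsto_coefB σ) (S.bLim_pos σ).ne' hθ0 hlt
    (S.tendsto_jost σ hlt.le hθ0) (casoratian_specialSolution_self hω)).congr fun k => ?_
  rw [inv_pow, div_inv_eq_mul]

end WebSystem

namespace WebSystem

variable {A C : Type*} [Fintype C] {S : WebSystem A C} {σ : C} {ω₀ : ℂ}

/-! ### The approach region -/

/-- At a point of the unit circle the disk contains points arbitrarily close to it at which
`Im λ` dominates the square of the local parameter. -/
theorem exists_neBot_approach (hω : ω₀ ∈ sphere (0 : ℂ) 1) : ∃ c > 0,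
    (𝓝[{ω | ω ∈ ball (0 : ℂ) 1 ∧ c * ‖S.localParam ω₀ ω‖ ^ 2 ≤ |(S.lam ω).im|}] ω₀).NeBot := by
  -- the points approach `ω₀` along a line transversal to both the circle and the real axis
  set p : ℝ → ℂ := fun δ => ω₀ * (1 - δ * (1 + Complex.I)) with hp
  have hn : ω₀.re ^ 2 + ω₀.im ^ 2 = 1 := by
    have h1 := Complex.normSq_apply ω₀
    rw [Complex.normSq_eq_norm_sq, mem_sphere_zero_iff_norm.mp hω] at h1
    linarith
  have hptend : Tendsto p (𝓝[>] 0) (𝓝 ω₀) := by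
    have : Continuous p := by fun_prop
    simpa [hp] using (this.tendsto 0).mono_left nhdsWithin_le_nhds
  have hnsq : ∀ δ : ℝ, Complex.normSq (p δ) = 1 - 2 * δ + 2 * δ ^ 2 := fun δ => by
    simp only [hp, Complex.normSq_apply, Complex.mul_re, Complex.mul_im, Complex.sub_re,
      Complex.sub_im, Complex.add_re, Complex.add_im, Complex.ofReal_re, Complex.ofReal_im,
      Complex.I_re, Complex.I_im, Complex.one_re, Complex.one_im]
    linear_combination (1 - 2 * δ + 2 * δ ^ 2) * hn
  have him : ∀ δ : ℝ, (p δ).im = (1 - δ) * ω₀.im - δ * ω₀.re := fun δ => by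
    simp only [hp, Complex.mul_re, Complex.mul_im, Complex.sub_re,
      Complex.sub_im, Complex.add_re, Complex.add_im, Complex.ofReal_re, Complex.ofReal_im,
      Complex.I_re, Complex.I_im, Complex.one_re, Complex.one_im]
    ring
  have hdist : ∀ δ : ℝ, 0 ≤ δ → ‖p δ - ω₀‖ ^ 2 = 2 * δ ^ 2 := fun δ _ => by
    rw [← Complex.normSq_eq_norm_sq]
    simp only [hp, Complex.normSq_apply, Complex.mul_re, Complex.mul_im, Complex.sub_re,
      Complex.sub_im, Complex.add_re, Complex.add_im, Complex.ofReal_re, Complex.ofReal_im,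
      Complex.I_re, Complex.I_im, Complex.one_re, Complex.one_im]
    linear_combination (2 * δ ^ 2) * hn
  have hball : ∀ δ : ℝ, 0 < δ → δ < 1 / 2 → p δ ∈ ball (0 : ℂ) 1 := fun δ h1 h2 => by
    rw [mem_ball_zero_iff, ← sq_lt_one_iff₀ (norm_nonneg _), ← Complex.normSq_eq_norm_sq, hnsq]
    nlinarith
  have hlam : ∀ δ : ℝ, 0 < δ → δ < 1 / 2 → S.b * δ * |(p δ).im| ≤ |(S.lam (p δ)).im| :=
    fun δ h1 h2 => by
      have h3 : δ ≤ 1 / Complex.normSq (p δ) - 1 := by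
        rw [hnsq, le_sub_iff_add_le, le_div_iff₀ (by nlinarith)]
        nlinarith [mul_pos h1 h1, mul_pos h1 (sub_pos.mpr h2)]
      rw [lam, im_zhukovskii, abs_mul, abs_mul, abs_of_pos S.b_pos, abs_of_pos (h1.trans_le h3),
        mul_right_comm]
      exact mul_le_mul_of_nonneg_left h3 (mul_nonneg S.b_pos.le (abs_nonneg _))
  have hev : ∀ᶠ δ : ℝ in 𝓝[>] 0, 0 < δ ∧ δ < 1 / 2 :=
    Ioo_mem_nhdsGT (by norm_num)
  have key : ∀ c > 0, (∀ᶠ δ : ℝ in 𝓝[>] 0, c * ‖S.localParam ω₀ (p δ)‖ ^ 2 ≤ |(S.lam (p δ)).im|) →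
      ∃ c > 0, (𝓝[{ω | ω ∈ ball (0 : ℂ) 1 ∧
        c * ‖S.localParam ω₀ ω‖ ^ 2 ≤ |(S.lam ω).im|}] ω₀).NeBot := fun c hc h => by
    refine ⟨c, hc, mem_closure_iff_nhdsWithin_neBot.mp (mem_closure_of_tendsto hptend ?_)⟩
    filter_upwards [h, hev] with δ h1 h2 using ⟨hball δ h2.1 h2.2, h1⟩
  have hb := S.b_pos
  by_cases h0 : ω₀.im = 0
  · -- near `±1` the imaginary part of `λ` is quadratically small
    have hre : |ω₀.re| = 1 := by
      rw [h0] at hn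
      exact (sq_eq_sq₀ (abs_nonneg _) zero_le_one).mp (by rw [sq_abs]; linarith)
    have hnot : ω₀ ∉ S.bandEdges := fun h => by
      rcases eq_or_eq_neg_of_abs_eq hre with h1 | h1
      · exact h.2.1 (Complex.ext h1 h0)
      · exact h.2.2.1 (Complex.ext h1 (by simpa using h0))
    refine key (S.b / 2) (by positivity) ?_
    filter_upwards [hev] with δ h
    refine le_trans (le_of_eq ?_) (hlam δ h.1 h.2)
    rw [S.norm_localParam_of_notMem hnot, hdist δ h.1.le, him, h0, mul_zero, zero_sub, abs_neg,
      abs_mul, hre, abs_of_pos h.1]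
    ring
  · have hpos : 0 < |ω₀.im| := abs_pos.mpr h0
    refine key (S.b * (|ω₀.im| / 2) / 2) (by positivity) ?_
    have h1 : ∀ᶠ δ : ℝ in 𝓝[>] 0, |ω₀.im| / 2 < |(p δ).im| :=
      ((continuous_abs.comp Complex.continuous_im).tendsto ω₀ |>.comp hptend).eventually_const_lt
        (by simp only [Function.comp]; linarith)
    filter_upwards [hev, h1] with δ h h2
    refine le_trans ?_ (hlam δ h.1 h.2)
    have h3 : ‖S.localParam ω₀ (p δ)‖ ^ 2 ≤ 2 * δ := by
      have h4 := hdist δ h.1.le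
      by_cases hE : ω₀ ∈ S.bandEdges
      · rw [S.norm_localParam_of_mem hE]
        refine abs_le_of_sq_le_sq' ?_ (by linarith [h.1]) |>.2
        rw [h4]
        nlinarith
      · rw [S.norm_localParam_of_notMem hE, h4]
        nlinarith [h.1, h.2]
    calc S.b * (|ω₀.im| / 2) / 2 * ‖S.localParam ω₀ (p δ)‖ ^ 2
        ≤ S.b * (|ω₀.im| / 2) / 2 * (2 * δ) := mul_le_mul_of_nonneg_left h3 (by positivity)
      _ = S.b * δ * (|ω₀.im| / 2) := by ring
      _ ≤ _ := mul_le_mul_of_nonneg_left h2.le (mul_nonneg hb.le h.1.le)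

variable [DecidableEq C]

/-! ### The energy flux through the incoming channel -/

theorem rawSolution_pt_other (hω : ω₀ ∈ closedBall (0 : ℂ) 1 \ S.undefinedSet) {γ : C} (hγ : γ ≠ σ)
    (k : ℕ) : S.rawSolution σ (S.pt γ k) ω₀ =
      S.jostCoeff ω₀ γ σ * S.jost γ k (S.theta γ ω₀) := by
  rw [rawSolution_pt hω, U_apply, S.isDiag_normalizer ω₀ hγ]
  ring

theorem exists_tendsto_rawSolution_other (hω : ω₀ ∈ closedBall (0 : ℂ) 1 \ S.undefinedSet) {γ : C}
    (hγ : γ ≠ σ) :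
    ∃ c, Tendsto (fun k => S.rawSolution σ (S.pt γ k) ω₀ / S.theta γ ω₀ ^ k) atTop (𝓝 c) := by
  refine ⟨_, ((S.tendsto_jost γ (S.norm_theta_le γ hω.1)
    (S.theta_ne_zero γ hω.1 (ne_zero_of_notMem hω))).const_mul (S.jostCoeff ω₀ γ σ)).congr
    fun k => ?_⟩
  rw [rawSolution_pt_other hω hγ, mul_div_assoc]

theorem ball_diff_subset {F : Set ℂ} : ball (0 : ℂ) 1 \ F ⊆ closedBall 0 1 \ F :=
  sdiff_subset_sdiff_left ball_subset_closedBall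

/-- Green's formula for the solution and its conjugate. Inside the disk the solution decays along
all channels but `σ`, so its energy is supplied by the flux through the first bond of `σ`. -/
theorem sq_im_lam_mul_energy_le (hω : ω₀ ∈ ball (0 : ℂ) 1 \ S.undefinedSet) (n : ℕ) :
    (S.lam ω₀).im ^ 2 * (∑ α : S.central, ‖S.rawSolution σ α ω₀‖ ^ 2 +
        ∑ γ, ∑ k ∈ Finset.range (if γ = σ then 0 else n), ‖S.rawSolution σ (S.pt γ (k + 1)) ω₀‖ ^ 2)
      ≤ (S.lam ω₀).im * (S.coefB σ 0 * (S.rawSolution σ (S.pt σ 0) ω₀ *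
          starRingEnd ℂ (S.rawSolution σ (S.pt σ 1) ω₀)).im) := by
  have hω' := ball_diff_subset hω
  set u : A → ℂ := fun β => S.rawSolution σ β ω₀ with hu
  set l := S.lam ω₀
  set e : ℕ → ℝ := fun n => ∑ α : S.central, ‖u α‖ ^ 2 +
    ∑ γ, ∑ k ∈ Finset.range (if γ = σ then 0 else n), ‖u (S.pt γ (k + 1))‖ ^ 2 with he
  have happ : ∀ α, S.apply u α = l * u α := apply_rawSolution hω'
  have happ' : ∀ α, S.apply (fun β => starRingEnd ℂ (u β)) α = starRingEnd ℂ l * starRingEnd ℂ (u α) :=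
    fun α => by rw [apply_conj, happ, map_mul]
  set w : C → ℕ → ℂ := fun γ => casoratian (S.coefB γ) (fun k => u (S.pt γ k))
    (fun k => starRingEnd ℂ (u (S.pt γ k))) with hw
  have hgreen : ∀ n : ℕ, (l - starRingEnd ℂ l) * (e n : ℂ) = ∑ γ, w γ (if γ = σ then 0 else n) :=
    fun n => by
      rw [← S.green_truncated happ happ' fun γ => if γ = σ then 0 else n]
      simp only [he, Complex.mul_conj']
      push_cast
      rfl
  have hlim : Tendsto (fun n : ℕ => ∑ γ, w γ (if γ = σ then 0 else n)) atTop
      (𝓝 (∑ γ, if γ = σ then w γ 0 else 0)) := by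
    refine tendsto_finsetSum _ fun γ _ => ?_
    by_cases hγ : γ = σ
    · simp only [if_pos hγ]
      exact tendsto_const_nhds
    · simp only [if_neg hγ]
      have h0 := S.theta_ne_zero γ hω'.1 (ne_zero_of_notMem hω')
      have hlt := S.norm_theta_lt_of_mem_ball γ hω.1
      obtain ⟨c, hc⟩ := exists_tendsto_rawSolution_other hω' hγ
      refine tendsto_casoratian_zero (S.tendsto_coefB γ) (θ₁ := S.theta γ ω₀)
        (θ₂ := starRingEnd ℂ (S.theta γ ω₀)) h0 ((map_ne_zero _).mpr h0) ?_ ⟨c, hc⟩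
        ⟨starRingEnd ℂ c, ?_⟩
      · rw [norm_mul, RCLike.norm_conj]
        exact mul_lt_one_of_nonneg_of_lt_one_left (norm_nonneg _) hlt hlt.le
      · refine ((Complex.continuous_conj.tendsto c).comp hc).congr fun k => ?_
        simp [u]
  have hlim' : Tendsto (fun n => l.im ^ 2 * e n) atTop (𝓝 (l.im * (S.coefB σ 0 *
      (u (S.pt σ 0) * starRingEnd ℂ (u (S.pt σ 1))).im))) := by
    have h1 := ((Complex.continuous_im.tendsto _).comp hlim).const_mul (l.im / 2)
    have h2 : (∑ γ, if γ = σ then w γ 0 else 0).im =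
        2 * (S.coefB σ 0 * (u (S.pt σ 0) * starRingEnd ℂ (u (S.pt σ 1))).im) := by
      rw [Finset.sum_ite_eq' Finset.univ σ, if_pos (Finset.mem_univ _)]
      simp only [hw, casoratian, Complex.mul_im, Complex.sub_im, Complex.sub_re, Complex.mul_re,
        Complex.ofReal_re, Complex.ofReal_im, Complex.conj_re, Complex.conj_im, zero_add]
      ring
    rw [h2] at h1
    convert h1 using 1
    · ext n
      simp only [Function.comp, ← hgreen, Complex.sub_conj]
      simp [Complex.mul_im]
      ring
    · congr 1
      ring
  refine Monotone.ge_of_tendsto (f := fun n => l.im ^ 2 * e n) (fun i j hij => ?_) hlim' n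
  refine mul_le_mul_of_nonneg_left (add_le_add_right (Finset.sum_le_sum fun γ _ => ?_) _)
    (sq_nonneg _)
  refine Finset.sum_le_sum_of_subset_of_nonneg (Finset.range_subset_range.mpr ?_)
    fun _ _ _ => sq_nonneg _
  split_ifs
  exacts [le_rfl, hij]

/-- The flux has the sign of `Im ω`, at the regular boundary points as well. -/
theorem im_mul_flux_nonneg (hω : ω₀ ∈ closedBall (0 : ℂ) 1 \ S.undefinedSet) :
    0 ≤ ω₀.im * (S.rawSolution σ (S.pt σ 0) ω₀ *
      starRingEnd ℂ (S.rawSolution σ (S.pt σ 1) ω₀)).im := by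
  have hc := fun k => continuousWithinAt_rawSolution (σ := σ) hω (S.pt σ k)
  refine mem_of_forall_ball (s := Ici (0 : ℝ)) (f := fun ω => ω.im *
    (S.rawSolution σ (S.pt σ 0) ω * starRingEnd ℂ (S.rawSolution σ (S.pt σ 1) ω)).im) isClosed_Ici
    hω.1 ?_ S.undefinedSet_finite fun ω h => ?_
  · exact Complex.continuous_im.continuousWithinAt.mul (Complex.continuous_im.continuousAt.comp_continuousWithinAt
      ((hc 0).mul (Complex.continuous_conj.continuousAt.comp_continuousWithinAt (hc 1))))
  · have h1 := sq_im_lam_mul_energy_le (σ := σ) h 0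
    have h0 := ne_zero_of_notMem (ball_diff_subset h)
    have h2 : 0 < 1 / Complex.normSq ω - 1 := by
      have h3 : ‖ω‖ < 1 := by simpa using h.1
      have h4 : Complex.normSq ω < 1 := by
        rw [Complex.normSq_eq_norm_sq]; exact pow_lt_one₀ (norm_nonneg _) h3 two_ne_zero
      rw [sub_pos, lt_div_iff₀ (Complex.normSq_pos.mpr h0), one_mul]
      exact h4
    have h5 : 0 ≤ (S.lam ω).im * (S.coefB σ 0 * (S.rawSolution σ (S.pt σ 0) ω *
        starRingEnd ℂ (S.rawSolution σ (S.pt σ 1) ω)).im) := le_trans (by positivity) h1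
    rw [lam, im_zhukovskii] at h5
    have h6 : 0 < S.b * (1 / Complex.normSq ω - 1) * S.coefB σ 0 :=
      mul_pos (mul_pos S.b_pos h2) (S.coefB_pos σ 0)
    refine nonneg_of_mul_nonneg_right ?_ h6
    refine h5.trans_eq ?_
    ring

/-- On `T_σ⁺` the flux is `(1 - |s|²)` times the flux of the incoming wave, so the reflection
coefficient is at most one in modulus. Hence the solution stays bounded on the channel `σ`. -/
theorem norm_rawSolution_self_le (hω : ω₀ ∈ closedBall (0 : ℂ) 1 \ S.undefinedSet)
    (hT : ω₀ ∈ S.Tplus σ) (hi : ω₀.im ≠ 0) (hθi : (S.theta σ ω₀).im ≠ 0) {K : ℕ}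
    (hK : S.jost σ K (S.theta σ ω₀) ≠ 0) (k : ℕ) :
    ‖S.rawSolution σ (S.pt σ k) ω₀‖ ≤ 2 * ‖S.jost σ k (S.theta σ ω₀)‖ := by
  have hω' : ω₀ ∈ closedBall (0 : ℂ) 1 \ S.poles σ :=
    ⟨hω.1, fun h => hω.2 (poles_subset_undefinedSet h)⟩
  set θ := S.theta σ ω₀ with hθ
  set s : ℂ := (S.specialSolution σ (S.pt σ K) ω₀ - S.jost σ K θ⁻¹) / S.jost σ K θ with hs
  -- on the unit circle the incoming wave is the complex conjugate of the outgoing one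
  have hrep : ∀ k, S.rawSolution σ (S.pt σ k) ω₀ =
      starRingEnd ℂ (S.jost σ k θ) + s * S.jost σ k θ := fun k => by
    rw [← specialSolution_eq hω, S.conj_jost σ hT.2]
    exact specialSolution_self_eq hω' hT hK k
  have hflux : S.coefB σ 0 * (S.rawSolution σ (S.pt σ 0) ω₀ *
      starRingEnd ℂ (S.rawSolution σ (S.pt σ 1) ω₀)).im = (1 - ‖s‖ ^ 2) * (S.bLim σ * θ.im) := by
    have h1 := congrArg Complex.im (S.casoratian_jost_inv σ hT.2 0)
    rw [← hθ] at h1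
    have h2 : (θ⁻¹).im = -θ.im := by
      rw [Complex.inv_im, Complex.normSq_eq_norm_sq, hT.2]
      simp
    simp only [casoratian, zero_add] at h1
    rw [← S.conj_jost σ hT.2, ← S.conj_jost σ hT.2] at h1
    simp only [Complex.mul_im, Complex.sub_im,
      Complex.sub_re, Complex.mul_re, Complex.ofReal_re, Complex.ofReal_im, Complex.conj_re,
      Complex.conj_im, h2] at h1
    rw [hrep, hrep, ← Complex.normSq_eq_norm_sq, Complex.normSq_apply]
    simp only [Complex.mul_im, Complex.mul_re, Complex.conj_re, Complex.conj_im, Complex.add_re,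
      Complex.add_im, map_add, map_mul, Complex.conj_conj]
    linear_combination (1 - (s.re * s.re + s.im * s.im)) / 2 * h1
  have hs1 : ‖s‖ ≤ 1 := by
    have h1 := im_mul_flux_nonneg (σ := σ) hω
    have h2 : 0 ≤ ω₀.im * ((1 - ‖s‖ ^ 2) * (S.bLim σ * θ.im)) := by
      rw [← hflux, mul_left_comm]
      exact mul_nonneg (S.coefB_pos σ 0).le h1
    have h3 : 0 < S.bLim σ * (ω₀.im * θ.im) :=
      mul_pos (S.bLim_pos σ) (lt_of_le_of_ne (S.im_mul_im_theta_nonneg σ hω.1)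
        (mul_ne_zero hi hθi).symm)
    have h4 : 0 ≤ 1 - ‖s‖ ^ 2 := by
      refine nonneg_of_mul_nonneg_right ?_ h3
      refine h2.trans_eq ?_
      ring
    exact (sq_le_one_iff₀ (norm_nonneg _)).mp (by linarith)
  rw [hrep]
  refine (norm_add_le _ _).trans ?_
  rw [RCLike.norm_conj, norm_mul, two_mul]
  exact add_le_add_right (mul_le_of_le_one_left (norm_nonneg _) hs1) _

/-- The solution has no pole on the channel `σ` at the points of `T_σ⁺`. -/
theorem exists_tendsto_rawSolution_self (hT : ω₀ ∈ S.Tplus σ) (k : ℕ) :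
    ∃ c, Tendsto (S.rawSolution σ (S.pt σ k)) (𝓝[closedBall (0 : ℂ) 1 \ {ω₀}] ω₀) (𝓝 c) := by
  have hω := S.Tplus_subset σ hT
  obtain ⟨K, hK⟩ := S.exists_forall_jost_ne_zero
  obtain ⟨M, hM0, hM⟩ := S.exists_norm_jost_le σ
  set F : Set ℂ := S.undefinedSet ∪ ({ω₀} ∪ ({1, -1} ∪
    ({ω | ω ∈ closedBall 0 1 ∧ S.theta σ ω = 1} ∪ {ω | ω ∈ closedBall 0 1 ∧ S.theta σ ω = -1})))
    with hF
  have hFfin : F.Finite := S.undefinedSet_finite.union ((finite_singleton _).union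
    ((toFinite _).union ((S.finite_setOf_theta_eq σ 1).union (S.finite_setOf_theta_eq σ (-1)))))
  have him : ∀ z : ℂ, ‖z‖ = 1 → z ≠ 1 → z ≠ -1 → z.im ≠ 0 := fun z hz h1 h2 h3 => by
    have h4 : z.re ^ 2 = 1 := by
      have h5 := Complex.normSq_apply z
      rw [Complex.normSq_eq_norm_sq, hz, h3] at h5
      linarith
    rcases eq_or_eq_neg_of_sq_eq_sq z.re 1 (by linarith) with h | h
    · exact h1 (Complex.ext h h3)
    · exact h2 (Complex.ext h (by simpa using h3))
  have hbd : ∀ ω ∈ S.Tplus σ \ F, ‖S.rawSolution σ (S.pt σ k) ω‖ ≤ 2 * M := fun ω h => by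
    have h1 := S.Tplus_subset σ h.1
    have h0 := S.ne_zero_of_mem_Tplus h.1
    obtain ⟨h2, hω'⟩ := h
    simp only [hF, mem_union, mem_insert_iff, mem_singleton_iff, mem_ofPred_eq, not_or, h1, true_and]
      at hω'
    obtain ⟨h3, h4, ⟨h5, h6⟩, h7, h8⟩ := hω'
    have h9 := norm_rawSolution_self_le (k := k) ⟨h1, h3⟩ h2 (him ω (by simpa using h2.1) h5 h6)
      (him _ h2.2 h7 h8) (hK σ _ h2.2.le (S.theta_ne_zero σ h1 h0))
    have h10 := hM k _ h2.2.le
    rw [h2.2, one_pow, mul_one] at h10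
    linarith
  -- boundedness along the arc `T_σ⁺` alone excludes a pole
  have hnt : ¬ Tendsto (fun ω => ‖S.rawSolution σ (S.pt σ k) ω‖)
      (𝓝[closedBall (0 : ℂ) 1 \ {ω₀}] ω₀) atTop := fun h => by
    have hne := S.neBot_Tplus_diff hFfin hT
    have h1 : Tendsto (fun ω => ‖S.rawSolution σ (S.pt σ k) ω‖) (𝓝[S.Tplus σ \ F] ω₀) atTop :=
      h.mono_left (nhdsWithin_mono _ fun ω h => ⟨S.Tplus_subset σ h.1, fun h' => h.2
        (Or.inr (Or.inl h'))⟩)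
    obtain ⟨ω, h2, h3⟩ := ((h1.eventually_gt_atTop (2 * M)).and self_mem_nhdsWithin).exists
    exact (hbd ω h3).not_gt h2
  obtain ⟨G, hG, hGe⟩ := MeromorphicNear.exists_analyticAt hω (meromorphicNear_rawSolution hω _) hnt
  refine ⟨G 0, Tendsto.congr' (hGe.mono fun ω h => h.symm) ?_⟩
  exact hG.continuousAt.tendsto.comp ((S.tendsto_localParam_ne hω).mono_right nhdsWithin_le_nhds)

end WebSystem

namespace WebSystem

variable {A C : Type*} [Fintype C] {S : WebSystem A C} {σ : C} {ω₀ : ℂ}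

/-! ### Absence of poles on `T_σ⁺` -/

theorem apply_const_mul (c : ℂ) (ξ : A → ℂ) (α : A) :
    S.apply (fun β => c * ξ β) α = c * S.apply ξ α := by
  rw [apply, apply, ← smul_eq_mul, smul_finsum]
  simp only [smul_eq_mul, mul_left_comm]

/-- Let `φ` be an eigenfunction at a real spectral parameter `l₀` which is a limit of solutions
`Ψ ω` at spectral parameters other than `l₀`. If the Wronskians of `Ψ ω` and `conj φ` vanish at
infinity, Green's formula makes `Ψ ω` and `φ` orthogonal; if the products are dominated along the
channels, the orthogonality persists in the limit and gives `φ = 0`. -/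
theorem eq_zero_of_tendsto_of_decay {l₀ : ℝ} {φ : A → ℂ} {F : Filter ℂ} [F.NeBot]
    {Ψ : ℂ → A → ℂ} (hφ : ∀ α, S.apply φ α = l₀ * φ α)
    (hΨ : ∀ᶠ ω in F, ∀ α, S.apply (Ψ ω) α = S.lam ω * Ψ ω α) (hne : ∀ᶠ ω in F, S.lam ω ≠ l₀)
    (hlim : ∀ α, Tendsto (fun ω => Ψ ω α) F (𝓝 (φ α)))
    (hdom : ∀ γ, ∃ M ρ : ℝ, 0 ≤ ρ ∧ ρ < 1 ∧
      ∀ᶠ ω in F, ∀ k, ‖Ψ ω (S.pt γ (k + 1)) * starRingEnd ℂ (φ (S.pt γ (k + 1)))‖ ≤ M * ρ ^ k)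
    (hcas : ∀ᶠ ω in F, ∀ γ, Tendsto (casoratian (S.coefB γ) (fun k => Ψ ω (S.pt γ k))
      fun k => starRingEnd ℂ (φ (S.pt γ k))) atTop (𝓝 0)) (α : A) : φ α = 0 := by
  choose M ρ hρ0 hρ1 hM using hdom
  have hφ' : ∀ α, S.apply (fun β => starRingEnd ℂ (φ β)) α = l₀ * starRingEnd ℂ (φ α) := fun α => by
    rw [apply_conj, hφ, map_mul, Complex.conj_ofReal]
  have hsum : ∀ γ, Summable fun k : ℕ => M γ * ρ γ ^ k := fun γ =>
    (summable_geometric_of_lt_one (hρ0 γ) (hρ1 γ)).mul_left _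
  -- the Green formula on the whole system
  have horth : ∀ᶠ ω in F, ∑ α : S.central, Ψ ω α * starRingEnd ℂ (φ α) +
      ∑ γ, ∑' k, Ψ ω (S.pt γ (k + 1)) * starRingEnd ℂ (φ (S.pt γ (k + 1))) = 0 := by
    filter_upwards [hΨ, hne, hcas, eventually_all.mpr hM] with ω h1 h2 h3 h4
    have h5 : Tendsto (fun n : ℕ => (S.lam ω - l₀) * (∑ α : S.central, Ψ ω α * starRingEnd ℂ (φ α) +
        ∑ γ, ∑ k ∈ Finset.range n, Ψ ω (S.pt γ (k + 1)) * starRingEnd ℂ (φ (S.pt γ (k + 1)))))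
        atTop (𝓝 0) := by
      simp only [S.green_truncated h1 hφ' fun _ => _]
      simpa using tendsto_finsetSum Finset.univ fun γ _ => h3 γ
    have h6 := ((tendsto_const_nhds
      (x := ∑ α : S.central, Ψ ω α * starRingEnd ℂ (φ α))).add (tendsto_finsetSum Finset.univ fun γ _ =>
      (Summable.of_norm_bounded (hsum γ) (h4 γ)).hasSum.tendsto_sum_nat)).const_mul (S.lam ω - l₀)
    exact (mul_eq_zero.mp (tendsto_nhds_unique h6 h5)).resolve_left (sub_ne_zero.mpr h2)
  have hterm : ∀ α, Tendsto (fun ω => Ψ ω α * starRingEnd ℂ (φ α)) F (𝓝 ((‖φ α‖ ^ 2 : ℝ) : ℂ)) :=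
    fun α => by
      have := (hlim α).mul_const (starRingEnd ℂ (φ α))
      rwa [Complex.mul_conj', ← Complex.ofReal_pow] at this
  have hlim' := (tendsto_finsetSum (Finset.univ : Finset S.central) fun α _ => hterm α).add
    (tendsto_finsetSum Finset.univ fun γ _ => tendsto_tsum_of_dominated_convergence (hsum γ)
      (fun k => hterm (S.pt γ (k + 1))) (hM γ))
  have hzero := tendsto_nhds_unique (Tendsto.congr' horth hlim') tendsto_const_nhds
  have hsq : ∀ γ, Summable fun k => ‖φ (S.pt γ (k + 1))‖ ^ 2 := fun γ => by
    refine Summable.of_nonneg_of_le (fun _ => sq_nonneg _) (fun k => ?_) (hsum γ)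
    refine le_of_tendsto (f := fun ω => ‖Ψ ω (S.pt γ (k + 1)) *
      starRingEnd ℂ (φ (S.pt γ (k + 1)))‖) (x := F) ?_ ((hM γ).mono fun ω h => h k)
    have := (hterm (S.pt γ (k + 1))).norm
    rwa [Complex.norm_real, Real.norm_of_nonneg (sq_nonneg _)] at this
  simp only [← Complex.ofReal_tsum, ← Complex.ofReal_sum, ← Complex.ofReal_add] at hzero
  rw [Complex.ofReal_eq_zero, add_eq_zero_iff_of_nonneg
    (Finset.sum_nonneg fun _ _ => sq_nonneg _)
    (Finset.sum_nonneg fun _ _ => tsum_nonneg fun _ => sq_nonneg _),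
    Finset.sum_eq_zero_iff_of_nonneg fun _ _ => sq_nonneg _,
    Finset.sum_eq_zero_iff_of_nonneg fun _ _ => tsum_nonneg fun _ => sq_nonneg _] at hzero
  by_cases hα : α ∈ S.central
  · exact norm_eq_zero.mp (pow_eq_zero_iff two_ne_zero |>.mp (hzero.1 ⟨α, hα⟩ (Finset.mem_univ _)))
  · obtain ⟨γ, k, rfl⟩ := S.exists_pt_of_notMem_central hα
    have h1 := (hsq γ).hasSum_iff.mpr (hzero.2 γ (Finset.mem_univ _))
    have h2 := congrFun ((hasSum_zero_iff_of_nonneg fun _ => sq_nonneg _).mp h1) k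
    exact norm_eq_zero.mp (pow_eq_zero_iff two_ne_zero |>.mp h2)

variable [DecidableEq C]

/-- If the solution has a pole at `ω₀ ∈ T_σ⁺`, its leading coefficient is an eigenfunction `φ` that
vanishes on the channel `σ` and is a multiple `ℓ γ` of the Jost solution on every other channel. -/
theorem exists_leading_solution (hT : ω₀ ∈ S.Tplus σ) (hp : ω₀ ∈ S.poles σ) :
    ∃ (m : ℕ) (ℓ : C → ℂ) (φ : A → ℂ), m ≠ 0 ∧ φ ≠ 0 ∧
      (∀ γ, γ ≠ σ → Tendsto (fun ω => S.localParam ω₀ ω ^ m * S.jostCoeff ω γ σ)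
        (𝓝[closedBall (0 : ℂ) 1 \ {ω₀}] ω₀) (𝓝 (ℓ γ))) ∧
      (∀ α, Tendsto (fun ω => S.localParam ω₀ ω ^ m * S.rawSolution σ α ω)
        (𝓝[closedBall (0 : ℂ) 1 \ {ω₀}] ω₀) (𝓝 (φ α))) ∧
      (∀ k, φ (S.pt σ k) = 0) ∧
      (∀ γ, γ ≠ σ → ∀ k, φ (S.pt γ k) = ℓ γ * S.jost γ k (S.theta γ ω₀)) ∧
      ∀ α, S.apply φ α = S.lam ω₀ * φ α := by
  have hω := S.Tplus_subset σ hT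
  have h0 := S.ne_zero_of_mem_Tplus hT
  have hne : (𝓝[closedBall (0 : ℂ) 1 \ {ω₀}] ω₀).NeBot := neBot_closedBall_diff (finite_singleton _) hω
  have hreg := S.eventually_mem_sdiff_undefinedSet ω₀
  have hjost := fun γ k => (S.continuousOn_jost_theta γ k ω₀ hω).mono (sdiff_subset (t := {ω₀}))
  obtain ⟨f, hfl, hfr⟩ : ∃ f : S.central ⊕ {γ // γ ≠ σ} → ℂ → ℂ,
      (∀ α, f (.inl α) = S.rawSolution σ α) ∧ ∀ γ, f (.inr γ) = fun ω => S.jostCoeff ω γ σ :=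
    ⟨Sum.elim (fun α => S.rawSolution σ α) (fun γ ω => S.jostCoeff ω γ σ), fun _ => rfl,
      fun _ => rfl⟩
  have hmero : ∀ i, S.MeromorphicNear (f i) ω₀ := by
    rintro (α | γ)
    · exact hfl α ▸ meromorphicNear_rawSolution hω _
    · exact hfr γ ▸ meromorphicNear_jostCoeff hω _ _
  obtain ⟨i₀, hi₀⟩ : ∃ i, Tendsto (fun ω => ‖f i ω‖) (𝓝[closedBall (0 : ℂ) 1 \ {ω₀}] ω₀) atTop := by
    obtain ⟨-, α, h⟩ := hp
    by_cases hα : α ∈ S.central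
    · exact ⟨.inl ⟨α, hα⟩, by rwa [hfl]⟩
    · obtain ⟨γ, k, rfl⟩ := S.exists_pt_of_notMem_central hα
      by_cases hγ : γ = σ
      · subst hγ
        obtain ⟨c, hc⟩ := exists_tendsto_rawSolution_self hT (k + 1)
        exact absurd hc.norm (not_tendsto_nhds_of_tendsto_atTop h _)
      · refine ⟨.inr ⟨γ, hγ⟩, ?_⟩
        rw [hfr]
        obtain ⟨M, hM0, hM⟩ := S.exists_norm_jost_le γ
        refine tendsto_atTop_mono' _ ?_ (h.atTop_div_const (show 0 < M + 1 by linarith))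
        filter_upwards [hreg] with ω h1
        rw [div_le_iff₀ (by linarith), rawSolution_pt_other h1 hγ, norm_mul]
        refine mul_le_mul_of_nonneg_left ?_ (norm_nonneg _)
        have h2 := S.norm_theta_le γ h1.1
        have h3 := mul_le_of_le_one_right hM0 (pow_le_one₀ (n := k + 1) (norm_nonneg _) h2)
        linarith [hM (k + 1) _ h2]
  obtain ⟨m, c, hm, ⟨i, hi⟩, hc⟩ := exists_leading_coefficients hω hmero hi₀
  have hcl : ∀ α : S.central, Tendsto (fun ω => S.localParam ω₀ ω ^ m * S.rawSolution σ α ω)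
      (𝓝[closedBall (0 : ℂ) 1 \ {ω₀}] ω₀) (𝓝 (c (.inl α))) := fun α => by
    simpa only [hfl] using hc (.inl α)
  have hcr : ∀ γ : {γ // γ ≠ σ}, Tendsto (fun ω => S.localParam ω₀ ω ^ m * S.jostCoeff ω γ σ)
      (𝓝[closedBall (0 : ℂ) 1 \ {ω₀}] ω₀) (𝓝 (c (.inr γ))) := fun γ => by
    simpa only [hfr] using hc (.inr γ)
  set ℓ : C → ℂ := fun γ => if h : γ ≠ σ then c (.inr ⟨γ, h⟩) else 0
  have hℓ : ∀ γ, γ ≠ σ → Tendsto (fun ω => S.localParam ω₀ ω ^ m * S.jostCoeff ω γ σ)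
      (𝓝[closedBall (0 : ℂ) 1 \ {ω₀}] ω₀) (𝓝 (ℓ γ)) := fun γ hγ => by
    have h1 : ℓ γ = c (.inr ⟨γ, hγ⟩) := dif_pos hγ
    rw [h1]
    exact hcr ⟨γ, hγ⟩
  have hother : ∀ γ, γ ≠ σ → ∀ k, Tendsto
      (fun ω => S.localParam ω₀ ω ^ m * S.rawSolution σ (S.pt γ k) ω)
      (𝓝[closedBall (0 : ℂ) 1 \ {ω₀}] ω₀) (𝓝 (ℓ γ * S.jost γ k (S.theta γ ω₀))) := fun γ hγ k => by
    refine Tendsto.congr' ?_ ((hℓ γ hγ).mul (hjost γ k))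
    filter_upwards [hreg] with ω h1
    rw [rawSolution_pt_other h1 hγ, mul_assoc]
  have hself : ∀ k, Tendsto (fun ω => S.localParam ω₀ ω ^ m * S.rawSolution σ (S.pt σ k) ω)
      (𝓝[closedBall (0 : ℂ) 1 \ {ω₀}] ω₀) (𝓝 0) := fun k => by
    obtain ⟨d, hd⟩ := exists_tendsto_rawSolution_self hT k
    have h1 := (((S.tendsto_localParam_ne hω).mono_right nhdsWithin_le_nhds).pow m).mul hd
    rwa [zero_pow hm, zero_mul] at h1
  have hex : ∀ α, ∃ x, Tendsto (fun ω => S.localParam ω₀ ω ^ m * S.rawSolution σ α ω)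
      (𝓝[closedBall (0 : ℂ) 1 \ {ω₀}] ω₀) (𝓝 x) := fun α => by
    by_cases hα : α ∈ S.central
    · exact ⟨_, hcl ⟨α, hα⟩⟩
    · obtain ⟨γ, k, rfl⟩ := S.exists_pt_of_notMem_central hα
      by_cases hγ : γ = σ
      · rw [hγ]
        exact ⟨0, hself (k + 1)⟩
      · exact ⟨_, hother γ hγ (k + 1)⟩
  choose φ hφ using hex
  have hφother : ∀ γ, γ ≠ σ → ∀ k, φ (S.pt γ k) = ℓ γ * S.jost γ k (S.theta γ ω₀) :=
    fun γ hγ k => tendsto_nhds_unique (hφ _) (hother γ hγ k)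
  refine ⟨m, ℓ, φ, hm, ?_, hℓ, hφ, fun k => tendsto_nhds_unique (hφ _) (hself k), hφother,
    fun α => ?_⟩
  · rintro h
    refine hi ?_
    rcases i with α | ⟨γ, hγ⟩
    · exact (tendsto_nhds_unique (hcl α) (hφ α)).trans (congrFun h _)
    · obtain ⟨K, hK⟩ := S.exists_forall_jost_ne_zero
      have h1 := hφother γ hγ K
      rw [h, Pi.zero_apply, zero_eq_mul, or_iff_left (hK γ _ (S.norm_theta_le γ hω)
        (S.theta_ne_zero γ hω h0))] at h1
      exact (dif_pos hγ).symm.trans h1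
  · have h1 := S.tendsto_apply hφ α
    have h2 := ((S.continuousWithinAt_lam h0 (closedBall 0 1 \ {ω₀})).tendsto).mul (hφ α)
    refine tendsto_nhds_unique h1 (Tendsto.congr' ?_ h2)
    filter_upwards [hreg] with ω h3
    rw [apply_const_mul, apply_rawSolution h3]
    ring

/-- The leading coefficient has finite energy on each channel, because the energy of the solution
is controlled by the flux through the channel `σ`, where there is no pole. -/
theorem exists_energy_le (hT : ω₀ ∈ S.Tplus σ) {m : ℕ} (hm : m ≠ 0) {φ : A → ℂ}
    (hφ : ∀ α, Tendsto (fun ω => S.localParam ω₀ ω ^ m * S.rawSolution σ α ω)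
      (𝓝[closedBall (0 : ℂ) 1 \ {ω₀}] ω₀) (𝓝 (φ α))) {γ : C} (hγ : γ ≠ σ) :
    ∃ D : ℝ, ∀ n, ∑ k ∈ Finset.range n, ‖φ (S.pt γ (k + 1))‖ ^ 2 ≤ D := by
  have hω := S.Tplus_subset σ hT
  obtain ⟨c, hc, hne⟩ := S.exists_neBot_approach hT.1
  set V := {ω | ω ∈ ball (0 : ℂ) 1 ∧ c * ‖S.localParam ω₀ ω‖ ^ 2 ≤ |(S.lam ω).im|} with hV
  have hle : 𝓝[V] ω₀ ≤ 𝓝[closedBall (0 : ℂ) 1 \ {ω₀}] ω₀ := by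
    refine nhdsWithin_mono _ fun ω h => ⟨ball_subset_closedBall h.1, ?_⟩
    rintro rfl
    have h1 := mem_sphere_zero_iff_norm.mp hT.1
    have h2 := mem_ball_zero_iff.mp h.1
    linarith
  have hreg := hle (S.eventually_mem_sdiff_undefinedSet ω₀)
  obtain ⟨d₀, hd₀⟩ := exists_tendsto_rawSolution_self hT 0
  obtain ⟨d₁, hd₁⟩ := exists_tendsto_rawSolution_self hT 1
  have ht := (S.tendsto_localParam_ne hω).mono_right nhdsWithin_le_nhds
  obtain ⟨j, rfl⟩ := Nat.exists_eq_succ_of_ne_zero hm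
  have hR := (((ht.norm.pow j).pow 2).mul ((hd₀.norm.mul hd₁.norm).const_mul (S.coefB σ 0))).mono_left hle
  refine ⟨(‖(0 : ℂ)‖ ^ j) ^ 2 * (S.coefB σ 0 * (‖d₀‖ * ‖d₁‖)) / c, fun n => ?_⟩
  · rw [le_div_iff₀ hc, mul_comm]
    have hL : Tendsto (fun ω => c * ∑ k ∈ Finset.range n,
        ‖S.localParam ω₀ ω ^ (j + 1) * S.rawSolution σ (S.pt γ (k + 1)) ω‖ ^ 2) (𝓝[V] ω₀)
        (𝓝 (c * ∑ k ∈ Finset.range n, ‖φ (S.pt γ (k + 1))‖ ^ 2)) :=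
      (tendsto_finsetSum _ fun k _ => (((hφ _).mono_left hle).norm.pow 2)).const_mul c
    refine le_of_tendsto_of_tendsto hL hR ?_
    filter_upwards [hreg, self_mem_nhdsWithin] with ω h1 h2
    have h3 := sq_im_lam_mul_energy_le (σ := σ) ⟨h2.1, h1.2⟩ n
    set e := ∑ k ∈ Finset.range n, ‖S.rawSolution σ (S.pt γ (k + 1)) ω‖ ^ 2 with he
    set x := |(S.lam ω).im| with hx
    set y := ‖S.rawSolution σ (S.pt σ 0) ω‖ * ‖S.rawSolution σ (S.pt σ 1) ω‖ with hy
    set t := ‖S.localParam ω₀ ω‖ with htdef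
    have he0 : 0 ≤ e := Finset.sum_nonneg fun _ _ => sq_nonneg _
    have ht0 : 0 < t := norm_pos_iff.mpr (S.localParam_ne_zero fun h => by
      subst h
      have h1 := mem_sphere_zero_iff_norm.mp hT.1
      have h2 := mem_ball_zero_iff.mp h2.1
      linarith)
    have hx0 : 0 < x := lt_of_lt_of_le (by positivity) h2.2
    have h4 : x ^ 2 * e ≤ x * (S.coefB σ 0 * y) := by
      have h5 : e ≤ ∑ α : S.central, ‖S.rawSolution σ α ω‖ ^ 2 + ∑ γ, ∑ k ∈ Finset.range
          (if γ = σ then 0 else n), ‖S.rawSolution σ (S.pt γ (k + 1)) ω‖ ^ 2 := by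
        have h6 := Finset.single_le_sum (f := fun γ => ∑ k ∈ Finset.range
          (if γ = σ then 0 else n), ‖S.rawSolution σ (S.pt γ (k + 1)) ω‖ ^ 2)
          (fun _ _ => Finset.sum_nonneg fun _ _ => sq_nonneg _) (Finset.mem_univ γ)
        simp only [if_neg hγ] at h6
        exact h6.trans (le_add_of_nonneg_left (Finset.sum_nonneg fun _ _ => sq_nonneg _))
      rw [hx, sq_abs]
      refine (mul_le_mul_of_nonneg_left h5 (sq_nonneg _)).trans (h3.trans ?_)
      refine (le_abs_self _).trans ?_
      rw [abs_mul, abs_mul, abs_of_pos (S.coefB_pos σ 0)]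
      refine mul_le_mul_of_nonneg_left (mul_le_mul_of_nonneg_left ?_ (S.coefB_pos σ 0).le)
        (abs_nonneg _)
      refine (Complex.abs_im_le_norm _).trans_eq ?_
      rw [norm_mul, RCLike.norm_conj]
    have h5 : x * e ≤ S.coefB σ 0 * y := by
      refine le_of_mul_le_mul_left ?_ hx0
      linarith
    calc c * ∑ k ∈ Finset.range n, ‖S.localParam ω₀ ω ^ (j + 1) *
          S.rawSolution σ (S.pt γ (k + 1)) ω‖ ^ 2 = (t ^ j) ^ 2 * (c * t ^ 2 * e) := by
          simp only [norm_mul, norm_pow, mul_pow, ← Finset.mul_sum]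
          ring
      _ ≤ (t ^ j) ^ 2 * (x * e) :=
          mul_le_mul_of_nonneg_left (mul_le_mul_of_nonneg_right h2.2 he0) (sq_nonneg _)
      _ ≤ _ := mul_le_mul_of_nonneg_left h5 (sq_nonneg _)

/-- No pole lies on `T_σ⁺`. The leading coefficient `φ` at such a pole vanishes on `σ` and has finite
energy on the other channels, hence decays on each of them; then `φ` is orthogonal to the solutions
inside the disk that converge to it, which is impossible unless `φ = 0`. -/
theorem disjoint_poles_Tplus : Disjoint (S.poles σ) (S.Tplus σ) := by
  rw [Set.disjoint_left]
  intro ω₀ hp hT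
  have hω := S.Tplus_subset σ hT
  have h0 := S.ne_zero_of_mem_Tplus hT
  obtain ⟨m, ℓ, φ, hm, hφ0, hℓ, hφ, hself, hother, happ⟩ := exists_leading_solution hT hp
  obtain ⟨l₀, hl₀, hlam⟩ := S.exists_lam_eq_of_mem_Tplus hT
  -- the oscillating Jost solutions have infinite energy
  have hosc : ∀ γ, γ ≠ σ → ‖S.theta γ ω₀‖ = 1 → ℓ γ = 0 := fun γ hγ h1 => by
    obtain ⟨D, hD⟩ := exists_energy_le hT hm hφ hγ
    by_contra hne
    have h2 : 0 < ‖ℓ γ‖ ^ 2 := by positivity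
    obtain ⟨n, hn⟩ := ((S.tendsto_sum_norm_jost γ h1).const_mul_atTop h2 |>.eventually_gt_atTop
      D).exists
    refine (hD n).not_gt ?_
    simpa only [hother γ hγ, norm_mul, mul_pow, ← Finset.mul_sum] using hn
  have hle : 𝓝[ball (0 : ℂ) 1 \ S.undefinedSet] ω₀ ≤ 𝓝[closedBall (0 : ℂ) 1 \ {ω₀}] ω₀ :=
    nhdsWithin_mono _ fun ω h => ⟨ball_subset_closedBall h.1, fun h' =>
      h.2 (h' ▸ poles_subset_undefinedSet hp)⟩
  have hne : (𝓝[ball (0 : ℂ) 1 \ S.undefinedSet] ω₀).NeBot :=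
    neBot_ball_diff S.undefinedSet_finite hω
  refine hφ0 (funext fun α => eq_zero_of_tendsto_of_decay (S := S) (l₀ := l₀)
    (F := 𝓝[ball (0 : ℂ) 1 \ S.undefinedSet] ω₀) (Ψ := fun ω α => S.localParam ω₀ ω ^ m *
    S.rawSolution σ α ω) (hlam ▸ happ) ?_ ?_ (fun α => (hφ α).mono_left hle) (fun γ => ?_) ?_ α)
  · filter_upwards [self_mem_nhdsWithin] with ω h α
    rw [apply_const_mul, apply_rawSolution (ball_diff_subset h)]
    ring
  · filter_upwards [self_mem_nhdsWithin] with ω h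
    exact S.lam_ne_ofReal h.1 (ne_zero_of_notMem (ball_diff_subset h)) (S.band_subset σ hl₀)
  · by_cases hγ : γ = σ
    · exact ⟨0, 0, le_rfl, one_pos, .of_forall fun ω k => by simp [hγ, hself]⟩
    by_cases h1 : ‖S.theta γ ω₀‖ = 1
    · exact ⟨0, 0, le_rfl, one_pos, .of_forall fun ω k => by simp [hother γ hγ, hosc γ hγ h1]⟩
    have h2 : ‖S.theta γ ω₀‖ < 1 := lt_of_le_of_ne (S.norm_theta_le γ hω) h1
    obtain ⟨M, hM0, hM⟩ := S.exists_norm_jost_le γ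
    refine ⟨(‖ℓ γ‖ + 1) * M * (‖ℓ γ‖ * M), ‖S.theta γ ω₀‖, norm_nonneg _, h2, ?_⟩
    filter_upwards [((hℓ γ hγ).mono_left hle).norm.eventually_lt_const (lt_add_one _),
      self_mem_nhdsWithin] with ω h3 h4 k
    have h5 := S.norm_theta_le γ (ball_subset_closedBall h4.1)
    rw [rawSolution_pt_other (ball_diff_subset h4) hγ, hother γ hγ, norm_mul, RCLike.norm_conj,
      ← mul_assoc, norm_mul, norm_mul (ℓ γ), mul_assoc _ _ (‖S.theta γ ω₀‖ ^ k),
      mul_assoc _ M (‖S.theta γ ω₀‖ ^ k)]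
    refine mul_le_mul (mul_le_mul h3.le ?_ (norm_nonneg _) (by positivity))
      (mul_le_mul_of_nonneg_left ?_ (norm_nonneg _)) (by positivity) (by positivity)
    · exact (hM _ _ h5).trans (mul_le_of_le_one_right hM0 (pow_le_one₀ (norm_nonneg _) h5))
    · refine (hM _ _ h2.le).trans (mul_le_mul_of_nonneg_left ?_ hM0)
      exact pow_le_pow_of_le_one (norm_nonneg _) h2.le (Nat.le_succ k)
  · filter_upwards [self_mem_nhdsWithin] with ω h γ
    by_cases hγ : γ = σ
    · subst hγ
      simp only [hself, map_zero]
      refine Tendsto.congr (fun k => ?_) tendsto_const_nhds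
      simp [casoratian]
    · have h' := ball_diff_subset h
      have h1 := S.theta_ne_zero γ h'.1 (ne_zero_of_notMem h')
      have h2 := S.theta_ne_zero γ hω h0
      obtain ⟨d, hd⟩ := exists_tendsto_rawSolution_other h' hγ
      refine tendsto_casoratian_zero (S.tendsto_coefB γ) (θ₁ := S.theta γ ω)
        (θ₂ := starRingEnd ℂ (S.theta γ ω₀)) h1 ((map_ne_zero _).mpr h2) ?_
        ⟨_, (hd.const_mul (S.localParam ω₀ ω ^ m)).congr fun k => mul_div_assoc' _ _ _⟩
        ⟨starRingEnd ℂ (ℓ γ * 1), ?_⟩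
      · rw [norm_mul, RCLike.norm_conj]
        exact mul_lt_one_of_nonneg_of_lt_one_left (norm_nonneg _)
          (S.norm_theta_lt_of_mem_ball γ h.1) (S.norm_theta_le γ hω)
      · refine ((Complex.continuous_conj.tendsto _).comp
          ((S.tendsto_jost γ (S.norm_theta_le γ hω) h2).const_mul (ℓ γ))).congr fun k => ?_
        simp [hother γ hγ, mul_div_assoc]

/-! ### Assembling the special solution -/

/-- The scattering coefficients `s_{γσ}`, read off from the values at the `K`-th particle of each
channel. They do not depend on `K` as long as the Jost solution does not vanish there. -/
noncomputable def scattering (S : WebSystem A C) (σ : C) (K : ℕ) (γ : C) (ω : ℂ) : ℂ :=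
  if γ = σ then (S.specialSolution σ (S.pt σ K) ω - S.jost σ K (S.theta σ ω)⁻¹) /
    S.jost σ K (S.theta σ ω)
  else S.specialSolution σ (S.pt γ K) ω / S.jost γ K (S.theta γ ω)

theorem scattering_of_ne {γ : C} (hγ : γ ≠ σ) (K : ℕ) : S.scattering σ K γ =
    fun ω => S.specialSolution σ (S.pt γ K) ω / S.jost γ K (S.theta γ ω) :=
  funext fun _ => if_neg hγ

theorem meromorphicNear_scattering (hω : ω₀ ∈ closedBall (0 : ℂ) 1) {γ : C} (hγ : γ ≠ σ) (K : ℕ) :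
    S.MeromorphicNear (S.scattering σ K γ) ω₀ := by
  rw [scattering_of_ne hγ]
  exact (meromorphicNear_specialSolution hω _).div
    (S.holomorphicNear_jost_theta γ K hω).meromorphicNear

theorem isSpecialSolution {K : ℕ} (hK : ∀ γ θ, ‖θ‖ ≤ 1 → θ ≠ 0 → S.jost γ K θ ≠ 0) :
    S.IsSpecialSolution σ (S.poles σ) (S.specialSolution σ) (S.scattering σ K) where
  finite := S.undefinedSet_finite.subset poles_subset_undefinedSet
  subset := fun _ h => h.1
  holomorphic := fun α _ h => holomorphicNear_specialSolution h α
  meromorphic := fun α _ h => meromorphicNear_specialSolution h.1 α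
  pole := fun ω₀ h => by
    obtain ⟨α, hα⟩ := h.2
    refine ⟨α, hα.congr' ?_⟩
    filter_upwards [S.eventually_mem_sdiff_undefinedSet ω₀] with ω hω
    rw [specialSolution_eq hω]
  disjoint := disjoint_poles_Tplus
  equation := fun _ h α => apply_specialSolution h α
  s_holomorphic := fun γ hγ ω₀ h => by
    refine (meromorphicNear_scattering h.1 hγ K).holomorphicNear h.1 ?_
    rw [scattering_of_ne hγ]
    exact (continuousWithinAt_specialSolution h _).div (S.continuousOn_jost_theta γ K _ h.1)
      (hK γ _ (S.norm_theta_le γ h.1) (S.theta_ne_zero γ h.1 (ne_zero_of_notMem_poles h)))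
  s_meromorphic := fun γ hγ ω₀ h => meromorphicNear_scattering h.1 hγ K
  s_continuous := fun ω hω => by
    have h := S.Tplus_subset σ hω
    have hs : S.scattering σ K σ = fun ω => (S.specialSolution σ (S.pt σ K) ω -
        S.jost σ K (S.theta σ ω)⁻¹) / S.jost σ K (S.theta σ ω) := funext fun _ => if_pos rfl
    rw [hs]
    refine (((continuousWithinAt_specialSolution ⟨h, fun h' =>
      Set.disjoint_left.mp disjoint_poles_Tplus h' hω⟩ _).mono (S.Tplus_subset σ)).sub
      (S.continuousOn_jost_inv_theta σ K ω hω)).div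
      ((S.continuousOn_jost_theta σ K ω h).mono (S.Tplus_subset σ))
      (hK σ _ hω.2.le (S.theta_ne_zero σ h (S.ne_zero_of_mem_Tplus hω)))
  along_self := fun ω hω k => by
    have h := S.Tplus_subset σ hω
    rw [scattering, if_pos rfl]
    exact specialSolution_self_eq ⟨h, fun h' => Set.disjoint_left.mp disjoint_poles_Tplus h' hω⟩ hω
      (hK σ _ hω.2.le (S.theta_ne_zero σ h (S.ne_zero_of_mem_Tplus hω))) k
  along_other := fun γ hγ ω h k => by
    rw [scattering, if_neg hγ]
    exact specialSolution_other_eq h hγ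
      (hK γ _ (S.norm_theta_le γ h.1) (S.theta_ne_zero γ h.1 (ne_zero_of_notMem_poles h))) k
  along_self_off := fun ω h hT => tendsto_specialSolution_self h hT

end WebSystem

theorem mainTheorem2 {A C : Type*} [Fintype C] [DecidableEq C] (S : WebSystem A C) :
    S.undefinedSet.Finite ∧
    (∀ ω ∈ closedBall (0 : ℂ) 1 \ S.undefinedSet,
      (∀ (σ γ : C) (k : ℕ),
        -(S.coefB γ k : ℂ) * S.U k ω γ σ + S.coefA γ (k + 1) * S.U (k + 1) ω γ σ
          - S.coefB γ (k + 1) * S.U (k + 2) ω γ σ = S.lam ω * S.U (k + 1) ω γ σ) ∧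
      S.U 0 ω = S.R (S.lam ω) * S.B0 * S.U 1 ω) ∧
    ∀ σ : C, ∃ (O : Set ℂ) (ψ : A → ℂ → ℂ) (s : C → ℂ → ℂ),
      S.IsSpecialSolution σ O ψ s ∧
      ∀ ω ∈ closedBall (0 : ℂ) 1 \ S.undefinedSet,
        (∀ (γ : C) (k : ℕ), ψ (S.pt γ k) ω = S.U k ω γ σ) ∧
        ∀ α : S.central, ψ α ω =
          ∑ ν, S.r (S.lam ω) α (S.attach ν) * S.coefB ν 0 * ψ (S.pt ν 1) ω := by
  refine ⟨S.undefinedSet_finite, fun ω h => ⟨fun σ γ k => ?_, S.U_boundary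
    (WebSystem.det_T_ne_zero_of_notMem h)⟩, fun σ => ?_⟩
  · exact S.isChannelSolution_U h.1 (WebSystem.ne_zero_of_notMem h) γ σ k
  · obtain ⟨K, hK⟩ := S.exists_forall_jost_ne_zero
    refine ⟨S.poles σ, S.specialSolution σ, S.scattering σ K, WebSystem.isSpecialSolution hK,
      fun ω h => ⟨fun γ k => ?_, fun α => ?_⟩⟩
    · rw [WebSystem.specialSolution_eq h, WebSystem.rawSolution_pt h]
    · simp only [WebSystem.specialSolution_eq h, WebSystem.rawSolution_central,
        WebSystem.rawSolution_pt_succ _ 0]
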